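/- Let $V$ be a finite-dimensional complex Hermitian vector space and let $W\subset U(V)$ be a finite irreducible group generated by (complex) reflections. Let $\mathcal A$ be the set of its reflecting hyperplanes, $X=V\setminus\bigcup_{H\in\mathcal A}H$, and let $\mathcal C$ be the set of all (possibly empty) sums of the lines $H^\perp$, $H\in\mathcal A$. A decomposition of $U\in\mathcal C$ is a family of $k>1$ nonzero $U_1,\dots,U_k\in\mathcal C$ with $U=U_1\oplus\dots\oplus U_k$ such that for every $B\in\mathcal C$ with $B\subset U$ all $B\cap U_i$ lie in $\mathcal C$ and $B=\bigoplus_i (B\cap U_i)$. Let $\mathcal F_W$ be the set of nonzero elements of $\mathcal C$ that have no decomposition. The minimal wonderful model $\overline X_W$ is the closure of the image of $X$ in $V\times\prod_{D\in\mathcal F_W}\mathbb P(V/D^\perp)$ under the natural map; identify $V/D^\perp$ with $D$. The group $W$ acts on $\overline X_W$; let $\overline Y_W=\overline X_W/W$. For $A\in\mathcal F_W$ let $\mathcal D_A$ be the irreducible component of the boundary $\overline X_W\setminus X$ whose projection to $V$ is $A^\perp$, let $\mathcal L_A=\bigl(\bigcup_{w\in W}\mathcal D_{wA}\bigr)/W\subset\overline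 Y_W$, and let $W_A\subset W$ be the subgroup of the elements that fix $A^\perp$ pointwise. A vector of $A$ is Springer regular if it lies in no reflecting hyperplane of $W_A$ and is an eigenvector of some $g\in W_A$ that does not act on $A$ as a scalar. A point $\omega\in\mathcal D_A$ is Springer generic if it lies on no other irreducible component of the boundary and its component $l\in\mathbb P(V/A^\perp)=\mathbb P(A)$ is not spanned by a Springer regular vector. The Springer generic points of $\mathcal L_A$ are the images of the Springer generic points of $\mathcal D_A$. Proposition. Let $A\in\mathcal F_W$. 1. $\mathcal L_A$ is smooth, of dimension $\dim V-1$, at each of its Springer generic points. 2. Let $\omega\in\mathcal D_A$ be Springer generic. The stabilizer of $\omega$ in $W$ is the center $Z(W_A)$. The normal space $T_\omega\overline X_W/T_\omega\mathcal D_A$ is one-dimensional. With $m=|Z(W_A)|$, there are a generator $\rho$ of $Z(W_A)$ and a primitive $m$-th root of unity $\varepsilon$ such that $\rho$ acts as $\varepsilon$ on $A$ and as the identity on $A^\perp$, and the differential of $\rho$ at $\omega$ acts on the normal space as multiplication by $\varepsilon$. -/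

import Mathlib

open Set Topology
open scoped LinearAlgebra.Projectivization

set_option linter.unusedSectionVars false

noncomputable section

namespace Wonderful

/-- The usual topology of a projective space: the quotient topology from the nonzero vectors. -/
instance projTopology {E : Type*} [AddCommGroup E] [Module ℂ E] [TopologicalSpace E] :
    TopologicalSpace (ℙ ℂ E) :=
  TopologicalSpace.coinduced (Projectivization.mk' ℂ (V := E)) inferInstance

variable {V : Type*} [NormedAddCommGroup V] [InnerProductSpace ℂ V] [FiniteDimensional ℂ V]

/-! ### Complex reflection groups and their arrangements -/

/-- The subspace of vectors fixed by `g`. -/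
def fixedSpace (g : V ≃ₗᵢ[ℂ] V) : Submodule ℂ V where
  carrier := {v | g v = v}
  add_mem' := by
    intro a b ha hb
    simp only [Set.mem_ofPred_eq, map_add] at *
    rw [ha, hb]
  zero_mem' := by simp
  smul_mem' := by
    intro c a ha
    simp only [Set.mem_ofPred_eq, map_smul] at *
    rw [ha]

/-- A (complex, unitary) reflection: its fixed space is a hyperplane. -/
def IsReflection (g : V ≃ₗᵢ[ℂ] V) : Prop :=
  Module.finrank ℂ (fixedSpace g) + 1 = Module.finrank ℂ V

/-- `W` is generated by the reflections that it contains. -/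
def IsReflectionGroup (W : Subgroup (V ≃ₗᵢ[ℂ] V)) : Prop :=
  Subgroup.closure {g | g ∈ W ∧ IsReflection g} = W

/-- The image `g U` of a subspace `U`. -/
def move (g : V ≃ₗᵢ[ℂ] V) (U : Submodule ℂ V) : Submodule ℂ V :=
  U.map (g.toLinearEquiv : V →ₗ[ℂ] V)

/-- `W` acts irreducibly on `V`. -/
def ActsIrreducibly (W : Subgroup (V ≃ₗᵢ[ℂ] V)) : Prop :=
  ∀ U : Submodule ℂ V, (∀ w ∈ W, move w U ≤ U) → U = ⊥ ∨ U = ⊤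

/-- The arrangement of `W`: the reflecting hyperplanes of the reflections in `W`. -/
def arrangement (W : Subgroup (V ≃ₗᵢ[ℂ] V)) : Set (Submodule ℂ V) :=
  {H | ∃ g ∈ W, IsReflection g ∧ H = fixedSpace g}

/-- The complement `X_W` of the arrangement. -/
def complement (W : Subgroup (V ≃ₗᵢ[ℂ] V)) : Set V :=
  {v | ∀ H ∈ arrangement W, v ∉ H}

/-- The closure under (possibly empty) sums of the set of the lines `Hᗮ`, `H` in the
arrangement. -/
def sumClosure (W : Subgroup (V ≃ₗᵢ[ℂ] V)) : Set (Submodule ℂ V) :=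
  {U | ∃ S : Set (Submodule ℂ V), S ⊆ arrangement W ∧ U = sSup ((fun H : Submodule ℂ V => Hᗮ) '' S)}

/-- `u` is a decomposition of `U` in `sumClosure W`. -/
def IsDecomposition (W : Subgroup (V ≃ₗᵢ[ℂ] V)) (U : Submodule ℂ V) (k : ℕ)
    (u : Fin k → Submodule ℂ V) : Prop :=
  1 < k ∧ (∀ i, u i ≠ ⊥ ∧ u i ∈ sumClosure W) ∧ iSupIndep u ∧ (⨆ i, u i) = U ∧
    ∀ B ∈ sumClosure W, B ≤ U → (∀ i, B ⊓ u i ∈ sumClosure W) ∧ (⨆ i, B ⊓ u i) = B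

/-- The set `F_W` of irreducible subspaces. -/
def irreducibles (W : Subgroup (V ≃ₗᵢ[ℂ] V)) : Set (Submodule ℂ V) :=
  {U | U ∈ sumClosure W ∧ U ≠ ⊥ ∧ ¬ ∃ k u, IsDecomposition W U k u}

/-- The parabolic subgroup `W_A` of the elements of `W` that fix `Aᗮ` pointwise. -/
def parabolic (W : Subgroup (V ≃ₗᵢ[ℂ] V)) (A : Submodule ℂ V) : Subgroup (V ≃ₗᵢ[ℂ] V) where
  carrier := {g | g ∈ W ∧ ∀ v ∈ Aᗮ, g v = v}
  mul_mem' := by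
    rintro a b ⟨ha, ha'⟩ ⟨hb, hb'⟩
    refine ⟨W.mul_mem ha hb, fun v hv => ?_⟩
    rw [LinearIsometryEquiv.coe_mul, Function.comp_apply, hb' v hv, ha' v hv]
  one_mem' := ⟨W.one_mem, fun v _ => rfl⟩
  inv_mem' := by
    rintro a ⟨ha, ha'⟩
    refine ⟨W.inv_mem ha, fun v hv => ?_⟩
    rw [LinearIsometryEquiv.coe_inv, LinearIsometryEquiv.symm_apply_eq, ha' v hv]

/-! ### `W` permutes the irreducible subspaces -/

lemma mem_move {g : V ≃ₗᵢ[ℂ] V} {U : Submodule ℂ V} {v : V} :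
    v ∈ move g U ↔ g⁻¹ v ∈ U := by
  unfold move
  rw [Submodule.mem_map]
  constructor
  · rintro ⟨u, hu, rfl⟩
    have : g⁻¹ (g u) = u := g.symm_apply_apply u
    exact this.symm ▸ hu
  · intro h
    exact ⟨g⁻¹ v, h, g.apply_symm_apply v⟩

lemma move_one (U : Submodule ℂ V) : move 1 U = U := by
  ext v; rw [mem_move]; simp

lemma move_mul (g h : V ≃ₗᵢ[ℂ] V) (U : Submodule ℂ V) : move (g * h) U = move g (move h U) := by
  ext v; rw [mem_move, mem_move, mem_move, mul_inv_rev]; rfl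

lemma move_inv_move (g : V ≃ₗᵢ[ℂ] V) (U : Submodule ℂ V) : move g⁻¹ (move g U) = U := by
  rw [← move_mul, inv_mul_cancel, move_one]

lemma move_move_inv (g : V ≃ₗᵢ[ℂ] V) (U : Submodule ℂ V) : move g (move g⁻¹ U) = U := by
  rw [← move_mul, mul_inv_cancel, move_one]

lemma move_mono (g : V ≃ₗᵢ[ℂ] V) {U U' : Submodule ℂ V} (h : U ≤ U') : move g U ≤ move g U' :=
  Submodule.map_mono h

/-- The action of `g` on the lattice of subspaces. -/
def moveIso (g : V ≃ₗᵢ[ℂ] V) : Submodule ℂ V ≃o Submodule ℂ V where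
  toFun := move g
  invFun := move g⁻¹
  left_inv := move_inv_move g
  right_inv := move_move_inv g
  map_rel_iff' := by
    intro a b
    refine ⟨fun h => ?_, move_mono g⟩
    have := move_mono g⁻¹ h
    simpa only [Equiv.coe_fn_mk, move_inv_move] using this

lemma move_orthogonal (g : V ≃ₗᵢ[ℂ] V) (U : Submodule ℂ V) : move g Uᗮ = (move g U)ᗮ :=
  Submodule.map_orthogonal_equiv U g

lemma fixedSpace_conj (g h : V ≃ₗᵢ[ℂ] V) : fixedSpace (g * h * g⁻¹) = move g (fixedSpace h) := by
  ext v
  rw [mem_move]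
  change g (h (g⁻¹ v)) = v ↔ h (g⁻¹ v) = g⁻¹ v
  exact ⟨fun e => by rw [← g.symm_apply_apply (h (g⁻¹ v)), e]; rfl,
    fun e => by rw [e]; exact g.apply_symm_apply v⟩

lemma finrank_move (g : V ≃ₗᵢ[ℂ] V) (U : Submodule ℂ V) :
    Module.finrank ℂ (move g U) = Module.finrank ℂ U :=
  LinearEquiv.finrank_map_eq g.toLinearEquiv U

variable {W : Subgroup (V ≃ₗᵢ[ℂ] V)}

lemma move_mem_arrangement {g : V ≃ₗᵢ[ℂ] V} (hg : g ∈ W) {H : Submodule ℂ V}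
    (hH : H ∈ arrangement W) : move g H ∈ arrangement W := by
  obtain ⟨r, hr, href, rfl⟩ := hH
  refine ⟨g * r * g⁻¹, W.mul_mem (W.mul_mem hg hr) (W.inv_mem hg), ?_, (fixedSpace_conj g r).symm⟩
  unfold IsReflection at *
  rw [fixedSpace_conj, finrank_move, href]

lemma move_mem_sumClosure {g : V ≃ₗᵢ[ℂ] V} (hg : g ∈ W) {U : Submodule ℂ V}
    (hU : U ∈ sumClosure W) : move g U ∈ sumClosure W := by
  obtain ⟨S, hS, rfl⟩ := hU
  refine ⟨move g '' S, ?_, ?_⟩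
  · rintro _ ⟨H, hH, rfl⟩
    exact move_mem_arrangement hg (hS hH)
  · change moveIso g _ = _
    rw [OrderIso.map_sSup, sSup_image, iSup_image, iSup_image]
    exact iSup_congr fun H => iSup_congr fun _ => move_orthogonal g H

lemma IsDecomposition.move {g : V ≃ₗᵢ[ℂ] V} (hg : g ∈ W) {U : Submodule ℂ V} {k : ℕ}
    {u : Fin k → Submodule ℂ V} (h : IsDecomposition W U k u) :
    IsDecomposition W (move g U) k (fun i => Wonderful.move g (u i)) := by
  obtain ⟨h1, h2, h3, h4, h5⟩ := h
  refine ⟨h1, fun i => ⟨fun e => (h2 i).1 ?_, move_mem_sumClosure hg (h2 i).2⟩, ?_, ?_, ?_⟩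
  · have : moveIso g (u i) = ⊥ := e
    rwa [map_eq_bot_iff] at this
  · exact h3.map_orderIso (moveIso g)
  · rw [← h4]
    exact ((moveIso g).map_iSup u).symm
  · intro B hB hBU
    have hB' : Wonderful.move g⁻¹ B ≤ U := by
      have := move_mono g⁻¹ hBU
      rwa [move_inv_move] at this
    obtain ⟨a, b⟩ := h5 _ (move_mem_sumClosure (W.inv_mem hg) hB) hB'
    have key : ∀ i, B ⊓ Wonderful.move g (u i)
        = Wonderful.move g (Wonderful.move g⁻¹ B ⊓ u i) := fun i => by
      have := (moveIso g).map_inf (Wonderful.move g⁻¹ B) (u i)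
      have e : moveIso g (Wonderful.move g⁻¹ B) = B := move_move_inv g B
      rw [e] at this
      exact this.symm
    refine ⟨fun i => ?_, ?_⟩
    · rw [key]
      exact move_mem_sumClosure hg (a i)
    · simp only [key]
      have := (moveIso g).map_iSup (fun i => Wonderful.move g⁻¹ B ⊓ u i)
      rw [b] at this
      exact this.symm.trans (move_move_inv g B)

lemma move_mem_irreducibles {g : V ≃ₗᵢ[ℂ] V} (hg : g ∈ W) {U : Submodule ℂ V}
    (hU : U ∈ irreducibles W) : move g U ∈ irreducibles W := by
  obtain ⟨h1, h2, h3⟩ := hU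
  refine ⟨move_mem_sumClosure hg h1, fun e => h2 ?_, ?_⟩
  · have : moveIso g U = ⊥ := e
    rwa [map_eq_bot_iff] at this
  · rintro ⟨k, u, h⟩
    have := h.move (W.inv_mem hg)
    rw [move_inv_move] at this
    exact h3 ⟨k, _, this⟩

lemma move_inv_mem (w : W) (D : irreducibles W) :
    move (w : V ≃ₗᵢ[ℂ] V)⁻¹ (D : Submodule ℂ V) ∈ irreducibles W :=
  move_mem_irreducibles (W.inv_mem w.2) D.2

instance finiteIrreducibles [Finite W] : Finite (irreducibles W) := by
  have h1 : (arrangement W).Finite := by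
    refine (Set.finite_range (fun w : W => fixedSpace (w : V ≃ₗᵢ[ℂ] V))).subset ?_
    rintro _ ⟨g, hg, -, rfl⟩
    exact ⟨⟨g, hg⟩, rfl⟩
  have h2 : (sumClosure W).Finite := by
    refine (h1.finite_subsets.image
      (fun S => sSup ((fun H : Submodule ℂ V => Hᗮ) '' S))).subset ?_
    rintro _ ⟨S, hS, rfl⟩
    exact ⟨S, hS, rfl⟩
  exact (h2.subset fun U hU => hU.1).to_subtype

instance fintypeIrreducibles [Finite W] : Fintype (irreducibles W) := Fintype.ofFinite _

/-! ### The ambient product of projective spaces and the wonderful model -/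

variable (W)

/-- The product `V × ∏_D ℙ(V / Dᗮ)` over the irreducible subspaces `D`, where `V / Dᗮ` is
identified with `D` by the orthogonal projection. -/
abbrev Ambient : Type _ := V × ((D : irreducibles W) → ℙ ℂ (D : Submodule ℂ V))

/-- The vector space `V × ∏_D V / Dᗮ`; its points with all components in the second factor
nonzero are systems of homogeneous coordinates of points of `Ambient W`. -/
abbrev Coord : Type _ := V × ((D : irreducibles W) → (D : Submodule ℂ V))

variable {W}

/-- `m` is a system of homogeneous coordinates of `ω`. -/
def IsLift (m : Coord W) (ω : Ambient W) : Prop :=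
  m.1 = ω.1 ∧ ∀ D, ∃ h : m.2 D ≠ 0, Projectivization.mk ℂ (m.2 D) h = ω.2 D

lemma proj_ne_zero {v : V} (hv : v ∈ complement W) (D : irreducibles W) :
    (D : Submodule ℂ V).orthogonalProjectionOnto v ≠ 0 := by
  obtain ⟨U, ⟨⟨S, hS, rfl⟩, h2, -⟩⟩ := D
  intro h0
  obtain ⟨H, hH⟩ : S.Nonempty := by
    by_contra hne
    rw [Set.not_nonempty_iff_eq_empty] at hne
    subst hne
    simp at h2
  rw [Submodule.orthogonalProjectionOnto_eq_zero_iff] at h0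
  have hle : Hᗮ ≤ sSup ((fun H : Submodule ℂ V => Hᗮ) '' S) := le_sSup ⟨H, hH, rfl⟩
  have := Submodule.orthogonal_le hle h0
  rw [Submodule.orthogonal_orthogonal] at this
  exact hv H (hS hH) this

/-- The map of `X_W` to `V × ∏_D ℙ(V / Dᗮ)`. -/
def embed (v : complement W) : Ambient W :=
  (v, fun D => Projectivization.mk ℂ ((D : Submodule ℂ V).orthogonalProjectionOnto (v : V))
    (proj_ne_zero v.2 D))

variable (W)

/-- The minimal wonderful model: the closure of the image of `embed`. -/
abbrev Model : Type _ := {ω : Ambient W // ω ∈ closure (range (embed (W := W)))}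

variable {W}

/-- The action of `w` from `w⁻¹ D` to `D`. -/
def moveLin (w : W) (D : irreducibles W) :
    (move (w : V ≃ₗᵢ[ℂ] V)⁻¹ (D : Submodule ℂ V) : Submodule ℂ V) →ₗ[ℂ] (D : Submodule ℂ V) :=
  LinearMap.restrict ((w : V ≃ₗᵢ[ℂ] V).toLinearEquiv : V →ₗ[ℂ] V) (fun x hx => by
    rw [mem_move, inv_inv] at hx
    exact hx)

lemma moveLin_injective (w : W) (D : irreducibles W) : Function.Injective (moveLin w D) := by
  intro a b h
  have h' := congrArg Subtype.val h
  exact Subtype.ext ((w : V ≃ₗᵢ[ℂ] V).injective h')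

/-- The action of `W` on the ambient product: `w (x, (l_D)_D) = (w x, (w l_{w⁻¹ D})_D)`. -/
instance ambientSMul : SMul W (Ambient W) where
  smul w ω := ((w : V ≃ₗᵢ[ℂ] V) ω.1, fun D =>
    Projectivization.map (moveLin w D) (moveLin_injective w D)
      (ω.2 ⟨move (w : V ≃ₗᵢ[ℂ] V)⁻¹ (D : Submodule ℂ V), move_inv_mem w D⟩))

/-- The linear action of `w` on homogeneous coordinates. -/
def coordMap (w : W) : Coord W →ₗ[ℂ] Coord W where
  toFun m := ((w : V ≃ₗᵢ[ℂ] V) m.1, fun D =>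
    moveLin w D (m.2 ⟨move (w : V ≃ₗᵢ[ℂ] V)⁻¹ (D : Submodule ℂ V), move_inv_mem w D⟩))
  map_add' a b := by
    ext <;> simp
  map_smul' c a := by
    ext <;> simp

lemma exists_lift (ω : Ambient W) : ∃ m : Coord W, IsLift m ω :=
  ⟨(ω.1, fun D => (ω.2 D).rep), rfl,
    fun D => ⟨(ω.2 D).rep_nonzero, Projectivization.mk_rep _⟩⟩

lemma IsLift.unique {m : Coord W} {ω ω' : Ambient W} (h : IsLift m ω) (h' : IsLift m ω') :
    ω = ω' := by
  refine Prod.ext (h.1.symm.trans h'.1) (funext fun D => ?_)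
  obtain ⟨_, e⟩ := h.2 D
  obtain ⟨_, e'⟩ := h'.2 D
  rw [← e, ← e']

lemma IsLift.smul {m : Coord W} {ω : Ambient W} (h : IsLift m ω) (w : W) :
    IsLift (coordMap w m) (w • ω) := by
  refine ⟨congrArg (w : V ≃ₗᵢ[ℂ] V) h.1, fun D => ?_⟩
  obtain ⟨h0, e⟩ := h.2 ⟨move (w : V ≃ₗᵢ[ℂ] V)⁻¹ (D : Submodule ℂ V), move_inv_mem w D⟩
  refine ⟨fun h1 => h0 (moveLin_injective w D (h1.trans (map_zero _).symm)), ?_⟩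
  change _ = Projectivization.map (moveLin w D) (moveLin_injective w D) _
  rw [← e, Projectivization.map_mk]
  rfl

lemma coord_congr (m : Coord W) {D D' : irreducibles W} (h : D = D') :
    ((m.2 D : (D : Submodule ℂ V)) : V) = (m.2 D' : (D' : Submodule ℂ V)) := by
  subst h; rfl

lemma coordMap_one (m : Coord W) : coordMap 1 m = m := by
  refine Prod.ext rfl (funext fun D => Subtype.ext ?_)
  have e : move ((1 : W) : V ≃ₗᵢ[ℂ] V)⁻¹ (D : Submodule ℂ V) = D := by
    rw [OneMemClass.coe_one, inv_one, move_one]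
  exact coord_congr m (D := ⟨_, move_inv_mem 1 D⟩) (Subtype.ext e)

lemma coordMap_mul (w w' : W) (m : Coord W) :
    coordMap (w * w') m = coordMap w (coordMap w' m) := by
  refine Prod.ext rfl (funext fun D => Subtype.ext ?_)
  change (w : V ≃ₗᵢ[ℂ] V) ((w' : V ≃ₗᵢ[ℂ] V) _) = (w : V ≃ₗᵢ[ℂ] V) ((w' : V ≃ₗᵢ[ℂ] V) _)
  congr 2
  exact coord_congr m (Subtype.ext (by
    change move ((w : V ≃ₗᵢ[ℂ] V) * (w' : V ≃ₗᵢ[ℂ] V))⁻¹ (D : Submodule ℂ V) = _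
    rw [mul_inv_rev, move_mul]))

instance ambientAction : MulAction W (Ambient W) where
  one_smul ω := by
    obtain ⟨m, hm⟩ := exists_lift ω
    have h := hm.smul 1
    rw [coordMap_one] at h
    exact h.unique hm
  mul_smul w w' ω := by
    obtain ⟨m, hm⟩ := exists_lift ω
    have h := hm.smul (w * w')
    rw [coordMap_mul] at h
    exact h.unique ((hm.smul w').smul w)

lemma continuous_projMap {E F : Type*} [AddCommGroup E] [Module ℂ E] [TopologicalSpace E]
    [AddCommGroup F] [Module ℂ F] [TopologicalSpace F] (f : E →ₗ[ℂ] F)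
    (hf : Function.Injective f) (hc : Continuous f) :
    Continuous (Projectivization.map f hf) := by
  rw [continuous_coinduced_dom]
  have h1 : Continuous (fun v : {v : E // v ≠ 0} =>
      (⟨f v, fun c => v.2 (hf (by simp [c]))⟩ : {v : F // v ≠ 0})) :=
    Continuous.subtype_mk (hc.comp continuous_subtype_val) _
  exact (continuous_coinduced_rng (f := Projectivization.mk' ℂ (V := F))).comp h1

lemma continuous_smul_ambient (w : W) : Continuous (fun ω : Ambient W => w • ω) := by
  refine Continuous.prodMk ((w : V ≃ₗᵢ[ℂ] V).continuous.comp continuous_fst) ?_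
  refine continuous_pi fun D => ?_
  exact (continuous_projMap _ _ (LinearMap.continuous_of_finiteDimensional _)).comp
    ((continuous_apply _).comp continuous_snd)

lemma smul_mem_complement (w : W) {v : V} (hv : v ∈ complement W) :
    (w : V ≃ₗᵢ[ℂ] V) v ∈ complement W := by
  intro H hH hvH
  refine hv _ (move_mem_arrangement (W.inv_mem w.2) hH) ?_
  rw [mem_move, inv_inv]
  exact hvH

lemma smul_embed (w : W) (v : complement W) :
    w • embed v = embed ⟨(w : V ≃ₗᵢ[ℂ] V) v, smul_mem_complement w v.2⟩ := by
  have h : IsLift ((v : V), fun D : irreducibles W =>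
      (D : Submodule ℂ V).orthogonalProjectionOnto (v : V)) (embed v) :=
    ⟨rfl, fun D => ⟨proj_ne_zero v.2 D, rfl⟩⟩
  refine (h.smul w).unique ⟨rfl, fun D => ?_⟩
  have key : (coordMap w ((v : V), fun D : irreducibles W =>
      (D : Submodule ℂ V).orthogonalProjectionOnto (v : V))).2 D =
      (D : Submodule ℂ V).orthogonalProjectionOnto ((w : V ≃ₗᵢ[ℂ] V) v) := by
    symm
    refine Subtype.ext (Submodule.eq_starProjection_of_mem_orthogonal (Subtype.property _) ?_)
    have e : (w : V ≃ₗᵢ[ℂ] V) (v : V) - (w : V ≃ₗᵢ[ℂ] V)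
        ((move (w : V ≃ₗᵢ[ℂ] V)⁻¹ (D : Submodule ℂ V)).starProjection (v : V))
        = (w : V ≃ₗᵢ[ℂ] V) ((v : V) -
          (move (w : V ≃ₗᵢ[ℂ] V)⁻¹ (D : Submodule ℂ V)).starProjection (v : V)) :=
      (map_sub _ _ _).symm
    have h2 := Submodule.sub_starProjection_mem_orthogonal
      (K := move (w : V ≃ₗᵢ[ℂ] V)⁻¹ (D : Submodule ℂ V)) (v : V)
    rw [← move_orthogonal, mem_move, inv_inv] at h2
    exact e ▸ h2
  refine ⟨?_, ?_⟩
  · rw [key]; exact proj_ne_zero (smul_mem_complement w v.2) D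
  · simp only [key]; rfl

lemma smul_mem_model (w : W) {ω : Ambient W} (h : ω ∈ closure (range (embed (W := W)))) :
    w • ω ∈ closure (range (embed (W := W))) := by
  refine map_mem_closure (continuous_smul_ambient w) h ?_
  rintro _ ⟨v, rfl⟩
  exact ⟨_, (smul_embed w v).symm⟩

/-- The action of `W` on the model. -/
instance modelAction : MulAction W (Model W) where
  smul w ω := ⟨w • (ω : Ambient W), smul_mem_model w ω.2⟩
  one_smul ω := Subtype.ext (one_smul W (ω : Ambient W))
  mul_smul w w' ω := Subtype.ext (mul_smul w w' (ω : Ambient W))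

lemma continuous_smul_model (w : W) : Continuous (fun ω : Model W => w • ω) :=
  Continuous.subtype_mk ((continuous_smul_ambient w).comp continuous_subtype_val) _

variable (W)

/-- The quotient of the model by `W`. -/
abbrev QuotientModel : Type _ := Quotient (MulAction.orbitRel W (Model W))

/-- The quotient map from the model. -/
def toQuotient (ω : Model W) : QuotientModel W := Quotient.mk _ ω

/-! ### The divisor at infinity and its irreducible components -/

/-- The divisor at infinity: the complement of `X_W` in the model. -/
def boundary : Set (Model W) := {ω | (ω : Ambient W) ∉ range (embed (W := W))}

/-- The polynomial functions on `Coord W`. -/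
def polyFun : Subalgebra ℂ (Coord W → ℂ) :=
  Algebra.adjoin ℂ {f | ∃ φ : Coord W →ₗ[ℂ] ℂ, f = φ}

variable {W}

/-- Zariski closed subsets of the model: the loci where all polynomials of some set vanish at all
homogeneous coordinates of the point (equivalently, where all their multihomogeneous components
vanish). -/
def IsZariskiClosed (Z : Set (Model W)) : Prop :=
  ∃ S ⊆ (polyFun W : Set (Coord W → ℂ)),
    Z = {ω | ∀ p ∈ S, ∀ m : Coord W, IsLift m (ω : Ambient W) → p m = 0}

/-- Irreducible subsets for the Zariski topology. -/
def IsZariskiIrreducible (Z : Set (Model W)) : Prop :=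
  Z.Nonempty ∧ ∀ Z₁ Z₂ : Set (Model W), IsZariskiClosed Z₁ → IsZariskiClosed Z₂ →
    Z ⊆ Z₁ ∪ Z₂ → Z ⊆ Z₁ ∨ Z ⊆ Z₂

variable (W)

/-- The irreducible components of the divisor at infinity: its maximal irreducible subsets. -/
def IsBoundaryComponent (Z : Set (Model W)) : Prop :=
  Maximal (fun T => T ⊆ boundary W ∧ IsZariskiIrreducible T) Z

/-- The component `D_A`: the (unique) irreducible component of the divisor at infinity whose image
in `V` is `Aᗮ`. -/
def divisor (A : Submodule ℂ V) : Set (Model W) :=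
  ⋃₀ {Z | IsBoundaryComponent W Z ∧ (fun ω : Model W => (ω : Ambient W).1) '' Z = (Aᗮ : Set V)}

/-- The component `L_A = W(D_A) / W` of the boundary of the quotient, where `W(D_A)` is the union
of the `D_{wA}`. -/
def quotientDivisor (A : Submodule ℂ V) : Set (QuotientModel W) :=
  toQuotient W '' ⋃ w : W, divisor W (move (w : V ≃ₗᵢ[ℂ] V) A)

/-! ### Springer generic points -/

/-- Springer regular vectors in `A` for the action of `W_A`: vectors outside the reflecting
hyperplanes that are eigenvectors of an element which is not a multiple of the identity of `A`. -/
def IsSpringerRegular (A : Submodule ℂ V) (v : A) : Prop :=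
  (∀ H ∈ arrangement (parabolic W A), (v : V) ∉ H) ∧
    ∃ g ∈ parabolic W A, (∃ c : ℂ, g (v : V) = c • (v : V)) ∧
      ¬ ∃ c : ℂ, ∀ a ∈ A, g a = c • a

/-- Generic points of `D_A`: those on no other irreducible component of the boundary. -/
def IsGeneric (A : Submodule ℂ V) (ω : Model W) : Prop :=
  ω ∈ divisor W A ∧ ∀ Z, IsBoundaryComponent W Z → ω ∈ Z → Z = divisor W A

/-- Springer generic points `(x, A, l)` of `D_A`: generic points such that the line `l` in `A` is
not spanned by a Springer regular vector. -/
def IsSpringerGeneric (A : irreducibles W) (ω : Model W) : Prop :=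
  IsGeneric W A ω ∧
    ∀ v : (A : Submodule ℂ V), IsSpringerRegular W A v →
      ((ω : Ambient W).2 A).submodule ≠ Submodule.span ℂ {v}

/-- Springer generic points of `L_A`: the images of the Springer generic points of `D_A`. -/
def IsSpringerGenericQuotient (A : irreducibles W) (y : QuotientModel W) : Prop :=
  ∃ ω, IsSpringerGeneric W A ω ∧ toQuotient W ω = y

/-! ### Holomorphic functions and smooth points -/

variable {W} [Finite W]

/-- Holomorphic functions on an open subset `U` of the ambient product, through homogeneous
coordinates. -/
def HolomorphicOn (U : Set (Ambient W)) (F : Ambient W → ℂ) : Prop :=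
  ∃ F' : Coord W → ℂ, DifferentiableOn ℂ F' {m | ∃ ω ∈ U, IsLift m ω} ∧
    ∀ ω ∈ U, ∀ m, IsLift m ω → F' m = F ω

/-- `f` restricted to the subset `Z` of the model is holomorphic near `ω`: it is near `ω` the
restriction of a holomorphic function on an open subset of the ambient product. -/
def HolomorphicAt (Z : Set (Model W)) (f : Model W → ℂ) (ω : Model W) : Prop :=
  ∃ U : Set (Ambient W), IsOpen U ∧ (ω : Ambient W) ∈ U ∧ ∃ F : Ambient W → ℂ,
    HolomorphicOn U F ∧ ∀ ω' ∈ Z, (ω' : Ambient W) ∈ U → f ω' = F ω'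

/-- A function on the subset `L` of the quotient is holomorphic near `y` if its composition with the
quotient map is holomorphic on the preimage of `L` near the preimages of `y`. -/
def HolomorphicAtQuotient (L : Set (QuotientModel W)) (f : QuotientModel W → ℂ)
    (y : QuotientModel W) : Prop :=
  ∀ ω, toQuotient W ω = y → HolomorphicAt (toQuotient W ⁻¹' L) (f ∘ toQuotient W) ω

/-- `L` is smooth of dimension `d` at `y`: an open neighbourhood of `y` in `L` with its holomorphic
functions is isomorphic to an open subset of `ℂ ^ d` with its holomorphic functions. -/
def IsSmoothAt (L : Set (QuotientModel W)) (y : QuotientModel W) (d : ℕ) : Prop :=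
  ∃ hy : y ∈ L, ∃ φ : OpenPartialHomeomorph L (Fin d → ℂ), (⟨y, hy⟩ : L) ∈ φ.source ∧
    ∀ (f : QuotientModel W → ℂ) (z : L), z ∈ φ.source →
      (HolomorphicAtQuotient L f z ↔
        ∀ᶠ u in 𝓝 (φ z), DifferentiableAt ℂ (fun u' => f (φ.symm u')) u)

/-! ### Tangent and normal spaces -/

lemma HolomorphicOn.inter_left {U U' : Set (Ambient W)} {F : Ambient W → ℂ}
    (h : HolomorphicOn U F) : HolomorphicOn (U ∩ U') F := by
  obtain ⟨F', h1, h2⟩ := h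
  exact ⟨F', h1.mono fun m ⟨ω, hω, hm⟩ => ⟨ω, hω.1, hm⟩, fun ω hω => h2 ω hω.1⟩

lemma HolomorphicOn.inter_right {U U' : Set (Ambient W)} {F : Ambient W → ℂ}
    (h : HolomorphicOn U' F) : HolomorphicOn (U ∩ U') F := by
  obtain ⟨F', h1, h2⟩ := h
  exact ⟨F', h1.mono fun m ⟨ω, hω, hm⟩ => ⟨ω, hω.2, hm⟩, fun ω hω => h2 ω hω.2⟩

lemma HolomorphicOn.add {U : Set (Ambient W)} {F G : Ambient W → ℂ}
    (h : HolomorphicOn U F) (h' : HolomorphicOn U G) : HolomorphicOn U (F + G) := by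
  obtain ⟨F', h1, h2⟩ := h
  obtain ⟨G', h1', h2'⟩ := h'
  exact ⟨F' + G', h1.add h1', fun ω hω m hm => by
    rw [Pi.add_apply, Pi.add_apply, h2 ω hω m hm, h2' ω hω m hm]⟩

lemma HolomorphicOn.mul {U : Set (Ambient W)} {F G : Ambient W → ℂ}
    (h : HolomorphicOn U F) (h' : HolomorphicOn U G) : HolomorphicOn U (F * G) := by
  obtain ⟨F', h1, h2⟩ := h
  obtain ⟨G', h1', h2'⟩ := h'
  exact ⟨F' * G', h1.mul h1', fun ω hω m hm => by
    rw [Pi.mul_apply, Pi.mul_apply, h2 ω hω m hm, h2' ω hω m hm]⟩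

/-- The functions on the model that are holomorphic near `ω`. (They are not identified when they
agree near `ω`; derivations at `ω` depend only on the germs, as one sees by multiplying with the
characteristic functions of neighbourhoods.) -/
def localRing (ω : Model W) : Subalgebra ℂ (Model W → ℂ) where
  carrier := {f | HolomorphicAt univ f ω}
  mul_mem' := by
    rintro f g ⟨U, hU, hω, F, hF, e⟩ ⟨U', hU', hω', F', hF', e'⟩
    refine ⟨U ∩ U', hU.inter hU', ⟨hω, hω'⟩, F * F', hF.inter_left.mul hF'.inter_right, ?_⟩
    intro z hz hzU
    rw [Pi.mul_apply, Pi.mul_apply, e z hz hzU.1, e' z hz hzU.2]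
  add_mem' := by
    rintro f g ⟨U, hU, hω, F, hF, e⟩ ⟨U', hU', hω', F', hF', e'⟩
    refine ⟨U ∩ U', hU.inter hU', ⟨hω, hω'⟩, F + F', hF.inter_left.add hF'.inter_right, ?_⟩
    intro z hz hzU
    rw [Pi.add_apply, Pi.add_apply, e z hz hzU.1, e' z hz hzU.2]
  algebraMap_mem' c :=
    ⟨univ, isOpen_univ, mem_univ _, fun _ => c,
      ⟨fun _ => c, differentiableOn_const c, fun _ _ _ _ => rfl⟩, fun _ _ _ => rfl⟩

lemma comp_smul_mem (w : W) {ω : Model W} {f : Model W → ℂ} (hf : f ∈ localRing (w • ω)) :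
    (fun z => f (w • z)) ∈ localRing ω := by
  obtain ⟨U, hU, hω, F, ⟨F', h1, h2⟩, e⟩ := hf
  refine ⟨(fun z => w • z) ⁻¹' U, hU.preimage (continuous_smul_ambient w), hω,
    fun z => F (w • z), ⟨fun m => F' (coordMap w m), ?_, ?_⟩, ?_⟩
  · refine h1.comp ?_ ?_
    · exact (LinearMap.toContinuousLinearMap (coordMap w)).differentiable.differentiableOn
    · rintro m ⟨z, hz, hm⟩
      exact ⟨w • z, hz, hm.smul w⟩
  · exact fun z hz m hm => h2 _ hz _ (hm.smul w)
  · exact fun z _ hz => e (w • z) (mem_univ _) hz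

/-- The tangent space of the model at `ω`: the derivations at `ω` of the holomorphic functions. -/
def tangentSpace (ω : Model W) : Submodule ℂ (localRing ω →ₗ[ℂ] ℂ) where
  carrier := {δ | ∀ f g : localRing ω, δ (f * g) = f.1 ω * δ g + g.1 ω * δ f}
  add_mem' := by
    intro a b ha hb f g
    simp only [LinearMap.add_apply, ha f g, hb f g]
    ring
  zero_mem' := by
    intro f g
    simp
  smul_mem' := by
    intro c a ha f g
    simp only [LinearMap.smul_apply, ha f g, smul_eq_mul]
    ring

/-- The tangent space at `ω` of a subset `Z`, as a subspace of the tangent space of the model: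
the derivations that kill the functions vanishing on `Z` near `ω`. -/
def tangentSubspace (Z : Set (Model W)) (ω : Model W) : Submodule ℂ (tangentSpace ω) where
  carrier := {δ | ∀ f : localRing ω, (∀ᶠ z in 𝓝 ω, z ∈ Z → f.1 z = 0) → δ.1 f = 0}
  add_mem' := by
    intro a b ha hb f hf
    simp [ha f hf, hb f hf]
  zero_mem' := by
    intro f _
    simp
  smul_mem' := by
    intro c a ha f hf
    simp [ha f hf]

/-- The normal space of `Z` in the model at `ω`. -/
abbrev NormalSpace (Z : Set (Model W)) (ω : Model W) : Type _ :=
  tangentSpace ω ⧸ tangentSubspace Z ω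

/-- Pullback of holomorphic functions by an element `w` of the stabilizer of `ω`. -/
def pullback (w : W) (ω : Model W) (h : w • ω = ω) : localRing ω →ₗ[ℂ] localRing ω where
  toFun f := ⟨fun z => f.1 (w • z), comp_smul_mem w (h.symm ▸ f.2)⟩
  map_add' _ _ := rfl
  map_smul' _ _ := rfl

/-- The differential at `ω` of the action of an element `w` of the stabilizer of `ω`. -/
def differential (w : W) (ω : Model W) (h : w • ω = ω) : tangentSpace ω →ₗ[ℂ] tangentSpace ω where
  toFun δ := ⟨δ.1 ∘ₗ pullback w ω h, fun f g => by
    have e : ∀ k : localRing ω, (pullback w ω h k).1 ω = k.1 ω := fun k => congrArg k.1 h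
    have := δ.2 (pullback w ω h f) (pullback w ω h g)
    rw [e, e] at this
    exact this⟩
  map_add' _ _ := rfl
  map_smul' _ _ := rfl

end Wonderful

end

noncomputable section

namespace Wonderful

variable {V : Type*} [NormedAddCommGroup V] [InnerProductSpace ℂ V] [FiniteDimensional ℂ V]

/-! ### Polynomials on a vector space -/

/-! Let `x` be the vector and `l` the line in `A` of a Springer generic point `ω`. Two facts about
generic points of `D_A` carry the argument: the hyperplanes through `x` are those with `Hᗮ ≤ A`
(`IsGeneric.sumLines_eq`), and `l` lies in none of them (`IsGeneric.notMem`). To see this, approach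
`ω` by points `v` of `X`. If the projections of `v` to a sum `U` of lines tend to zero and are
negligible against the projections to all other lines, then deleting from `v` its part in a
component `B` of `U` hardly moves the homogeneous coordinates, so `ω` is in the closure of the
stratum of `B` (`mem_closure_stratum`). This closure is an irreducible part of the boundary, hence
inside `D_A`, and `B = A` follows (`IsGeneric.eq_of_mem_closure_stratum`).

Let `a` be a unit vector on `l`. The points with vector `v'' + t v'` and with line in `A` spanned by
`v'`, where `v'` and `v''` are the parts of `v` in `A` and `Aᗮ` and `⟨a, v⟩ = 1`, form an open chart
around `ω` with coordinates `v - a` and `t`, in which `D_A` is `t = 0`. An element that is a scalar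
`c` on `A` and trivial on `Aᗮ` sends `(v, t)` to `(v, c t)`: it fixes `D_A` pointwise in the chart
and scales the normal direction by `c`. A holomorphic function that vanishes at `t = 0` is divisible
by `t` (`exists_eq_mul_of_vanishing`), so the normal space is the line dual to `t`.

An element that fixes `ω` fixes `x`, so by Steinberg's theorem (`steinberg`) it lies in `W_A`. It
also preserves `l`, and unless it is scalar on `A` the line `l` would be spanned by a Springer
regular vector. The elements of `W_A` that are scalar on `A` form the center, because `A` is
irreducible; they embed in the nonzero complex numbers and hence form a cyclic group. So near `ω`
the group identifies no two distinct points of `D_A`, and `L_A` looks like `D_A` there.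

Steinberg's theorem is proved with polynomials. Chevalley's argument bounds the dimension of the
coinvariants of a reflection group `G` by `|G|`, and the bound passes to the stabilizer `Q` of a
vector. Let `P` be generated by the reflections in `Q`. If `P ≠ Q`, the comparison of bases of the
polynomials over the invariants of `Q` and of `P` gives a determinant that vanishes at the origin
but has no zero outside finitely many subspaces of codimension at least two, which is impossible. -/

open MvPolynomial in
/-- The ring of polynomials in the coordinates of `V` with respect to a fixed basis. -/
abbrev Poly (V : Type*) [NormedAddCommGroup V] [InnerProductSpace ℂ V] : Type :=
  MvPolynomial (Fin (Module.finrank ℂ V)) ℂ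

/-- The value of a polynomial at a vector. -/
def evalAt (v : V) : Poly V →ₐ[ℂ] ℂ :=
  MvPolynomial.aeval fun i => (Module.finBasis ℂ V).repr v i

/-- The linear polynomial of a linear form. -/
def linPoly (φ : V →ₗ[ℂ] ℂ) : Poly V :=
  ∑ i, MvPolynomial.C (φ (Module.finBasis ℂ V i)) * MvPolynomial.X i

lemma evalAt_linPoly (v : V) (φ : V →ₗ[ℂ] ℂ) : evalAt v (linPoly φ) = φ v := by
  conv_rhs => rw [← (Module.finBasis ℂ V).sum_repr v, map_sum]
  simp only [linPoly, evalAt, map_sum, map_mul, MvPolynomial.aeval_C, MvPolynomial.aeval_X,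
    map_smul, smul_eq_mul, Algebra.algebraMap_self, RingHom.id_apply]
  exact Finset.sum_congr rfl fun i _ => mul_comm _ _

lemma linPoly_isHomogeneous (φ : V →ₗ[ℂ] ℂ) : (linPoly φ).IsHomogeneous 1 :=
  MvPolynomial.IsHomogeneous.sum _ _ _ fun _ _ => MvPolynomial.isHomogeneous_C_mul_X _ _

lemma poly_ext {f g : Poly V} (h : ∀ v : V, evalAt v f = evalAt v g) : f = g := by
  refine MvPolynomial.funext fun x => ?_
  have := h ((Module.finBasis ℂ V).equivFun.symm x)
  have e : ∀ i, (Module.finBasis ℂ V).repr ((Module.finBasis ℂ V).equivFun.symm x) i = x i := by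
    intro i
    rw [← Module.Basis.equivFun_apply, LinearEquiv.apply_symm_apply]
  simp only [evalAt, e, MvPolynomial.aeval_eq_eval] at this
  exact this

/-- Composition of a polynomial with a linear map. -/
def precomp (g : V →ₗ[ℂ] V) : Poly V →ₐ[ℂ] Poly V :=
  MvPolynomial.aeval fun i => linPoly ((Module.finBasis ℂ V).coord i ∘ₗ g)

lemma evalAt_precomp (v : V) (g : V →ₗ[ℂ] V) (f : Poly V) :
    evalAt v (precomp g f) = evalAt (g v) f := by
  have : (evalAt v).comp (precomp g) = evalAt (g v) := by
    refine MvPolynomial.algHom_ext fun i => ?_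
    simp [precomp, evalAt_linPoly]
    simp [evalAt]
  exact DFunLike.congr_fun this f

/-- Composition of a polynomial with the translation by `w`. -/
def translate (w : V) : Poly V →ₐ[ℂ] Poly V :=
  MvPolynomial.aeval fun i =>
    MvPolynomial.X i + MvPolynomial.C ((Module.finBasis ℂ V).repr w i)

lemma evalAt_translate (v w : V) (f : Poly V) :
    evalAt v (translate w f) = evalAt (v + w) f := by
  have : (evalAt v).comp (translate w) = evalAt (v + w) := by
    refine MvPolynomial.algHom_ext fun i => ?_
    simp [translate, evalAt]
  exact DFunLike.congr_fun this f

/-- The action of isometries on polynomials. -/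
def act (g : V ≃ₗᵢ[ℂ] V) : Poly V →ₐ[ℂ] Poly V :=
  precomp ((g⁻¹).toLinearEquiv : V →ₗ[ℂ] V)

lemma evalAt_act (v : V) (g : V ≃ₗᵢ[ℂ] V) (f : Poly V) :
    evalAt v (act g f) = evalAt (g⁻¹ v) f := evalAt_precomp _ _ _

lemma act_one (f : Poly V) : act 1 f = f := poly_ext fun v => by rw [evalAt_act]; simp

lemma act_mul (g h : V ≃ₗᵢ[ℂ] V) (f : Poly V) : act (g * h) f = act g (act h f) :=
  poly_ext fun v => by rw [evalAt_act, evalAt_act, evalAt_act, mul_inv_rev]; rfl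

lemma act_inv_act (g : V ≃ₗᵢ[ℂ] V) (f : Poly V) : act g⁻¹ (act g f) = f := by
  rw [← act_mul, inv_mul_cancel, act_one]

lemma precomp_isHomogeneous (g : V →ₗ[ℂ] V) {f : Poly V} {d : ℕ} (hf : f.IsHomogeneous d) :
    (precomp g f).IsHomogeneous d := by
  have := hf.aeval (fun i => linPoly ((Module.finBasis ℂ V).coord i ∘ₗ g)) (n := 1)
    (fun i => linPoly_isHomogeneous _)
  rwa [one_mul] at this

lemma act_isHomogeneous (g : V ≃ₗᵢ[ℂ] V) {f : Poly V} {d : ℕ} (hf : f.IsHomogeneous d) :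
    (act g f).IsHomogeneous d := precomp_isHomogeneous _ hf

lemma homogeneousComponent_act (g : V ≃ₗᵢ[ℂ] V) (f : Poly V) (d : ℕ) :
    MvPolynomial.homogeneousComponent d (act g f)
      = act g (MvPolynomial.homogeneousComponent d f) := by
  conv_lhs => rw [← f.sum_homogeneousComponent, map_sum, map_sum]
  have : ∀ i, MvPolynomial.homogeneousComponent d
      (act g (MvPolynomial.homogeneousComponent i f)) =
      if d = i then act g (MvPolynomial.homogeneousComponent d f) else 0 := by
    intro i
    rw [MvPolynomial.homogeneousComponent_of_mem
      (act_isHomogeneous g (MvPolynomial.homogeneousComponent_isHomogeneous i f))]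
    split_ifs with h
    · rw [h]
    · rfl
  simp only [this, Finset.sum_ite_eq, Finset.mem_range]
  split_ifs with h
  · rfl
  · rw [MvPolynomial.homogeneousComponent_eq_zero _ _ (by omega), map_zero]

lemma homogeneousComponent_mul {σ : Type*} {r s : MvPolynomial σ ℂ} {k : ℕ}
    (hr : r.IsHomogeneous k) (d : ℕ) :
    MvPolynomial.homogeneousComponent d (r * s) =
      if k ≤ d then r * MvPolynomial.homogeneousComponent (d - k) s else 0 := by
  let _ := MvPolynomial.gradedAlgebra (σ := σ) (R := ℂ)
  have h := DirectSum.coe_decompose_mul_of_left_mem (b := s)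
    (MvPolynomial.homogeneousSubmodule σ ℂ) d hr
  have e : ∀ (f : MvPolynomial σ ℂ) (i : ℕ),
      (DirectSum.decompose (MvPolynomial.homogeneousSubmodule σ ℂ) f i : MvPolynomial σ ℂ)
        = MvPolynomial.homogeneousComponent i f := fun f i =>
    MvPolynomial.decomposition.decompose'_apply f i
  simpa only [e] using h

/-- There is a polynomial with value `1` at a point and `0` at finitely many other ones. -/
lemma exists_separating (u : V) (T : Set V) (hT : T.Finite) (hu : u ∉ T) :
    ∃ f : Poly V, evalAt u f = 1 ∧ ∀ v ∈ T, evalAt v f = 0 := by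
  have h1 : ∀ v : V, v ≠ u → ∃ f : Poly V, evalAt u f = 1 ∧ evalAt v f = 0 := by
    intro v hv
    have hne : u - v ≠ 0 := sub_ne_zero.2 (Ne.symm hv)
    have h0 : inner ℂ (u - v) (u - v) ≠ 0 := inner_self_ne_zero.2 hne
    -- The affine function `x ↦ ⟨u - v, x - v⟩ / ‖u - v‖²`.
    refine ⟨MvPolynomial.C (inner ℂ (u - v) (u - v))⁻¹ *
      (linPoly (innerSL ℂ (u - v) : V →ₗ[ℂ] ℂ) - MvPolynomial.C (inner ℂ (u - v) v)), ?_, ?_⟩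
    · rw [map_mul, map_sub, evalAt_linPoly]
      simp only [← MvPolynomial.algebraMap_eq, AlgHom.commutes]
      simp only [Algebra.algebraMap_self, RingHom.id_apply, ContinuousLinearMap.coe_coe,
        innerSL_apply_apply]
      rw [← inner_sub_right, inv_mul_cancel₀ h0]
    · rw [map_mul, map_sub, evalAt_linPoly]
      simp [← MvPolynomial.algebraMap_eq]
  choose! F hF using h1
  refine ⟨∏ v ∈ hT.toFinset, F v, ?_, ?_⟩
  · rw [map_prod]
    refine Finset.prod_eq_one fun v hv => (hF v ?_).1
    rintro rfl
    exact hu (hT.mem_toFinset.1 hv)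
  · intro v hv
    rw [map_prod]
    refine Finset.prod_eq_zero (hT.mem_toFinset.2 hv) (hF v ?_).2
    rintro rfl
    exact hu hv

/-- A polynomial that vanishes outside finitely many proper subspaces is zero. -/
lemma poly_eq_zero_of_generic {ι : Type*} [Finite ι] (p : ι → Submodule ℂ V) (hp : ∀ i, p i ≠ ⊤)
    (f : Poly V) (hf : ∀ v : V, (∀ i, v ∉ p i) → evalAt v f = 0) : f = 0 := by
  have := Fintype.ofFinite ι
  have h1 : ∀ i, ∃ φ : V →ₗ[ℂ] ℂ, φ ≠ 0 ∧ p i ≤ LinearMap.ker φ := fun i =>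
    (p i).exists_le_ker_of_lt_top (lt_top_iff_ne_top.2 (hp i))
  choose φ hφ hle using h1
  -- Each linear form kills one of the subspaces, so the product vanishes at every vector; and the
  -- polynomials form a domain.
  have h2 : f * ∏ i, linPoly (φ i) = 0 := by
    refine poly_ext fun v => ?_
    rw [map_mul, map_prod, map_zero]
    by_cases hv : ∀ i, v ∉ p i
    · rw [hf v hv, zero_mul]
    · push Not at hv
      obtain ⟨i, hi⟩ := hv
      rw [Finset.prod_eq_zero (Finset.mem_univ i), mul_zero]
      rw [evalAt_linPoly]
      exact hle i hi
  refine (mul_eq_zero.1 h2).resolve_right ?_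
  refine Finset.prod_ne_zero_iff.2 fun i _ h0 => ?_
  refine hφ i (LinearMap.ext fun v => ?_)
  rw [← evalAt_linPoly, h0, map_zero, LinearMap.zero_apply]

/-! ### Invariants and coinvariants -/

/-- The polynomials invariant under `G`. -/
def invariants (G : Subgroup (V ≃ₗᵢ[ℂ] V)) : Subalgebra ℂ (Poly V) where
  carrier := {f | ∀ g ∈ G, act g f = f}
  mul_mem' ha hb g hg := by rw [map_mul, ha g hg, hb g hg]
  add_mem' ha hb g hg := by rw [map_add, ha g hg, hb g hg]
  algebraMap_mem' c g _ := (act g).commutes c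

/-- The ideal generated by the homogeneous invariants of degree greater than `c`. -/
def invIdeal (G : Subgroup (V ≃ₗᵢ[ℂ] V)) (c : ℕ) : Ideal (Poly V) :=
  Ideal.span {r | r ∈ invariants G ∧ ∃ k, c < k ∧ r.IsHomogeneous k}

variable {G : Subgroup (V ≃ₗᵢ[ℂ] V)}

lemma evalAt_invariant {f : Poly V} (hf : f ∈ invariants G) {g : V ≃ₗᵢ[ℂ] V} (hg : g ∈ G)
    (v : V) : evalAt (g v) f = evalAt v f := by
  have := congrArg (evalAt v) (hf _ (G.inv_mem hg))
  rwa [evalAt_act, inv_inv] at this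

lemma homogeneousComponent_mem_invariants {f : Poly V} (hf : f ∈ invariants G) (d : ℕ) :
    MvPolynomial.homogeneousComponent d f ∈ invariants G := fun g hg => by
  rw [← homogeneousComponent_act, hf g hg]

lemma mem_invIdeal {c k : ℕ} {r : Poly V} (hr : r ∈ invariants G) (hk : c < k)
    (hrk : r.IsHomogeneous k) : r ∈ invIdeal G c := Ideal.subset_span ⟨hr, k, hk, hrk⟩

lemma invIdeal_induction {c : ℕ} {p : Poly V → Prop} (h0 : p 0)
    (hadd : ∀ x y, p x → p y → p (x + y))
    (hmul : ∀ r ∈ invariants G, ∀ k, c < k → r.IsHomogeneous k → ∀ s, p (r * s))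
    {x : Poly V} (hx : x ∈ invIdeal G c) : p x := by
  refine Submodule.closure_induction (p := fun x _ => p x) h0 (fun x y _ _ => hadd x y) ?_ hx
  rintro s r ⟨hr, k, hk, hrk⟩
  rw [smul_eq_mul, mul_comm]
  exact hmul r hr k hk hrk s

/-- The generators have degree greater than `c`. In degree `c` a congruence thus becomes an
equation, which starts the induction in `chevalley`. -/
lemma homogeneousComponent_invIdeal {c : ℕ} {x : Poly V} (hx : x ∈ invIdeal G c) {d : ℕ}
    (hd : d ≤ c) : MvPolynomial.homogeneousComponent d x = 0 := by
  refine invIdeal_induction (p := fun x => MvPolynomial.homogeneousComponent d x = 0)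
    (by rw [map_zero]) (fun x y hx hy => by rw [map_add, hx, hy, add_zero]) ?_ hx
  intro r _ k hk hrk s
  rw [homogeneousComponent_mul hrk, if_neg (by omega)]

lemma homogeneousComponent_mem_invIdeal {c : ℕ} {x : Poly V} (hx : x ∈ invIdeal G c) (d : ℕ) :
    MvPolynomial.homogeneousComponent d x ∈ invIdeal G c := by
  refine invIdeal_induction (p := fun x => MvPolynomial.homogeneousComponent d x ∈ invIdeal G c)
    (by rw [map_zero]; exact zero_mem _)
    (fun x y hx hy => by rw [map_add]; exact add_mem hx hy) ?_ hx
  intro r hr k hk hrk s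
  rw [homogeneousComponent_mul hrk]
  split_ifs
  · exact Ideal.mul_mem_right _ _ (mem_invIdeal hr hk hrk)
  · exact zero_mem _

lemma act_mem_invIdeal {c : ℕ} {x : Poly V} (hx : x ∈ invIdeal G c) {g : V ≃ₗᵢ[ℂ] V}
    (hg : g ∈ G) : act g x ∈ invIdeal G c := by
  refine invIdeal_induction (p := fun x => act g x ∈ invIdeal G c)
    (by rw [map_zero]; exact zero_mem _)
    (fun x y hx hy => by rw [map_add]; exact add_mem hx hy) ?_ hx
  intro r hr k hk hrk s
  rw [map_mul, hr g hg]
  exact Ideal.mul_mem_right _ _ (mem_invIdeal hr hk hrk)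

/-- The sum of the translates of a polynomial under `G`. -/
def trace (G : Subgroup (V ≃ₗᵢ[ℂ] V)) [Finite G] : Poly V →ₗ[ℂ] Poly V :=
  letI := Fintype.ofFinite G
  ∑ g : G, (act (g : V ≃ₗᵢ[ℂ] V)).toLinearMap

lemma trace_apply [Fintype G] (f : Poly V) :
    trace G f = ∑ g : G, act (g : V ≃ₗᵢ[ℂ] V) f := by
  simp only [trace, LinearMap.sum_apply, AlgHom.toLinearMap_apply]
  -- The sum in `trace` uses the instance `Fintype.ofFinite G` instead of the given one.
  congr!

lemma trace_mem_invariants [Finite G] (f : Poly V) : trace G f ∈ invariants G := by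
  have := Fintype.ofFinite G
  intro g hg
  rw [trace_apply, map_sum]
  refine Fintype.sum_equiv (Equiv.mulLeft (⟨g, hg⟩ : G)) _ _ fun h => ?_
  rw [← act_mul]
  rfl

/-- A reflection acts trivially modulo a linear form. -/
lemma IsReflection.exists_divided_difference {r : V ≃ₗᵢ[ℂ] V} (hr : IsReflection r) :
    ∃ α : V →ₗ[ℂ] ℂ, α ≠ 0 ∧ ∀ f : Poly V, ∃ h, f - act r f = linPoly α * h := by
  have hlt : fixedSpace r < ⊤ := by
    rw [lt_top_iff_ne_top]
    intro h
    rw [IsReflection, h, finrank_top] at hr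
    omega
  obtain ⟨α, hα, hle⟩ := (fixedSpace r).exists_le_ker_of_lt_top hlt
  have hker : fixedSpace r = LinearMap.ker α := by
    refine Submodule.eq_of_le_of_finrank_le hle ?_
    have h1 : LinearMap.ker α < ⊤ := by
      rw [lt_top_iff_ne_top]
      exact fun h => hα (LinearMap.ker_eq_top.1 h)
    have := Submodule.finrank_lt_finrank_of_lt h1
    rw [finrank_top] at this
    rw [IsReflection] at hr
    omega
  obtain ⟨y, hy⟩ : ∃ y, α y = 1 := by
    obtain ⟨z, hz⟩ : ∃ z, α z ≠ 0 := by
      by_contra h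
      push Not at h
      exact hα (LinearMap.ext h)
    exact ⟨(α z)⁻¹ • z, by rw [map_smul, smul_eq_mul, inv_mul_cancel₀ hz]⟩
  -- A linear form that kills the hyperplane `ker α` is a multiple of `α`; the difference of a
  -- coordinate and its translate by `r` is such a form.
  have hψ : ∀ ψ : V →ₗ[ℂ] ℂ, (∀ v ∈ fixedSpace r, ψ v = 0) → ∀ v, ψ v = α v * ψ y := by
    intro ψ h v
    have : v - α v • y ∈ fixedSpace r := by
      rw [hker, LinearMap.mem_ker, map_sub, map_smul, hy]
      simp
    have := h _ this
    rw [map_sub, map_smul, sub_eq_zero] at this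
    exact this
  refine ⟨α, hα, fun f => ?_⟩
  induction f using MvPolynomial.induction_on with
  | C a => exact ⟨0, by rw [← MvPolynomial.algebraMap_eq, AlgHom.commutes, sub_self, mul_zero]⟩
  | add p q hp hq =>
    obtain ⟨a, ha⟩ := hp
    obtain ⟨b, hb⟩ := hq
    exact ⟨a + b, by rw [map_add, mul_add, ← ha, ← hb]; ring⟩
  | mul_X p i hp =>
    obtain ⟨a, ha⟩ := hp
    set ψ : V →ₗ[ℂ] ℂ := (Module.finBasis ℂ V).coord i -
      (Module.finBasis ℂ V).coord i ∘ₗ ((r⁻¹).toLinearEquiv : V →ₗ[ℂ] V)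
    have h1 : ∀ v ∈ fixedSpace r, ψ v = 0 := by
      intro v hv
      have : r⁻¹ v = v := by
        rw [LinearIsometryEquiv.coe_inv, LinearIsometryEquiv.symm_apply_eq]
        exact hv.symm
      change (Module.finBasis ℂ V).coord i v - (Module.finBasis ℂ V).coord i (r⁻¹ v) = 0
      rw [this, sub_self]
    have h2 : (MvPolynomial.X i : Poly V) - act r (MvPolynomial.X i)
        = linPoly α * MvPolynomial.C (ψ y) := by
      refine poly_ext fun v => ?_
      rw [map_sub, evalAt_act, map_mul, evalAt_linPoly, ← MvPolynomial.algebraMap_eq,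
        AlgHom.commutes]
      simp only [Algebra.algebraMap_self, RingHom.id_apply]
      rw [← hψ ψ h1 v]
      simp [evalAt, ψ]
    -- Twisted Leibniz rule: `p X - r(p) r(X) = (p - r(p)) X + r(p) (X - r(X))`.
    refine ⟨a * MvPolynomial.X i + act r p * MvPolynomial.C (ψ y), ?_⟩
    rw [map_mul]
    linear_combination MvPolynomial.X i * ha + act r p * h2


/-- Chevalley's lemma: relations with invariant coefficients of degree `c` hold modulo invariants
of positive degree after any linear functional is applied to the coefficients. -/
lemma chevalley [Finite G] (hG : IsReflectionGroup G) (c : ℕ) (ev : Poly V →ₗ[ℂ] ℂ) (d : ℕ) :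
    ∀ {ι : Type} (s : Finset ι) (a e : ι → Poly V), (∀ i ∈ s, a i ∈ invariants G) →
      (∀ i ∈ s, (a i).IsHomogeneous c) → (∀ i ∈ s, (e i).IsHomogeneous d) →
      ∑ i ∈ s, a i * e i ∈ invIdeal G c →
      ∑ i ∈ s, ev (a i) • e i ∈ invIdeal G 0 := by
  induction d with
  | zero =>
    intro ι s a e _ hac he hsum
    have h1 : ∀ i ∈ s, e i = MvPolynomial.C ((e i).coeff 0) := fun i hi => by
      rw [← MvPolynomial.homogeneousComponent_zero,
        MvPolynomial.homogeneousComponent_eq_self (he i hi)]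
    -- For constants `e i` the sum is homogeneous of degree `c`, where the ideal is zero. So there
    -- is a true linear relation to which `ev` can be applied.
    have h2 : ∑ i ∈ s, (e i).coeff 0 • a i = 0 := by
      have h3 : ∑ i ∈ s, a i * e i = ∑ i ∈ s, (e i).coeff 0 • a i :=
        Finset.sum_congr rfl fun i hi => by
          conv_lhs => rw [h1 i hi]
          rw [MvPolynomial.smul_eq_C_mul, mul_comm]
      rw [h3] at hsum
      rw [← homogeneousComponent_invIdeal hsum le_rfl]
      exact (MvPolynomial.homogeneousComponent_eq_self (MvPolynomial.IsHomogeneous.sum _ _ _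
        fun i hi => by rw [MvPolynomial.smul_eq_C_mul]; exact (hac i hi).C_mul _)).symm
    have h3 : ∑ i ∈ s, ev (a i) • e i = 0 := by
      have h4 := congrArg ev h2
      simp only [map_sum, map_smul, map_zero, smul_eq_mul] at h4
      calc ∑ i ∈ s, ev (a i) • e i
          = ∑ i ∈ s, MvPolynomial.C ((e i).coeff 0 * ev (a i)) :=
            Finset.sum_congr rfl fun i hi => by
              conv_lhs => rw [h1 i hi]
              rw [MvPolynomial.smul_eq_C_mul, mul_comm, ← MvPolynomial.C_mul]
        _ = 0 := by rw [← map_sum, h4, map_zero]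
    rw [h3]
    exact zero_mem _
  | succ d ih =>
    intro ι s a e ha hac he hsum
    have := Fintype.ofFinite G
    set x := ∑ i ∈ s, ev (a i) • e i with hx
    have hxd : x.IsHomogeneous (d + 1) := MvPolynomial.IsHomogeneous.sum _ _ _
        fun i hi => by rw [MvPolynomial.smul_eq_C_mul]; exact (he i hi).C_mul _
    -- Division of the relation by the linear form of `r` replaces each `e i` by a quotient of
    -- degree `d` and keeps the invariant coefficients, so the induction hypothesis applies to the
    -- quotients.
    have h1 : ∀ r ∈ G, IsReflection r → x - act r x ∈ invIdeal G 0 := by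
      intro r hr href
      obtain ⟨α, hα, hdiv⟩ := href.exists_divided_difference
      have hα' : linPoly α ≠ 0 := fun h => hα (LinearMap.ext fun v => by
        rw [← evalAt_linPoly, h, map_zero, LinearMap.zero_apply])
      have hh : ∀ i, ∃ h : Poly V, i ∈ s → h.IsHomogeneous d ∧
          e i - act r (e i) = linPoly α * h := by
        intro i
        obtain ⟨h, hh⟩ := hdiv (e i)
        refine ⟨MvPolynomial.homogeneousComponent d h, fun hi =>
          ⟨MvPolynomial.homogeneousComponent_isHomogeneous _ _, ?_⟩⟩
        have h2 := congrArg (MvPolynomial.homogeneousComponent (d + 1)) hh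
        rw [homogeneousComponent_mul (linPoly_isHomogeneous α), if_pos (by omega),
          Nat.add_sub_cancel, MvPolynomial.homogeneousComponent_eq_self
            ((he i hi).sub (act_isHomogeneous r (he i hi)))] at h2
        exact h2
      choose h hh using hh
      -- The ideal is stable under divided differences because its invariant generators factor out.
      have hJ : ∀ y ∈ invIdeal G c, ∀ z, y - act r y = linPoly α * z → z ∈ invIdeal G c := by
        intro y hy
        have : ∃ z ∈ invIdeal G c, y - act r y = linPoly α * z := by
          refine invIdeal_induction
            (p := fun y => ∃ z ∈ invIdeal G c, y - act r y = linPoly α * z)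
            ⟨0, zero_mem _, by rw [map_zero, sub_zero, mul_zero]⟩ ?_ ?_ hy
          · rintro y y' ⟨z, hz, e⟩ ⟨z', hz', e'⟩
            exact ⟨z + z', add_mem hz hz', by rw [map_add, mul_add, ← e, ← e']; ring⟩
          · intro b hb k hk hbk t
            obtain ⟨z, hz⟩ := hdiv t
            refine ⟨b * z, Ideal.mul_mem_right _ _ (mem_invIdeal hb hk hbk), ?_⟩
            rw [map_mul, hb r hr]
            linear_combination b * hz
        obtain ⟨z, hz, e⟩ := this
        intro z' e'
        rwa [← mul_left_cancel₀ hα' (e.symm.trans e')]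
      have h2 : ∑ i ∈ s, a i * h i ∈ invIdeal G c := by
        refine hJ _ hsum _ ?_
        rw [map_sum, ← Finset.sum_sub_distrib, Finset.mul_sum]
        refine Finset.sum_congr rfl fun i hi => ?_
        rw [map_mul, ha i hi r hr]
        linear_combination a i * (hh i hi).2
      have h3 := ih s a h ha hac (fun i hi => (hh i hi).1) h2
      have h4 : x - act r x = linPoly α * ∑ i ∈ s, ev (a i) • h i := by
        rw [hx, map_sum, ← Finset.sum_sub_distrib, Finset.mul_sum]
        refine Finset.sum_congr rfl fun i hi => ?_
        rw [map_smul, ← smul_sub, (hh i hi).2, mul_smul_comm]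
      rw [h4]
      exact Ideal.mul_mem_left _ _ h3
    have h2 : ∀ g ∈ G, x - act g x ∈ invIdeal G 0 := by
      intro g hg
      rw [IsReflectionGroup] at hG
      have hle : ∀ g ∈ Subgroup.closure {g | g ∈ G ∧ IsReflection g}, g ∈ G :=
        fun g hg => hG ▸ hg
      rw [← hG] at hg
      induction hg using Subgroup.closure_induction with
      | mem r hr => exact h1 r hr.1 hr.2
      | one => rw [act_one, sub_self]; exact zero_mem _
      | mul g h hg hh ihg ihh =>
        have := add_mem ihg (act_mem_invIdeal ihh (hle g hg))
        rw [map_sub, ← act_mul] at this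
        simpa using this
      | inv g hg ihg =>
        have := neg_mem (act_mem_invIdeal ihg (G.inv_mem (hle g hg)))
        rw [map_sub, act_inv_act, neg_sub] at this
        exact this
    -- The trace is invariant of positive degree `d + 1`; and `x` is congruent to all its
    -- translates, hence to their average.
    have h3 : trace G x ∈ invIdeal G 0 := by
      refine mem_invIdeal (trace_mem_invariants x) (Nat.succ_pos d) ?_
      rw [trace_apply]
      exact MvPolynomial.IsHomogeneous.sum _ _ _ fun g _ => act_isHomogeneous _ hxd
    have h4 : (Fintype.card G : ℂ) • x ∈ invIdeal G 0 := by
      have h5 : (Fintype.card G : ℂ) • x = ∑ g : G, (x - act (g : V ≃ₗᵢ[ℂ] V) x) + trace G x := by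
        rw [Finset.sum_sub_distrib, trace_apply, sub_add_cancel, Finset.sum_const,
          Finset.card_univ, Nat.cast_smul_eq_nsmul]
      rw [h5]
      exact add_mem (sum_mem fun g _ => h2 g g.2) h3
    have h6 : (Fintype.card G : ℂ) ≠ 0 := Nat.cast_ne_zero.2 Fintype.card_ne_zero
    have h7 := (invIdeal G 0).mul_mem_left (MvPolynomial.C (Fintype.card G : ℂ)⁻¹) h4
    rwa [← MvPolynomial.smul_eq_C_mul, smul_smul, inv_mul_cancel₀ h6, one_smul] at h7

/-- The coinvariant algebra of `G` has dimension at most the order of `G`. -/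
def CoinvariantBound (G : Subgroup (V ≃ₗᵢ[ℂ] V)) : Prop :=
  ∀ (k : ℕ) (d : Fin k → ℕ) (e : Fin k → Poly V), (∀ i, (e i).IsHomogeneous (d i)) →
    (∀ c : Fin k → ℂ, ∑ i, c i • e i ∈ invIdeal G 0 → c = 0) → k ≤ Nat.card G

/-- Homogeneous polynomials that are independent modulo the invariants of positive degree are
independent over the invariants. -/
lemma independent_of_independent_mod [Finite G] (hG : IsReflectionGroup G) {k : ℕ} {d : Fin k → ℕ}
    {e : Fin k → Poly V} (he : ∀ i, (e i).IsHomogeneous (d i))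
    (hind : ∀ c : Fin k → ℂ, ∑ i, c i • e i ∈ invIdeal G 0 → c = 0)
    {a : Fin k → Poly V} (ha : ∀ i, a i ∈ invariants G) (h0 : ∑ i, a i * e i = 0) : a = 0 := by
  classical
  by_contra hne
  obtain ⟨i₀, hi₀⟩ : ∃ i, a i ≠ 0 := by
    by_contra h
    push Not at h
    exact hne (funext h)
  obtain ⟨c₀, hc₀⟩ : ∃ c, MvPolynomial.homogeneousComponent c (a i₀) ≠ 0 := by
    by_contra h
    push Not at h
    apply hi₀
    rw [← (a i₀).sum_homogeneousComponent]
    exact Finset.sum_eq_zero fun i _ => h i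
  set D := c₀ + d i₀ with hD
  -- The part of the relation in total degree `D`: the coefficient of `e i` has degree `D - d i`.
  -- The guard `d i ≤ D` excludes truncated subtraction.
  set a' : Fin k → Poly V := fun i =>
    if d i ≤ D then MvPolynomial.homogeneousComponent (D - d i) (a i) else 0 with ha'
  have hsum : ∑ i, a' i * e i = 0 := by
    have h1 := congrArg (MvPolynomial.homogeneousComponent D) h0
    rw [map_sum, map_zero] at h1
    rw [← h1]
    refine Finset.sum_congr rfl fun i _ => ?_
    rw [mul_comm (a i), homogeneousComponent_mul (he i), ha']
    dsimp only
    split_ifs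
    · ring
    · ring
  have hinv : ∀ i, a' i ∈ invariants G := by
    intro i
    rw [ha']
    dsimp only
    split_ifs
    · exact homogeneousComponent_mem_invariants (ha i) _
    · exact zero_mem _
  have hhom : ∀ i, (a' i).IsHomogeneous (D - d i) := by
    intro i
    rw [ha']
    dsimp only
    split_ifs
    · exact MvPolynomial.homogeneousComponent_isHomogeneous _ _
    · exact MvPolynomial.isHomogeneous_zero _ _ _
  have hle : ∀ i, a' i ≠ 0 → d i ≤ D := by
    intro i hi
    by_contra h
    exact hi (if_neg h)
  have hT : (Finset.univ.filter fun i => a' i ≠ 0).Nonempty := by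
    refine ⟨i₀, Finset.mem_filter.2 ⟨Finset.mem_univ _, ?_⟩⟩
    rw [ha']
    dsimp only
    rw [if_pos (by omega), show D - d i₀ = c₀ by omega]
    exact hc₀
  -- The largest `d i` belongs to the coefficients of lowest degree. Nonzero terms with another `d
  -- i` have coefficients of higher degree, so they lie in the ideal and `chevalley` applies to the
  -- remaining terms.
  obtain ⟨i₁, hi₁, hmax⟩ := Finset.exists_max_image _ d hT
  rw [Finset.mem_filter] at hi₁
  set s := Finset.univ.filter fun i => d i = d i₁ with hs
  have hrest : ∑ i ∈ s, a' i * e i ∈ invIdeal G (D - d i₁) := by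
    have h1 := Finset.sum_filter_add_sum_filter_not Finset.univ (fun i => d i = d i₁)
      (fun i => a' i * e i)
    rw [hsum] at h1
    rw [eq_neg_of_add_eq_zero_left h1]
    refine neg_mem (sum_mem fun i hi => ?_)
    by_cases h2 : a' i = 0
    · rw [h2, zero_mul]; exact zero_mem _
    · have h3 := hmax i (Finset.mem_filter.2 ⟨Finset.mem_univ _, h2⟩)
      have h4 := (Finset.mem_filter.1 hi).2
      have h5 := hle _ hi₁.2
      exact Ideal.mul_mem_right _ _ (mem_invIdeal (hinv i) (by omega) (hhom i))
  have key : ∀ ev : Poly V →ₗ[ℂ] ℂ, ev (a' i₁) = 0 := by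
    intro ev
    have h1 := chevalley hG (D - d i₁) ev (d i₁) s a' e (fun i _ => hinv i)
      (fun i hi => (Finset.mem_filter.1 hi).2 ▸ hhom i)
      (fun i hi => (Finset.mem_filter.1 hi).2 ▸ he i) hrest
    have h2 := hind (fun i => if d i = d i₁ then ev (a' i) else 0) (by
      simp only [ite_smul, zero_smul]
      rw [← Finset.sum_filter]
      exact h1)
    have h3 := congrFun h2 i₁
    simpa using h3
  refine hi₁.2 (MvPolynomial.ext _ _ fun m => ?_)
  exact key (MvPolynomial.lcoeff ℂ m)

/-- Choose `u` where `y` is nonzero and `s` equal to `1` at `u` and to `0` on the rest of its orbit.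
At `u` the trace is the value of `y` times the order of the stabilizer of `u`. -/
lemma exists_trace_mul_ne_zero [Finite G] {y : Poly V} (hy : y ≠ 0) :
    ∃ s : Poly V, trace G (s * y) ≠ 0 := by
  classical
  have := Fintype.ofFinite G
  obtain ⟨u, hu⟩ : ∃ u : V, evalAt u y ≠ 0 := by
    by_contra h
    push Not at h
    exact hy (poly_ext fun v => by rw [h, map_zero])
  obtain ⟨s, hs1, hs2⟩ := exists_separating u
    ((Set.range fun g : G => (g : V ≃ₗᵢ[ℂ] V)⁻¹ u) \ {u}) (Set.toFinite _) (by simp)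
  refine ⟨s, fun h => ?_⟩
  have h1 := congrArg (evalAt u) h
  rw [trace_apply, map_sum, map_zero] at h1
  have h2 : ∀ g : G, evalAt u (act (g : V ≃ₗᵢ[ℂ] V) (s * y)) =
      if (g : V ≃ₗᵢ[ℂ] V)⁻¹ u = u then evalAt u y else 0 := by
    intro g
    rw [evalAt_act, map_mul]
    split_ifs with hg
    · rw [hg, hs1, one_mul]
    · rw [hs2 _ ⟨⟨g, rfl⟩, hg⟩, zero_mul]
  simp only [h2] at h1
  rw [← Finset.sum_filter, Finset.sum_const, nsmul_eq_mul] at h1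
  refine (mul_ne_zero (Nat.cast_ne_zero.2 (Finset.card_ne_zero_of_mem
    (Finset.mem_filter.2 ⟨Finset.mem_univ (1 : G), ?_⟩))) hu) h1
  simp

/-- With more than `|G|` polynomials the vectors `(g e_i)_g` would be dependent over the polynomial
ring. Multiplication by a suitable `s` and averaging over `G` would make the coefficients invariant
but not all zero, against `independent_of_independent_mod`. -/
lemma coinvariantBound_of_isReflectionGroup [Finite G] (hG : IsReflectionGroup G) :
    CoinvariantBound G := by
  intro k d e he hind
  have := Fintype.ofFinite G
  by_contra hlt
  push Not at hlt
  let T : (Fin k → Poly V) →ₗ[Poly V] (G → Poly V) :=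
    { toFun := fun x g => ∑ i, x i * act (g : V ≃ₗᵢ[ℂ] V) (e i)
      map_add' := fun x y => funext fun g => by
        simp only [Pi.add_apply, add_mul, Finset.sum_add_distrib]
      map_smul' := fun c x => funext fun g => by
        simp only [Pi.smul_apply, smul_eq_mul, Finset.mul_sum, mul_assoc, RingHom.id_apply] }
  have hT : ¬ Function.Injective T := by
    intro hT
    have := card_le_of_injective (R := Poly V) (α := Fin k) (β := G) T hT
    rw [Fintype.card_fin, ← Nat.card_eq_fintype_card] at this
    omega
  rw [← LinearMap.ker_eq_bot, Submodule.eq_bot_iff] at hT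
  push Not at hT
  obtain ⟨x, hx, hx0⟩ := hT
  obtain ⟨i₀, hi₀⟩ : ∃ i, x i ≠ 0 := by
    by_contra h
    push Not at h
    exact hx0 (funext h)
  obtain ⟨s, hs⟩ := exists_trace_mul_ne_zero (G := G) hi₀
  refine hs (congrFun (independent_of_independent_mod hG he hind
    (a := fun i => trace G (s * x i)) (fun i => trace_mem_invariants _) ?_) i₀)
  simp only [trace_apply, Finset.sum_mul]
  rw [Finset.sum_comm]
  refine Finset.sum_eq_zero fun h _ => ?_
  -- Applying `h` to the relation at `h⁻¹` puts `h` on the coefficients and leaves `e i` unmoved.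
  have h1 := congrArg (act (h : V ≃ₗᵢ[ℂ] V)) (congrFun (LinearMap.mem_ker.1 hx) h⁻¹)
  change act (h : V ≃ₗᵢ[ℂ] V) (∑ i, x i * act ((h⁻¹ : G) : V ≃ₗᵢ[ℂ] V) (e i)) = act _ 0 at h1
  rw [map_zero, map_sum] at h1
  have h2 : ∀ i, act (h : V ≃ₗᵢ[ℂ] V) (x i * act ((h⁻¹ : G) : V ≃ₗᵢ[ℂ] V) (e i)) =
      act (h : V ≃ₗᵢ[ℂ] V) (x i) * e i := fun i => by
    rw [map_mul, ← act_mul, InvMemClass.coe_inv, mul_inv_cancel, act_one]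
  simp only [h2] at h1
  simp only [map_mul, mul_assoc, ← Finset.mul_sum, h1, mul_zero]


/-! ### Generators of the polynomials over the invariants -/

/-- The polynomials are generated by at most `|G|` elements over the invariants of `G`. -/
def GeneratedOverInvariants (G : Subgroup (V ≃ₗᵢ[ℂ] V)) : Prop :=
  ∃ k ≤ Nat.card G, ∃ e : Fin k → Poly V, ∀ f : Poly V, ∃ a : Fin k → Poly V,
    (∀ i, a i ∈ invariants G) ∧ f = ∑ i, a i * e i

/-- A largest homogeneous family that is independent modulo the invariants of positive degree spans
modulo them. By the graded Nakayama argument, an induction on the degree, it generates over the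
invariants. -/
lemma generatedOverInvariants_of_bound (h : CoinvariantBound G) : GeneratedOverInvariants G := by
  classical
  set p : ℕ → Prop := fun k => ∃ (d : Fin k → ℕ) (e : Fin k → Poly V),
    (∀ i, (e i).IsHomogeneous (d i)) ∧
    (∀ c : Fin k → ℂ, ∑ i, c i • e i ∈ invIdeal G 0 → c = 0) with hp
  have hle : ∀ k, p k → k ≤ Nat.card G := fun k ⟨d, e, h1, h2⟩ => h k d e h1 h2
  have h0 : p 0 := ⟨Fin.elim0, Fin.elim0, fun i => i.elim0, fun c _ => funext fun i => i.elim0⟩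
  set k := Nat.findGreatest p (Nat.card G) with hk
  have hpk : p k := Nat.findGreatest_spec (Nat.zero_le _) h0
  obtain ⟨d, e, he, hind⟩ := hpk
  refine ⟨k, hle k ⟨d, e, he, hind⟩, e, ?_⟩
  have hmod : ∀ (m : ℕ) (f : Poly V), f.IsHomogeneous m →
      ∃ c : Fin k → ℂ, f - ∑ i, c i • e i ∈ invIdeal G 0 := by
    intro m f hf
    have h1 : ¬ p (k + 1) := fun h1 =>
      Nat.findGreatest_is_greatest (Nat.lt_succ_self k) (hle _ h1) h1
    rw [hp] at h1
    push Not at h1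
    obtain ⟨c, hc, hc0⟩ := h1 (Fin.cons m d) (Fin.cons f e) (fun i => by
      refine Fin.cases ?_ (fun i => ?_) i
      · exact hf
      · exact he i)
    rw [Fin.sum_univ_succ] at hc
    simp only [Fin.cons_zero, Fin.cons_succ] at hc
    have h2 : c 0 ≠ 0 := by
      intro h2
      rw [h2, zero_smul, zero_add] at hc
      have h3 := hind (fun i => c i.succ) hc
      refine hc0 (funext fun i => ?_)
      refine Fin.cases h2 (fun i => ?_) i
      exact congrFun h3 i
    refine ⟨fun i => - (c 0)⁻¹ * c i.succ, ?_⟩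
    have h3 := (invIdeal G 0).mul_mem_left (MvPolynomial.C (c 0)⁻¹) hc
    rw [← MvPolynomial.smul_eq_C_mul, smul_add, smul_smul, inv_mul_cancel₀ h2, one_smul,
      Finset.smul_sum] at h3
    simpa only [neg_mul, neg_smul, Finset.sum_neg_distrib, sub_neg_eq_add, mul_smul] using h3
  set M := Submodule.span (invariants G) (Set.range e) with hM
  have hMℂ : ∀ (c : ℂ) (x : Poly V), x ∈ M → c • x ∈ M := fun c x hx => by
    have := M.smul_mem (algebraMap ℂ (invariants G) c) hx
    rwa [algebraMap_smul] at this
  have hhom : ∀ (m : ℕ) (f : Poly V), f.IsHomogeneous m → f ∈ M := by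
    intro m
    induction m using Nat.strong_induction_on with
    | _ m ih =>
      -- Splitting off an invariant of positive degree leaves a cofactor of smaller degree, already
      -- known to be in `M`.
      have hI : ∀ y ∈ invIdeal G 0, MvPolynomial.homogeneousComponent m y ∈ M := by
        intro y hy
        refine invIdeal_induction (p := fun y => MvPolynomial.homogeneousComponent m y ∈ M)
          (by rw [map_zero]; exact zero_mem _)
          (fun x y hx hy => by rw [map_add]; exact add_mem hx hy) ?_ hy
        intro r hr j hj hrj s
        rw [homogeneousComponent_mul hrj]
        split_ifs with hjm
        · exact M.smul_mem (⟨r, hr⟩ : invariants G) (ih (m - j) (by omega) _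
            (MvPolynomial.homogeneousComponent_isHomogeneous _ _))
        · exact zero_mem _
      intro f hf
      obtain ⟨c, hc⟩ := hmod m f hf
      have h1 := hI _ hc
      have h2 : MvPolynomial.homogeneousComponent m (∑ i, c i • e i) ∈ M := by
        rw [map_sum]
        refine sum_mem fun i _ => ?_
        rw [map_smul, MvPolynomial.homogeneousComponent_of_mem (he i)]
        split_ifs
        · exact hMℂ _ _ (Submodule.subset_span ⟨i, rfl⟩)
        · rw [smul_zero]; exact zero_mem _
      have h3 := add_mem h1 h2
      rwa [← map_add, sub_add_cancel, MvPolynomial.homogeneousComponent_eq_self hf] at h3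
  intro f
  have hf : f ∈ M := by
    rw [← f.sum_homogeneousComponent]
    exact sum_mem fun i _ => hhom i _ (MvPolynomial.homogeneousComponent_isHomogeneous _ _)
  rw [hM, Submodule.mem_span_range_iff_exists_fun] at hf
  obtain ⟨a, ha⟩ := hf
  exact ⟨fun i => a i, fun i => (a i).2, ha.symm⟩

/-! ### Coinvariants of the stabilizer of a vector -/

/-- The stabilizer of `v` in `G`. -/
def fixer (G : Subgroup (V ≃ₗᵢ[ℂ] V)) (v : V) : Subgroup (V ≃ₗᵢ[ℂ] V) where
  carrier := {g | g ∈ G ∧ g v = v}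
  mul_mem' := fun {a b} ⟨ha, ha'⟩ ⟨hb, hb'⟩ => ⟨G.mul_mem ha hb, by
    rw [LinearIsometryEquiv.coe_mul, Function.comp_apply, hb', ha']⟩
  one_mem' := ⟨G.one_mem, rfl⟩
  inv_mem' := fun {a} ⟨ha, ha'⟩ => ⟨G.inv_mem ha, by
    rw [LinearIsometryEquiv.coe_inv, LinearIsometryEquiv.symm_apply_eq, ha']⟩

lemma fixer_le (G : Subgroup (V ≃ₗᵢ[ℂ] V)) (v : V) : fixer G v ≤ G := fun _ h => h.1

lemma homogeneousComponent_mul_eq_zero {x y : Poly V} {a b : ℕ}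
    (hx : ∀ j < a, MvPolynomial.homogeneousComponent j x = 0)
    (hy : ∀ j < b, MvPolynomial.homogeneousComponent j y = 0) :
    ∀ j < a + b, MvPolynomial.homogeneousComponent j (x * y) = 0 := by
  intro j hj
  rw [← x.sum_homogeneousComponent, Finset.sum_mul, map_sum]
  refine Finset.sum_eq_zero fun i _ => ?_
  rw [homogeneousComponent_mul (MvPolynomial.homogeneousComponent_isHomogeneous i x)]
  split_ifs with h
  · by_cases hi : i < a
    · rw [hx i hi, zero_mul]
    · rw [hy _ (by omega), mul_zero]
  · rfl

lemma homogeneousComponent_zero_eq (f : Poly V) :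
    MvPolynomial.homogeneousComponent 0 f = MvPolynomial.C (evalAt 0 f) := by
  rw [MvPolynomial.homogeneousComponent_zero]
  congr 1
  rw [evalAt]
  simp only [map_zero, Finsupp.coe_zero, Pi.zero_apply]
  rw [← MvPolynomial.constantCoeff_eq]
  exact (MvPolynomial.aeval_zero' f).symm

lemma homogeneousComponent_eq_zero_of_mem_pow {K : ℕ} {x : Poly V}
    (hx : x ∈ (RingHom.ker (evalAt (0 : V))) ^ K) :
    ∀ j < K, MvPolynomial.homogeneousComponent j x = 0 := by
  induction K generalizing x with
  | zero => intro j hj; omega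
  | succ K ih =>
    rw [pow_succ'] at hx
    refine Submodule.mul_induction_on hx ?_ ?_
    · intro y hy z hz
      rw [add_comm]
      refine homogeneousComponent_mul_eq_zero ?_ (ih hz)
      intro j hj
      rw [show j = 0 by omega, homogeneousComponent_zero_eq, (RingHom.mem_ker).1 hy, map_zero]
    · intro y z hy hz j hj
      rw [map_add, hy j hj, hz j hj, add_zero]

/-- The ideal generated by the invariants that vanish at `v`. -/
def invIdealAt (G : Subgroup (V ≃ₗᵢ[ℂ] V)) (v : V) : Ideal (Poly V) :=
  Ideal.span {a | a ∈ invariants G ∧ evalAt v a = 0}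

lemma act_mem_invIdealAt {v : V} {x : Poly V} (hx : x ∈ invIdealAt G v) {g : V ≃ₗᵢ[ℂ] V}
    (hg : g ∈ G) : act g x ∈ invIdealAt G v := by
  have : invIdealAt G v ≤ (invIdealAt G v).comap (act g) := by
    refine Ideal.span_le.2 ?_
    rintro a ⟨ha, ha'⟩
    change act g a ∈ invIdealAt G v
    rw [ha g hg]
    exact Ideal.subset_span ⟨ha, ha'⟩
  exact this hx

/-- Translation by `v` commutes with the elements that fix `v`. So it turns invariants of `G` that
vanish at `v` into invariants of the stabilizer without constant term. -/
lemma translate_mem_invIdeal {v : V} {x : Poly V} (hx : x ∈ invIdealAt G v) :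
    translate v x ∈ invIdeal (fixer G v) 0 := by
  have : invIdealAt G v ≤ (invIdeal (fixer G v) 0).comap (translate v) := by
    refine Ideal.span_le.2 ?_
    rintro a ⟨ha, ha'⟩
    change translate v a ∈ invIdeal (fixer G v) 0
    have hinv : translate v a ∈ invariants (fixer G v) := by
      intro q hq
      refine poly_ext fun u => ?_
      have hq' : q⁻¹ v = v := ((fixer G v).inv_mem hq).2
      rw [evalAt_act, evalAt_translate, evalAt_translate]
      conv_lhs => rw [← hq', ← map_add]
      exact evalAt_invariant ha (G.inv_mem hq.1) _
    rw [← (translate v a).sum_homogeneousComponent]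
    refine sum_mem fun i _ => ?_
    rcases Nat.eq_zero_or_pos i with rfl | hi
    · rw [homogeneousComponent_zero_eq, evalAt_translate, zero_add, ha', map_zero]
      exact zero_mem _
    · exact mem_invIdeal (homogeneousComponent_mem_invariants hinv i) hi
        (MvPolynomial.homogeneousComponent_isHomogeneous _ _)
  exact this hx

/-- An index set of polynomials independent modulo the invariants that vanish at `v` has at most
`|G|` elements. -/
lemma card_le_of_independent_mod_invIdealAt (hG : GeneratedOverInvariants G) (v : V)
    {ι : Type*} [Fintype ι] (F : ι → Poly V)
    (hF : ∀ c : ι → ℂ, ∑ i, c i • F i ∈ invIdealAt G v → c = 0) :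
    Fintype.card ι ≤ Nat.card G := by
  obtain ⟨k, hk, e, he⟩ := hG
  choose a ha hae using fun i => he (F i)
  let T : (ι → ℂ) →ₗ[ℂ] (Fin k → ℂ) :=
    { toFun := fun c j => ∑ i, c i * evalAt v (a i j)
      map_add' := fun x y => funext fun g => by
        simp only [Pi.add_apply, add_mul, Finset.sum_add_distrib]
      map_smul' := fun c x => funext fun g => by
        simp only [Pi.smul_apply, smul_eq_mul, Finset.mul_sum, mul_assoc, RingHom.id_apply] }
  have hT : Function.Injective T := by
    rw [← LinearMap.ker_eq_bot, Submodule.eq_bot_iff]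
    intro c hc
    refine hF c ?_
    -- Modulo the ideal each invariant coefficient equals its value at `v`, so a vector killed by
    -- the matrix of these values is a relation among the `F i`.
    have h1 : ∑ i, c i • F i = ∑ j, (∑ i, c i • a i j) * e j := by
      simp only [Finset.sum_mul]
      rw [Finset.sum_comm]
      refine Finset.sum_congr rfl fun i _ => ?_
      conv_lhs => rw [hae i]
      rw [Finset.smul_sum]
      exact Finset.sum_congr rfl fun j _ => (smul_mul_assoc _ _ _).symm
    rw [h1]
    refine sum_mem fun j _ => Ideal.mul_mem_right _ _ (Ideal.subset_span ⟨?_, ?_⟩)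
    · exact sum_mem fun i _ => (invariants G).smul_mem (ha i j) _
    · have := congrFun (LinearMap.mem_ker.1 hc) j
      simpa [T] using this
  have := card_le_of_injective (R := ℂ) (α := ι) (β := Fin k) T hT
  rw [Fintype.card_fin] at this
  exact this.trans hk

/-- The fibre of `V → V/G` through `v`, with multiplicities, consists of `[G : fixer G v]` copies of
the zero fibre of the stabilizer, and its length is at most `|G|`. Accordingly, copies of an
independent family, one near each point of the orbit of `v`, are independent modulo `invIdealAt G
v`. -/
lemma coinvariantBound_fixer [Finite G] (hG : GeneratedOverInvariants G) (v : V) :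
    CoinvariantBound (fixer G v) := by
  classical
  intro k d f hf hind
  have := Fintype.ofFinite G
  set H := (fixer G v).subgroupOf G with hH
  have hcard : Nat.card G = Nat.card (G ⧸ H) * Nat.card (fixer G v) := by
    rw [Subgroup.card_eq_card_quotient_mul_card_subgroup H,
      Nat.card_congr (Subgroup.subgroupOfEquivOfLe (fixer_le G v)).toEquiv]
  have hpos : 0 < Nat.card (G ⧸ H) := Nat.card_pos
  have := Fintype.ofFinite (G ⧸ H)
  have hout : ∀ t t' : G ⧸ H, (t.out : V ≃ₗᵢ[ℂ] V) v = (t'.out : V ≃ₗᵢ[ℂ] V) v → t = t' := by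
    intro t t' h
    rw [← QuotientGroup.out_eq' t, ← QuotientGroup.out_eq' t', QuotientGroup.eq,
      Subgroup.mem_subgroupOf]
    refine ⟨(t.out⁻¹ * t'.out).2, ?_⟩
    change (t.out : V ≃ₗᵢ[ℂ] V)⁻¹ ((t'.out : V ≃ₗᵢ[ℂ] V) v) = v
    rw [← h]
    exact (t.out : V ≃ₗᵢ[ℂ] V).symm_apply_apply v
  -- All degrees are below `K`, so the `f i` are determined by their expansions to order `K`.
  obtain ⟨K, hK⟩ : ∃ K, ∀ i, d i < K :=
    ⟨∑ i, d i + 1, fun i => Nat.lt_succ_of_le (Finset.single_le_sum (f := d)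
      (fun _ _ => Nat.zero_le _) (Finset.mem_univ i))⟩
  have hsep : ∀ t : G ⧸ H, ∃ h : Poly V, evalAt ((t.out : V ≃ₗᵢ[ℂ] V) v) h = 1 ∧
      ∀ t', t' ≠ t → evalAt ((t'.out : V ≃ₗᵢ[ℂ] V) v) h = 0 := by
    intro t
    obtain ⟨h, h1, h2⟩ := exists_separating ((t.out : V ≃ₗᵢ[ℂ] V) v)
      ((fun t' : G ⧸ H => (t'.out : V ≃ₗᵢ[ℂ] V) v) '' {t' | t' ≠ t}) (Set.toFinite _) (by
        rintro ⟨t', ht', e⟩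
        exact ht' (hout _ _ e))
    exact ⟨h, h1, fun t' ht' => h2 _ ⟨t', ht', rfl⟩⟩
  choose h h1 h2 using hsep
  -- Where `h t` is `1`, the factor `1 - h t ^ K` vanishes and `φ t` is `1` to order `K`. Where `h
  -- t` is `0`, `φ t` vanishes to order `K`, being divisible by `h t ^ K`.
  set φ : G ⧸ H → Poly V := fun t => 1 - (1 - h t ^ K) ^ K with hφ
  set 𝔫 : Ideal (Poly V) := RingHom.ker (evalAt v) with h𝔫
  have hφ1 : ∀ t : G ⧸ H, act (t.out : V ≃ₗᵢ[ℂ] V)⁻¹ (φ t) - 1 ∈ 𝔫 ^ K := by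
    intro t
    have h3 : 1 - act (t.out : V ≃ₗᵢ[ℂ] V)⁻¹ (h t) ∈ 𝔫 := by
      rw [h𝔫, RingHom.mem_ker, map_sub, evalAt_act, inv_inv, h1, map_one, sub_self]
    have h4 : 1 - act (t.out : V ≃ₗᵢ[ℂ] V)⁻¹ (h t) ^ K ∈ 𝔫 := by
      have := sub_dvd_pow_sub_pow 1 (act (t.out : V ≃ₗᵢ[ℂ] V)⁻¹ (h t)) K
      rw [one_pow] at this
      exact Ideal.mem_of_dvd _ this h3
    have h5 := neg_mem (Ideal.pow_mem_pow h4 K)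
    rw [hφ]
    simpa using h5
  have hφ0 : ∀ t t' : G ⧸ H, t ≠ t' → act (t.out : V ≃ₗᵢ[ℂ] V)⁻¹ (φ t') ∈ 𝔫 ^ K := by
    intro t t' htt
    have h3 : act (t.out : V ≃ₗᵢ[ℂ] V)⁻¹ (h t') ∈ 𝔫 := by
      rw [h𝔫, RingHom.mem_ker, evalAt_act, inv_inv, h2 _ _ htt]
    have h4 := Ideal.pow_mem_pow h3 K
    have := sub_dvd_pow_sub_pow 1 (1 - act (t.out : V ≃ₗᵢ[ℂ] V)⁻¹ (h t') ^ K) K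
    rw [one_pow, sub_sub_cancel] at this
    rw [hφ]
    simpa using Ideal.mem_of_dvd _ this h4
  have key := card_le_of_independent_mod_invIdealAt hG v
    (fun x : (G ⧸ H) × Fin k => φ x.1 *
      act (x.1.out : V ≃ₗᵢ[ℂ] V) (translate (-v) (f x.2))) ?_
  · rw [Fintype.card_prod, Fintype.card_fin, ← Nat.card_eq_fintype_card, hcard] at key
    exact Nat.le_of_mul_le_mul_left key hpos
  intro c hc
  have hzero : ∀ t, (fun j => c (t, j)) = 0 := by
    intro t
    refine hind _ ?_
    have h3 := act_mem_invIdealAt hc (G.inv_mem t.out.2)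
    set y := act (t.out : V ≃ₗᵢ[ℂ] V)⁻¹ (∑ x : (G ⧸ H) × Fin k, c x • (φ x.1 *
      act (x.1.out : V ≃ₗᵢ[ℂ] V) (translate (-v) (f x.2)))) with hy
    -- After the orbit point of `t` has been moved back to `v`, only the terms that belong to `t`
    -- are visible to order `K`.
    have h4 : ∑ j, c (t, j) • translate (-v) (f j) - y ∈ 𝔫 ^ K := by
      have h5 : y = ∑ t' : G ⧸ H, ∑ j, c (t', j) • (act (t.out : V ≃ₗᵢ[ℂ] V)⁻¹ (φ t') *
          act (t.out : V ≃ₗᵢ[ℂ] V)⁻¹ (act (t'.out : V ≃ₗᵢ[ℂ] V) (translate (-v) (f j)))) := by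
        rw [hy, Fintype.sum_prod_type]
        simp only [map_sum, map_smul, map_mul]
      rw [h5, ← Finset.add_sum_erase _ _ (Finset.mem_univ t), ← sub_sub]
      refine sub_mem ?_ (sum_mem fun t' ht' => sum_mem fun j _ => ?_)
      · rw [← Finset.sum_sub_distrib]
        refine sum_mem fun j _ => ?_
        rw [act_inv_act, ← smul_sub, MvPolynomial.smul_eq_C_mul]
        refine Ideal.mul_mem_left _ _ ?_
        have h6 := neg_mem (Ideal.mul_mem_right (translate (-v) (f j)) _ (hφ1 t))
        rwa [sub_mul, one_mul, neg_sub] at h6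
      · rw [MvPolynomial.smul_eq_C_mul]
        exact Ideal.mul_mem_left _ _
          (Ideal.mul_mem_right _ _ (hφ0 t t' (Finset.ne_of_mem_erase ht').symm))
    set x := ∑ j, c (t, j) • f j with hx
    have h5 : translate v (∑ j, c (t, j) • translate (-v) (f j)) = x := by
      rw [map_sum, hx]
      refine Finset.sum_congr rfl fun j _ => ?_
      rw [map_smul]
      congr 1
      refine poly_ext fun u => ?_
      rw [evalAt_translate, evalAt_translate, add_neg_cancel_right]
    have h6 : translate v y ∈ invIdeal (fixer G v) 0 := translate_mem_invIdeal h3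
    have h7 : x - translate v y ∈ (RingHom.ker (evalAt (0 : V))) ^ K := by
      rw [← h5, ← map_sub]
      have h8 : 𝔫 ≤ (RingHom.ker (evalAt (0 : V))).comap (translate v) := by
        intro z hz
        rw [Ideal.mem_comap, RingHom.mem_ker, evalAt_translate, zero_add]
        exact hz
      exact Ideal.le_comap_pow _ K (Ideal.pow_right_mono h8 K h4)
    -- Below degree `K` the components of `x` are those of an element of the ideal; from degree `K`
    -- on they vanish.
    rw [← x.sum_homogeneousComponent]
    refine sum_mem fun i _ => ?_
    by_cases hi : i < K
    · have h8 := homogeneousComponent_eq_zero_of_mem_pow h7 i hi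
      rw [map_sub, sub_eq_zero] at h8
      rw [h8]
      exact homogeneousComponent_mem_invIdeal h6 i
    · rw [hx, map_sum]
      refine sum_mem fun j _ => ?_
      rw [map_smul, MvPolynomial.homogeneousComponent_of_mem (hf j), if_neg, smul_zero]
      · exact zero_mem _
      · have := hK j
        omega
  exact funext fun x => congrFun (hzero x.1) x.2

/-! ### Steinberg's fixed point theorem -/


lemma fixedSpace_ne_top {g : V ≃ₗᵢ[ℂ] V} (hg : g ≠ 1) : fixedSpace g ≠ ⊤ := by
  intro h
  refine hg (LinearIsometryEquiv.ext fun v => ?_)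
  have : v ∈ fixedSpace g := h ▸ Submodule.mem_top
  exact this

/-- A free orbit has `|G|` points, and polynomials realize every function on it. Invariants are
constant on the orbit, so the values of the generators already span these functions; having at most
`|G|` members, the family has exactly `|G|`, with invertible matrix of values. -/
lemma generators_injective [Finite G] {k : ℕ} (hk : k ≤ Nat.card G) {e : Fin k → Poly V}
    (he : ∀ f : Poly V, ∃ a : Fin k → Poly V, (∀ i, a i ∈ invariants G) ∧ f = ∑ i, a i * e i)
    {u : V} (hu : ∀ g ∈ G, g u = u → g = 1) :
    k = Nat.card G ∧ ∀ x : Fin k → ℂ,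
      (∀ g ∈ G, ∑ i, x i * evalAt (g u) (e i) = 0) → x = 0 := by
  classical
  have := Fintype.ofFinite G
  let T : (Fin k → ℂ) →ₗ[ℂ] (G → ℂ) :=
    { toFun := fun x g => ∑ i, x i * evalAt ((g : V ≃ₗᵢ[ℂ] V) u) (e i)
      map_add' := fun x y => funext fun g => by
        simp only [Pi.add_apply, add_mul, Finset.sum_add_distrib]
      map_smul' := fun c x => funext fun g => by
        simp only [Pi.smul_apply, smul_eq_mul, Finset.mul_sum, mul_assoc, RingHom.id_apply] }
  have hinj : ∀ g h : G, (g : V ≃ₗᵢ[ℂ] V) u = (h : V ≃ₗᵢ[ℂ] V) u → g = h := by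
    intro g h hgh
    have h1 := hu ((h : V ≃ₗᵢ[ℂ] V)⁻¹ * g) (G.mul_mem (G.inv_mem h.2) g.2) (by
      rw [LinearIsometryEquiv.coe_mul, Function.comp_apply, hgh]
      exact (h : V ≃ₗᵢ[ℂ] V).symm_apply_apply u)
    exact Subtype.ext (inv_mul_eq_one.1 h1).symm
  have hsurj : Function.Surjective T := by
    intro y
    have hsep : ∀ g : G, ∃ h : Poly V, evalAt ((g : V ≃ₗᵢ[ℂ] V) u) h = 1 ∧
        ∀ g' : G, g' ≠ g → evalAt ((g' : V ≃ₗᵢ[ℂ] V) u) h = 0 := by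
      intro g
      obtain ⟨h, h1, h2⟩ := exists_separating ((g : V ≃ₗᵢ[ℂ] V) u)
        ((fun g' : G => (g' : V ≃ₗᵢ[ℂ] V) u) '' {g' | g' ≠ g}) (Set.toFinite _) (by
          rintro ⟨g', hg', e⟩
          exact hg' (hinj _ _ e))
      exact ⟨h, h1, fun g' hg' => h2 _ ⟨g', hg', rfl⟩⟩
    choose h h1 h2 using hsep
    obtain ⟨a, ha, hae⟩ := he (∑ g, y g • h g)
    refine ⟨fun i => evalAt u (a i), funext fun g => ?_⟩
    have h3 := congrArg (evalAt ((g : V ≃ₗᵢ[ℂ] V) u)) hae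
    simp only [map_sum, map_smul, map_mul, smul_eq_mul] at h3
    rw [Finset.sum_eq_single g (fun g' _ hg' => by rw [h2 _ _ hg'.symm, mul_zero])
      (fun h => absurd (Finset.mem_univ g) h), h1, mul_one] at h3
    rw [h3]
    change ∑ i, evalAt u (a i) * evalAt ((g : V ≃ₗᵢ[ℂ] V) u) (e i) = _
    exact Finset.sum_congr rfl fun i _ => by rw [evalAt_invariant (ha i) g.2]
  have hdim : k = Nat.card G := by
    refine le_antisymm hk ?_
    have := LinearMap.finrank_le_finrank_of_surjective (f := T) hsurj
    rwa [Module.finrank_fintype_fun_eq_card, Module.finrank_fintype_fun_eq_card,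
      Fintype.card_fin, ← Nat.card_eq_fintype_card] at this
  refine ⟨hdim, fun x hx => ?_⟩
  have hTi : Function.Injective T := by
    rw [LinearMap.injective_iff_surjective_of_finrank_eq_finrank]
    · exact hsurj
    · rw [Module.finrank_fintype_fun_eq_card, Module.finrank_fintype_fun_eq_card,
        Fintype.card_fin, ← Nat.card_eq_fintype_card, hdim]
  exact hTi ((funext fun g => hx g g.2 : T x = 0).trans (map_zero T).symm)

lemma exists_trivial_stabilizer (G : Subgroup (V ≃ₗᵢ[ℂ] V)) [Finite G] :
    ∃ u : V, ∀ g ∈ G, g u = u → g = 1 := by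
  by_contra h
  push Not at h
  refine one_ne_zero (poly_eq_zero_of_generic
    (fun g : {g : G // (g : V ≃ₗᵢ[ℂ] V) ≠ 1} => fixedSpace (g : V ≃ₗᵢ[ℂ] V))
    (fun g => fixedSpace_ne_top g.2) (1 : Poly V) fun v hv => ?_)
  obtain ⟨g, hg, hgv, hne⟩ := h v
  exact absurd hgv (hv ⟨⟨g, hg⟩, hne⟩)

/-- At a vector with free orbit the values of the coefficients are killed by an invertible matrix,
and all vectors outside finitely many proper subspaces are of this kind. So the generators form a
basis. -/
lemma independent_generators [Finite G] {k : ℕ} (hk : k ≤ Nat.card G) {e : Fin k → Poly V}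
    (he : ∀ f : Poly V, ∃ a : Fin k → Poly V, (∀ i, a i ∈ invariants G) ∧ f = ∑ i, a i * e i)
    {a : Fin k → Poly V} (ha : ∀ i, a i ∈ invariants G) (h0 : ∑ i, a i * e i = 0) (i : Fin k) :
    a i = 0 := by
  refine poly_eq_zero_of_generic
    (fun g : {g : G // (g : V ≃ₗᵢ[ℂ] V) ≠ 1} => fixedSpace (g : V ≃ₗᵢ[ℂ] V))
    (fun g => fixedSpace_ne_top g.2) (a i) fun v hv => ?_
  refine congrFun ((generators_injective hk he (u := v) ?_).2 (fun i => evalAt v (a i)) ?_) i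
  · intro g hg hgv
    by_contra hne
    exact hv ⟨⟨g, hg⟩, hne⟩ hgv
  · intro g hg
    have := congrArg (evalAt (g v)) h0
    simp only [map_sum, map_mul, map_zero] at this
    rw [← this]
    exact Finset.sum_congr rfl fun j _ => by rw [evalAt_invariant (ha j) hg]

lemma exists_polynomial_evalAt (f : Poly V) (y w : V) :
    ∃ p : Polynomial ℂ, ∀ s : ℂ, p.eval s = evalAt (s • y + w) f := by
  refine ⟨MvPolynomial.aeval (fun i => Polynomial.C ((Module.finBasis ℂ V).repr y i) *
    Polynomial.X + Polynomial.C ((Module.finBasis ℂ V).repr w i)) f, fun s => ?_⟩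
  have : (Polynomial.aeval s).comp (MvPolynomial.aeval (R := ℂ) (fun i =>
      Polynomial.C ((Module.finBasis ℂ V).repr y i) * Polynomial.X +
        Polynomial.C ((Module.finBasis ℂ V).repr w i))) = evalAt (s • y + w) := by
    refine MvPolynomial.algHom_ext fun i => ?_
    simp only [AlgHom.comp_apply, MvPolynomial.aeval_X, evalAt, map_add, map_mul,
      Polynomial.aeval_C, Polynomial.aeval_X, map_smul, Finsupp.add_apply, Finsupp.smul_apply,
      smul_eq_mul, Algebra.algebraMap_self, RingHom.id_apply]
    ring
  rw [← Polynomial.coe_aeval_eq_eval]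
  exact DFunLike.congr_fun this f

/-- The values of a polynomial without zeros outside subspaces of codimension at least two. -/
lemma evalAt_zero_ne_zero {ι : Type*} [Finite ι] [Nonempty ι] (p : ι → Submodule ℂ V)
    (hp : ∀ i, Module.finrank ℂ (p i) + 1 < Module.finrank ℂ V) (f : Poly V)
    (hf : ∀ v : V, (∀ i, v ∉ p i) → evalAt v f ≠ 0) : evalAt (0 : V) f ≠ 0 := by
  have avoid : ∀ q : ι → Submodule ℂ V, (∀ i, q i ≠ ⊤) → ∃ y, ∀ i, y ∉ q i := by
    intro q hq
    by_contra h
    push Not at h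
    refine one_ne_zero (poly_eq_zero_of_generic q hq (1 : Poly V) fun v hv => ?_)
    obtain ⟨i, hi⟩ := h v
    exact absurd hi (hv i)
  have htop : ∀ q : Submodule ℂ V, Module.finrank ℂ q < Module.finrank ℂ V → q ≠ ⊤ := by
    rintro q hq rfl
    rw [finrank_top] at hq
    exact lt_irrefl _ hq
  obtain ⟨y, hy⟩ := avoid p fun i => htop _ (by have := hp i; omega)
  -- Here the codimension matters: `p i` enlarged by `y` is still proper. The plane of `y` and `z`
  -- meets each `p i` only in zero.
  obtain ⟨z, hz⟩ := avoid (fun i => p i ⊔ Submodule.span ℂ {y}) fun i => htop _ (by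
    have h1 := Submodule.finrank_add_le_finrank_add_finrank (p i) (Submodule.span ℂ {y})
    have h2 : Module.finrank ℂ (Submodule.span ℂ {y}) ≤ 1 :=
      (finrank_span_le_card ({y} : Set V)).trans (by simp)
    have := hp i
    omega)
  have hgood : ∀ s t : ℂ, t ≠ 0 → evalAt (s • y + t • z) f ≠ 0 := by
    intro s t ht
    refine hf _ fun i hi => hz i ?_
    have h1 : z = t⁻¹ • (s • y + t • z) + (-(t⁻¹ * s)) • y := by
      rw [smul_add, smul_smul, smul_smul, inv_mul_cancel₀ ht, one_smul, neg_smul]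
      abel
    rw [h1]
    exact add_mem (Submodule.mem_sup_left ((p i).smul_mem _ hi))
      (Submodule.mem_sup_right (Submodule.smul_mem _ _ (Submodule.mem_span_singleton_self y)))
  -- Without zeros on the line `t z + ℂ y`, the polynomial is constant there. As an identity between
  -- polynomials in `t` this extends to `t = 0`, which compares the values at `y` and at the origin.
  have hconst : ∀ t : ℂ, t ≠ 0 → evalAt (t • z + y) f = evalAt (t • z + 0) f := by
    intro t ht
    obtain ⟨q, hq⟩ := exists_polynomial_evalAt f y (t • z)
    have hdeg : q.degree ≤ 0 := by
      by_contra hdeg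
      push Not at hdeg
      obtain ⟨s, hs⟩ := IsAlgClosed.exists_root q hdeg.ne'
      exact hgood s t ht (by rw [← hq]; exact hs)
    have h1 := hq 1
    have h2 := hq 0
    rw [Polynomial.eq_C_of_degree_le_zero hdeg, Polynomial.eval_C] at h1 h2
    rw [add_comm, ← one_smul ℂ y, ← h1, h2, zero_smul, zero_add, add_zero]
  obtain ⟨q1, hq1⟩ := exists_polynomial_evalAt f z y
  obtain ⟨q2, hq2⟩ := exists_polynomial_evalAt f z 0
  have heq : q1 = q2 := by
    refine Polynomial.eq_of_infinite_eval_eq _ _ ?_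
    refine Set.Infinite.mono (s := {0}ᶜ) ?_ (Set.finite_singleton _).infinite_compl
    intro t ht
    change q1.eval t = q2.eval t
    rw [hq1, hq2]
    exact hconst t ht
  have h3 := hq1 0
  rw [heq, hq2] at h3
  simp only [zero_smul, zero_add] at h3
  rw [h3]
  exact hf y hy

/-- Steinberg's criterion: a finite group over whose invariants the polynomials have a small
system of generators is generated by reflections. -/
lemma le_of_generatedOverInvariants {Q P : Subgroup (V ≃ₗᵢ[ℂ] V)} [Finite Q] (hPQ : P ≤ Q)
    (hnormal : ∀ q ∈ Q, ∀ p ∈ P, q * p * q⁻¹ ∈ P)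
    (href : ∀ q ∈ Q, IsReflection q → q ∈ P)
    (hQ : GeneratedOverInvariants Q) (hP : GeneratedOverInvariants P) : Q ≤ P := by
  classical
  have := Fintype.ofFinite Q
  have : Finite P := Finite.of_injective _ (Subgroup.inclusion_injective hPQ)
  have := Fintype.ofFinite P
  by_contra hQP
  obtain ⟨q₀, hq₀, hq₀P⟩ := SetLike.not_le_iff_exists.1 hQP
  obtain ⟨k, hk, e, he⟩ := hQ
  obtain ⟨l, hl, b, hb⟩ := hP
  obtain ⟨u₁, hu₁⟩ := exists_trivial_stabilizer Q
  obtain ⟨hkcard, -⟩ := generators_injective hk he hu₁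
  obtain ⟨hlcard, -⟩ := generators_injective hl hb (fun g hg => hu₁ g (hPQ hg))
  choose c hc hec using fun i => hb (e i)
  set H := P.subgroupOf Q with hH
  have hcard : Nat.card Q = Nat.card (Q ⧸ H) * Nat.card P := by
    rw [Subgroup.card_eq_card_quotient_mul_card_subgroup H,
      Nat.card_congr (Subgroup.subgroupOfEquivOfLe hPQ).toEquiv]
  have := Fintype.ofFinite (Q ⧸ H)
  obtain ⟨σ⟩ : Nonempty (Fin k ≃ (Q ⧸ H) × Fin l) := by
    rw [← Fintype.card_eq, Fintype.card_prod, Fintype.card_fin, Fintype.card_fin,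
      ← Nat.card_eq_fintype_card, hkcard, hcard, hlcard]
  -- Row `(κ, j)` holds the translates by `κ` of the `j`-th coordinates of the `e i` in the basis
  -- `b` over the invariants of `P`. The matrix is square because `k = |Q| = [Q : P] l`.
  set M : Matrix (Fin k) (Fin k) (Poly V) := fun m i =>
    act ((σ m).1.out : V ≃ₗᵢ[ℂ] V) (c i (σ m).2) with hM
  have hdet : ∀ u : V, evalAt u M.det = ((evalAt u).mapMatrix M).det := fun u =>
    AlgHom.map_det _ _
  have hMe : ∀ u m i, (evalAt u).mapMatrix M m i =
      evalAt (((σ m).1.out : V ≃ₗᵢ[ℂ] V)⁻¹ u) (c i (σ m).2) := fun u m i => evalAt_act _ _ _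
  -- Different cosets give points `κ⁻¹ u` in different orbits of `P`: by normality, `κ p⁻¹ κ'⁻¹ ∈ P`
  -- yields `κ'⁻¹ κ ∈ P`.
  have hcoset : ∀ κ κ' : Q ⧸ H, ∀ p ∈ P, ∀ u : V, (∀ q ∈ Q, q u = u → q ∈ P) →
      p⁻¹ ((κ'.out : V ≃ₗᵢ[ℂ] V)⁻¹ u) = (κ.out : V ≃ₗᵢ[ℂ] V)⁻¹ u → κ' = κ := by
    intro κ κ' p hp u hu h
    have h1 : (κ.out : V ≃ₗᵢ[ℂ] V) * p⁻¹ * (κ'.out : V ≃ₗᵢ[ℂ] V)⁻¹ ∈ P := by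
      refine hu _ (Q.mul_mem (Q.mul_mem κ.out.2 (hPQ (P.inv_mem hp))) (Q.inv_mem κ'.out.2)) ?_
      change (κ.out : V ≃ₗᵢ[ℂ] V) (p⁻¹ ((κ'.out : V ≃ₗᵢ[ℂ] V)⁻¹ u)) = u
      rw [h]
      exact (κ.out : V ≃ₗᵢ[ℂ] V).apply_symm_apply u
    have h2 := hnormal _ (Q.inv_mem κ'.out.2) _
      (P.mul_mem h1 (hnormal _ κ'.out.2 _ (P.inv_mem (hnormal _ (Q.inv_mem κ'.out.2) _
        (P.inv_mem hp)))))
    have h3 := hnormal _ κ.out.2 p hp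
    have h4 := P.mul_mem h3 h1
    have h5 := hnormal _ (Q.inv_mem κ'.out.2) _ h4
    rw [← QuotientGroup.out_eq' κ, ← QuotientGroup.out_eq' κ', QuotientGroup.eq,
      Subgroup.mem_subgroupOf]
    change (κ'.out : V ≃ₗᵢ[ℂ] V)⁻¹ * (κ.out : V ≃ₗᵢ[ℂ] V) ∈ P
    convert h5 using 1
    group
  have hgood : ∀ u : V, (∀ q ∈ Q, q u = u → q ∈ P) → evalAt u M.det ≠ 0 := by
    intro u hu
    -- Invariants that separate these orbits, obtained by averaging a separating polynomial over
    -- `P`.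
    have hχ : ∀ κ : Q ⧸ H, ∃ χ ∈ invariants P,
        evalAt ((κ.out : V ≃ₗᵢ[ℂ] V)⁻¹ u) χ = 1 ∧
        ∀ κ', κ' ≠ κ → evalAt ((κ'.out : V ≃ₗᵢ[ℂ] V)⁻¹ u) χ = 0 := by
      intro κ
      obtain ⟨h, h1, h2⟩ := exists_separating ((κ.out : V ≃ₗᵢ[ℂ] V)⁻¹ u)
        ((Set.range fun q : Q => (q : V ≃ₗᵢ[ℂ] V) u) \ {(κ.out : V ≃ₗᵢ[ℂ] V)⁻¹ u})
        (Set.toFinite _) (by simp)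
      have hval : ∀ κ' : Q ⧸ H, ∀ p : P, evalAt ((κ'.out : V ≃ₗᵢ[ℂ] V)⁻¹ u)
          (act (p : V ≃ₗᵢ[ℂ] V) h) = if (p : V ≃ₗᵢ[ℂ] V)⁻¹ ((κ'.out : V ≃ₗᵢ[ℂ] V)⁻¹ u) =
            (κ.out : V ≃ₗᵢ[ℂ] V)⁻¹ u then 1 else 0 := by
        intro κ' p
        rw [evalAt_act]
        split_ifs with hp
        · rw [hp, h1]
        · exact h2 _ ⟨⟨⟨_, Q.mul_mem (Q.inv_mem (hPQ p.2)) (Q.inv_mem κ'.out.2)⟩, rfl⟩, hp⟩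
      set m := (Finset.univ.filter fun p : P => (p : V ≃ₗᵢ[ℂ] V)⁻¹
        ((κ.out : V ≃ₗᵢ[ℂ] V)⁻¹ u) = (κ.out : V ≃ₗᵢ[ℂ] V)⁻¹ u).card with hm
      have hm0 : (m : ℂ) ≠ 0 := Nat.cast_ne_zero.2 (Finset.card_ne_zero_of_mem
        (Finset.mem_filter.2 ⟨Finset.mem_univ (1 : P), by simp⟩))
      refine ⟨(m : ℂ)⁻¹ • trace P h, (invariants P).smul_mem (trace_mem_invariants h) _, ?_, ?_⟩
      · rw [map_smul, trace_apply, map_sum]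
        simp only [hval]
        rw [Finset.sum_boole, ← hm, smul_eq_mul, inv_mul_cancel₀ hm0]
      · intro κ' hκ'
        rw [map_smul, trace_apply, map_sum]
        simp only [hval]
        rw [Finset.sum_eq_zero, smul_zero]
        intro p _
        exact if_neg fun hp => hκ' (hcoset κ κ' p p.2 u hu hp)
    choose χ hχP hχ1 hχ0 using hχ
    rw [hdet, ← isUnit_iff_ne_zero, ← Matrix.isUnit_iff_isUnit_det,
      ← Matrix.mulVec_surjective_iff_isUnit]
    -- The prescribed values `y` are interpolated by invariants `f j` of `P`. Expanding `∑ f j * b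
    -- j` over the invariants of `Q` and comparing the coefficients of the basis `b` produces a
    -- preimage of `y`.
    intro y
    set f : Fin l → Poly V := fun j => ∑ κ, y (σ.symm (κ, j)) • χ κ with hf
    have hfP : ∀ j, f j ∈ invariants P := fun j =>
      sum_mem fun κ _ => (invariants P).smul_mem (hχP κ) _
    obtain ⟨a, ha, hae⟩ := he (∑ j, f j * b j)
    have hrel : ∀ j, f j = ∑ i, a i * c i j := by
      intro j
      rw [← sub_eq_zero]
      refine independent_generators hl hb (a := fun j => f j - ∑ i, a i * c i j) (fun j =>
        sub_mem (hfP j) (sum_mem fun i _ => mul_mem (fun g hg => ha i g (hPQ hg)) (hc i j))) ?_ j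
      simp only [sub_mul, Finset.sum_sub_distrib]
      rw [hae, sub_eq_zero]
      simp only [Finset.sum_mul]
      rw [Finset.sum_comm]
      refine Finset.sum_congr rfl fun i _ => ?_
      conv_lhs => rw [hec i]
      rw [Finset.mul_sum]
      exact Finset.sum_congr rfl fun j _ => (mul_assoc _ _ _).symm
    refine ⟨fun i => evalAt u (a i), funext fun m => ?_⟩
    have h1 := congrArg (evalAt (((σ m).1.out : V ≃ₗᵢ[ℂ] V)⁻¹ u)) (hrel (σ m).2)
    simp only [hf, map_sum, map_smul, map_mul, smul_eq_mul] at h1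
    rw [Finset.sum_eq_single (σ m).1 (fun κ _ hκ => by rw [hχ0 _ _ hκ.symm, mul_zero])
      (fun h => absurd (Finset.mem_univ _) h), hχ1, mul_one, Prod.mk.eta,
      Equiv.symm_apply_apply] at h1
    rw [h1]
    change ∑ i, (evalAt u).mapMatrix M m i * evalAt u (a i) = _
    refine Finset.sum_congr rfl fun i _ => ?_
    rw [evalAt_invariant (ha i) (Q.inv_mem (σ m).1.out.2), mul_comm, hMe]
  have hne : Nonempty {q : Q // (q : V ≃ₗᵢ[ℂ] V) ∉ P} := ⟨⟨⟨q₀, hq₀⟩, hq₀P⟩⟩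
  refine evalAt_zero_ne_zero (fun q : {q : Q // (q : V ≃ₗᵢ[ℂ] V) ∉ P} =>
    fixedSpace (q : V ≃ₗᵢ[ℂ] V)) ?_ M.det ?_ ?_
  · rintro ⟨q, hq⟩
    have h1 : (q : V ≃ₗᵢ[ℂ] V) ≠ 1 := fun h => hq (h ▸ P.one_mem)
    -- An element outside `P` is neither the identity nor a reflection, so its fixed space has
    -- codimension at least two.
    have h2 : Module.finrank ℂ (fixedSpace (q : V ≃ₗᵢ[ℂ] V)) + 1 ≠ Module.finrank ℂ V :=
      fun h => hq (href q q.2 h)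
    have h3 := Submodule.finrank_lt (fixedSpace_ne_top h1)
    change Module.finrank ℂ (fixedSpace (q : V ≃ₗᵢ[ℂ] V)) + 1 < _
    omega
  · intro v hv
    refine hgood v fun q hq hqv => ?_
    by_contra hqP
    exact hv ⟨⟨q, hq⟩, hqP⟩ hqv
  -- At the origin the cosets act trivially, so the rows of two different cosets with the same `j`
  -- coincide.
  · have hl0 : 0 < l := hlcard ▸ Nat.card_pos
    have hκ : ((1 : Q) : Q ⧸ H) ≠ ((⟨q₀, hq₀⟩ : Q) : Q ⧸ H) := by
      intro h
      rw [QuotientGroup.eq, Subgroup.mem_subgroupOf] at h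
      simp at h
      exact hq₀P h
    rw [hdet]
    refine Matrix.det_zero_of_row_eq (i := σ.symm ((1 : Q), ⟨0, hl0⟩))
      (j := σ.symm ((⟨q₀, hq₀⟩ : Q), ⟨0, hl0⟩)) ?_ (funext fun i => ?_)
    · intro h
      exact hκ (congrArg Prod.fst (σ.symm.injective h))
    · simp only [hMe, Equiv.apply_symm_apply, map_zero]

/-- Steinberg's theorem: the stabilizer of a vector in a finite reflection group is generated by
reflections. -/
theorem steinberg [Finite G] (hG : IsReflectionGroup G) (v : V) :
    fixer G v ≤ Subgroup.closure {r | r ∈ fixer G v ∧ IsReflection r} := by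
  set Q := fixer G v with hQ
  set P := Subgroup.closure {r | r ∈ Q ∧ IsReflection r} with hP
  have : Finite Q := Finite.of_injective _ (Subgroup.inclusion_injective (fixer_le G v))
  have hPQ : P ≤ Q := (Subgroup.closure_le _).2 fun r hr => hr.1
  have : Finite P := Finite.of_injective _ (Subgroup.inclusion_injective hPQ)
  have hPref : IsReflectionGroup P := by
    refine le_antisymm ((Subgroup.closure_le _).2 fun r hr => hr.1) ?_
    conv_lhs => rw [hP]
    exact Subgroup.closure_mono fun r hr => ⟨Subgroup.subset_closure hr, hr.2⟩
  -- For `Q` the bound is inherited from `G`; for `P` it is Chevalley's bound, as `P` is generated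
  -- by its reflections. Normality holds because conjugates of reflections are reflections.
  refine le_of_generatedOverInvariants hPQ ?_ (fun q hq hqr => Subgroup.subset_closure ⟨hq, hqr⟩)
    (generatedOverInvariants_of_bound (coinvariantBound_fixer (generatedOverInvariants_of_bound
      (coinvariantBound_of_isReflectionGroup hG)) v))
    (generatedOverInvariants_of_bound (coinvariantBound_of_isReflectionGroup hPref))
  intro q hq p hp
  have hconj : P ≤ P.comap (MulAut.conj q).toMonoidHom := by
    refine (Subgroup.closure_le _).2 ?_
    rintro r ⟨hr, hrr⟩
    refine Subgroup.subset_closure ⟨Q.mul_mem (Q.mul_mem hq hr) (Q.inv_mem hq), ?_⟩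
    change Module.finrank ℂ (fixedSpace (q * r * q⁻¹)) + 1 = _
    rw [fixedSpace_conj, finrank_move]
    exact hrr
  exact hconj hp

/-! ### Components of the elements of the sum closure -/

section Components

variable {W : Subgroup (V ≃ₗᵢ[ℂ] V)}

lemma finrank_orthogonal_of_mem_arrangement {H : Submodule ℂ V} (hH : H ∈ arrangement W) :
    Module.finrank ℂ Hᗮ = 1 := by
  obtain ⟨g, -, hg, rfl⟩ := hH
  have h1 := Submodule.finrank_add_finrank_orthogonal (fixedSpace g)
  rw [IsReflection] at hg
  omega

lemma exists_span_orthogonal {H : Submodule ℂ V} (hH : H ∈ arrangement W) :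
    ∃ v : V, v ≠ 0 ∧ Hᗮ = Submodule.span ℂ {v} := by
  obtain ⟨v, hv, hs⟩ := finrank_eq_one_iff'.1 (finrank_orthogonal_of_mem_arrangement hH)
  refine ⟨v, fun h => hv (Subtype.ext h), le_antisymm (fun w hw => ?_) ?_⟩
  · obtain ⟨c, hc⟩ := hs ⟨w, hw⟩
    exact Submodule.mem_span_singleton.2 ⟨c, congrArg Subtype.val hc⟩
  · rw [Submodule.span_singleton_le_iff_mem]
    exact v.2

/-- The sum of the lines `Hᗮ`, `H` in the arrangement, with the property `p`. -/
def sumLines (W : Subgroup (V ≃ₗᵢ[ℂ] V)) (p : Submodule ℂ V → Prop) : Submodule ℂ V :=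
  sSup ((fun H : Submodule ℂ V => Hᗮ) '' {H | H ∈ arrangement W ∧ p Hᗮ})

lemma sumLines_mem_sumClosure (p : Submodule ℂ V → Prop) : sumLines W p ∈ sumClosure W :=
  ⟨_, fun _ h => h.1, rfl⟩

lemma le_sumLines {p : Submodule ℂ V → Prop} {H : Submodule ℂ V} (hH : H ∈ arrangement W)
    (hp : p Hᗮ) : Hᗮ ≤ sumLines W p := le_sSup ⟨H, ⟨hH, hp⟩, rfl⟩

lemma sumLines_le {p : Submodule ℂ V → Prop} {U : Submodule ℂ V}
    (h : ∀ H ∈ arrangement W, p Hᗮ → Hᗮ ≤ U) : sumLines W p ≤ U := by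
  refine sSup_le ?_
  rintro _ ⟨H, ⟨hH, hp⟩, rfl⟩
  exact h H hH hp

lemma sumLines_isOrtho {p : Submodule ℂ V → Prop} {U : Submodule ℂ V}
    (h : ∀ H ∈ arrangement W, p Hᗮ → Hᗮ ⟂ U) : sumLines W p ⟂ U :=
  sumLines_le h

lemma le_of_forall_lines {U B : Submodule ℂ V} (hU : U ∈ sumClosure W)
    (h : ∀ H ∈ arrangement W, Hᗮ ≤ U → Hᗮ ≤ B) : U ≤ B := by
  obtain ⟨S, hS, rfl⟩ := hU
  refine sSup_le ?_
  rintro _ ⟨H, hH, rfl⟩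
  exact h H (hS hH) (le_sSup ⟨H, hH, rfl⟩)

lemma exists_line_le {U : Submodule ℂ V} (hU : U ∈ sumClosure W) (h : U ≠ ⊥) :
    ∃ H ∈ arrangement W, Hᗮ ≤ U := by
  by_contra hc
  push Not at hc
  exact h (le_bot_iff.1 (le_of_forall_lines hU fun H hH hle => absurd hle (hc H hH)))

lemma line_mem_sumClosure {H : Submodule ℂ V} (hH : H ∈ arrangement W) : Hᗮ ∈ sumClosure W :=
  ⟨{H}, by simpa using hH, by simp⟩

lemma line_le_or_inf_eq_bot {H : Submodule ℂ V} (hH : H ∈ arrangement W) (B : Submodule ℂ V) :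
    Hᗮ ≤ B ∨ Hᗮ ⊓ B = ⊥ := by
  obtain ⟨v, hv, hs⟩ := exists_span_orthogonal hH
  by_cases h : v ∈ B
  · left
    rw [hs, Submodule.span_singleton_le_iff_mem]
    exact h
  · right
    rw [hs, ← disjoint_iff, disjoint_comm, Submodule.disjoint_span_singleton' hv]
    exact h

/-- A line is the sum of its intersections with the summands, and each intersection is zero or the
whole line. -/
lemma IsDecomposition.line_le {U : Submodule ℂ V} {k : ℕ} {u : Fin k → Submodule ℂ V}
    (h : IsDecomposition W U k u) {H : Submodule ℂ V} (hH : H ∈ arrangement W) (hle : Hᗮ ≤ U) :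
    ∃ i, Hᗮ ≤ u i := by
  by_contra hc
  push Not at hc
  have h1 := (h.2.2.2.2 _ (line_mem_sumClosure hH) hle).2
  have h2 : ∀ i, Hᗮ ⊓ u i = ⊥ := fun i => (line_le_or_inf_eq_bot hH (u i)).resolve_left (hc i)
  simp only [h2, iSup_bot] at h1
  have := finrank_orthogonal_of_mem_arrangement hH
  rw [← h1, finrank_bot] at this
  omega

lemma sub_mem_orthogonal_fixedSpace (r : V ≃ₗᵢ[ℂ] V) (v : V) : r v - v ∈ (fixedSpace r)ᗮ := by
  rw [Submodule.mem_orthogonal]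
  intro w hw
  have hw' : r w = w := hw
  rw [inner_sub_right]
  conv_lhs => rw [← hw', r.inner_map_map, hw']
  exact sub_self _

/-- Let `r` be a reflection with line in `u i`, and `v` on a line in `u j`. The line of `r v` lies
in some `u m`, and `r v - v` lies in `u i`. If `m = j`, then `r v - v` is in `u i` and in `u j`, so
`v` is fixed by `r`, hence orthogonal to its line. If `m ≠ j`, then `v` lies in the sum of the other
summands and is zero. -/
lemma IsDecomposition.isOrtho {U : Submodule ℂ V} {k : ℕ} {u : Fin k → Submodule ℂ V}
    (h : IsDecomposition W U k u) {i j : Fin k} (hij : i ≠ j) : u i ⟂ u j := by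
  refine le_of_forall_lines (h.2.1 i).2 fun H hH hHi => Submodule.IsOrtho.symm
    (le_of_forall_lines (h.2.1 j).2 fun H' hH' hHj v hv => ?_)
  obtain ⟨r, hr, href, rfl⟩ := hH
  have hle : ∀ i, u i ≤ U := fun i => h.2.2.2.1 ▸ le_iSup u i
  have hmv : (Wonderful.move r H')ᗮ ≤ U := by
    rw [← move_orthogonal]
    intro x hx
    rw [mem_move] at hx
    have h1 := sub_mem_orthogonal_fixedSpace r (r⁻¹ x)
    have h2 : r (r⁻¹ x) = x := r.apply_symm_apply x
    rw [h2] at h1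
    have := add_mem (hle i (hHi h1)) (hle j (hHj hx))
    rwa [sub_add_cancel] at this
  obtain ⟨m, hm⟩ := h.line_le (move_mem_arrangement hr hH') hmv
  have hrv : r v ∈ u m := by
    refine hm ?_
    rw [← move_orthogonal, mem_move]
    have : r⁻¹ (r v) = v := r.symm_apply_apply v
    rwa [this]
  have h1 : r v - v ∈ u i := hHi (sub_mem_orthogonal_fixedSpace r v)
  have hv' : v ∈ u j := hHj hv
  have hdis := h.2.2.1 j
  by_cases hmj : m = j
  · subst hmj
    have h2 : r v - v ∈ u m := sub_mem hrv hv'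
    have h3 : r v - v = 0 := by
      have := hdis.le_bot ⟨h2, (le_iSup₂_of_le i hij le_rfl : u i ≤ ⨆ j, ⨆ (_ : j ≠ m), u j) h1⟩
      exact this
    have hfix : v ∈ fixedSpace r := sub_eq_zero.1 h3
    exact (fixedSpace r).le_orthogonal_orthogonal hfix
  · have h2 : v ∈ ⨆ i, ⨆ (_ : i ≠ j), u i := by
      have h4 : v = r v - (r v - v) := (sub_sub_cancel _ _).symm
      rw [h4]
      exact sub_mem ((le_iSup₂_of_le m hmj le_rfl : u m ≤ ⨆ i, ⨆ (_ : i ≠ j), u i) hrv)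
        ((le_iSup₂_of_le i hij le_rfl : u i ≤ ⨆ i, ⨆ (_ : i ≠ j), u i) h1)
    have h3 : v = 0 := hdis.le_bot ⟨hv', h2⟩
    rw [h3]
    exact zero_mem _

/-- The components of `U`: the irreducible subspaces `B` of `U` such that all lines of `U` lie in
`B` or are orthogonal to `B`. -/
def IsComponent (W : Subgroup (V ≃ₗᵢ[ℂ] V)) (U B : Submodule ℂ V) : Prop :=
  B ∈ irreducibles W ∧ B ≤ U ∧ ∀ H ∈ arrangement W, Hᗮ ≤ U → Hᗮ ≤ B ∨ Hᗮ ⟂ B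

/-- A minimal nonzero member of `sumClosure W` with the line property is irreducible: the summands
of a decomposition are orthogonal, so each of them would be a smaller member with the same property.
-/
lemma exists_isComponent {U : Submodule ℂ V} (hU : U ∈ sumClosure W) (h : U ≠ ⊥) :
    ∃ B, IsComponent W U B := by
  obtain ⟨B, ⟨hB, hB0, hBU, hBl⟩, hmin⟩ := wellFounded_lt.has_min
    {B | B ∈ sumClosure W ∧ B ≠ ⊥ ∧ B ≤ U ∧ ∀ H ∈ arrangement W, Hᗮ ≤ U → Hᗮ ≤ B ∨ Hᗮ ⟂ B}
    ⟨U, hU, h, le_rfl, fun H _ hle => Or.inl hle⟩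
  refine ⟨B, ⟨hB, hB0, ?_⟩, hBU, hBl⟩
  rintro ⟨k, u, hu⟩
  have hle : ∀ i, u i ≤ B := fun i => hu.2.2.2.1 ▸ le_iSup u i
  have hk := hu.1
  set i₀ : Fin k := ⟨0, by omega⟩
  set i₁ : Fin k := ⟨1, by omega⟩
  have h01 : i₀ ≠ i₁ := by simp [i₀, i₁]
  refine hmin (u i₀) ⟨(hu.2.1 i₀).2, (hu.2.1 i₀).1, (hle i₀).trans hBU, ?_⟩
    (lt_of_le_of_ne (hle i₀) ?_)
  · intro H hH hHU
    rcases hBl H hH hHU with h1 | h1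
    · obtain ⟨m, hm⟩ := hu.line_le hH h1
      by_cases hm0 : m = i₀
      · exact Or.inl (hm0 ▸ hm)
      · exact Or.inr ((hu.isOrtho hm0).mono_left hm)
    · exact Or.inr (h1.mono_right (hle i₀))
  · intro he
    have h2 : u i₁ ≤ u i₀ := he ▸ hle i₁
    exact (hu.2.1 i₁).1 (Submodule.isOrtho_self.1 ((hu.isOrtho h01).mono_left h2))

/-- The two partial sums lie in `B` and in `Bᗮ`, and the modular law identifies them with the
intersections. -/
lemma sumClosure_split {U B : Submodule ℂ V} (hU : U ∈ sumClosure W)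
    (hl : ∀ H ∈ arrangement W, Hᗮ ≤ U → Hᗮ ≤ B ∨ Hᗮ ⟂ B) :
    sumLines W (fun L => L ≤ U ∧ L ≤ B) ⊔ sumLines W (fun L => L ≤ U ∧ L ⟂ B) = U ∧
    U ⊓ B = sumLines W (fun L => L ≤ U ∧ L ≤ B) ∧
    U ⊓ Bᗮ = sumLines W (fun L => L ≤ U ∧ L ⟂ B) := by
  set U₀ := sumLines W (fun L => L ≤ U ∧ L ≤ B)
  set U₁ := sumLines W (fun L => L ≤ U ∧ L ⟂ B)
  have h0 : U₀ ≤ B := sumLines_le fun H _ h => h.2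
  have h1 : U₁ ≤ Bᗮ := sumLines_le fun H _ h => h.2
  have hsup : U₀ ⊔ U₁ = U := by
    refine le_antisymm (sup_le (sumLines_le fun H _ h => h.1) (sumLines_le fun H _ h => h.1)) ?_
    refine le_of_forall_lines hU fun H hH hHU => ?_
    rcases hl H hH hHU with h | h
    · exact (le_sumLines (p := fun L => L ≤ U ∧ L ≤ B) hH ⟨hHU, h⟩).trans le_sup_left
    · exact (le_sumLines (p := fun L => L ≤ U ∧ L ⟂ B) hH ⟨hHU, h⟩).trans le_sup_right
  have hd : B ⊓ Bᗮ = ⊥ := B.inf_orthogonal_eq_bot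
  refine ⟨hsup, ?_, ?_⟩
  · conv_lhs => rw [← hsup]
    rw [sup_inf_assoc_of_le _ h0, sup_eq_left]
    exact (inf_le_inf_right B h1).trans (by rw [inf_comm, hd]; exact bot_le)
  · conv_lhs => rw [← hsup]
    rw [sup_comm, sup_inf_assoc_of_le _ h1, sup_eq_left]
    exact (inf_le_inf_right Bᗮ h0).trans (by rw [hd]; exact bot_le)

lemma iSup_fin_two_eq (f : Fin 2 → Submodule ℂ V) : ⨆ i, f i = f 0 ⊔ f 1 :=
  le_antisymm (iSup_le (Fin.forall_fin_two.2 ⟨le_sup_left, le_sup_right⟩))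
    (sup_le (le_iSup f 0) (le_iSup f 1))

/-- Otherwise `D ⊓ B` and `D ⊓ Bᗮ` would decompose `D`: the condition on lines is inherited by every
`C ≤ D`, so `C` splits as well. -/
lemma irreducible_le_or_isOrtho {D B : Submodule ℂ V} (hD : D ∈ irreducibles W)
    (hl : ∀ H ∈ arrangement W, Hᗮ ≤ D → Hᗮ ≤ B ∨ Hᗮ ⟂ B) : D ≤ B ∨ D ⟂ B := by
  obtain ⟨hsup, hinf0, hinf1⟩ := sumClosure_split hD.1 hl
  by_contra hc
  push Not at hc
  refine hD.2.2 ⟨2, ![D ⊓ B, D ⊓ Bᗮ], by norm_num, ?_, ?_, ?_, ?_⟩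
  · intro i
    fin_cases i
    · refine ⟨fun h => hc.2 ?_, ?_⟩
      · change D ⊓ B = ⊥ at h
        rw [← hinf0, ← hinf1, h, bot_sup_eq] at hsup
        exact inf_eq_left.1 hsup
      · change D ⊓ B ∈ _
        rw [hinf0]
        exact sumLines_mem_sumClosure _
    · refine ⟨fun h => hc.1 ?_, ?_⟩
      · change D ⊓ Bᗮ = ⊥ at h
        rw [← hinf0, ← hinf1, h, sup_bot_eq] at hsup
        exact inf_eq_left.1 hsup
      · change D ⊓ Bᗮ ∈ _
        rw [hinf1]
        exact sumLines_mem_sumClosure _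
  · rw [iSupIndep_pair (i := 0) (j := 1) (by simp) (by intro k; fin_cases k <;> simp)]
    exact B.orthogonal_disjoint.mono inf_le_right inf_le_right
  · rw [← hinf0, ← hinf1] at hsup
    rw [iSup_fin_two_eq]
    exact hsup
  · intro C hC hCD
    obtain ⟨csup, cinf0, cinf1⟩ := sumClosure_split hC
      (fun H hH hHC => hl H hH (hHC.trans hCD))
    have e0 : C ⊓ (D ⊓ B) = C ⊓ B := by rw [← inf_assoc, inf_eq_left.2 hCD]
    have e1 : C ⊓ (D ⊓ Bᗮ) = C ⊓ Bᗮ := by rw [← inf_assoc, inf_eq_left.2 hCD]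
    refine ⟨fun i => ?_, ?_⟩
    · fin_cases i
      · change C ⊓ (D ⊓ B) ∈ _
        rw [e0, cinf0]
        exact sumLines_mem_sumClosure _
      · change C ⊓ (D ⊓ Bᗮ) ∈ _
        rw [e1, cinf1]
        exact sumLines_mem_sumClosure _
    · rw [← cinf0, ← cinf1] at csup
      rw [iSup_fin_two_eq]
      change C ⊓ (D ⊓ B) ⊔ C ⊓ (D ⊓ Bᗮ) = C
      rw [e0, e1, csup]

lemma IsComponent.le_or_isOrtho {U B D : Submodule ℂ V} (h : IsComponent W U B)
    (hD : D ∈ irreducibles W) (hDU : D ≤ U) : D ≤ B ∨ D ⟂ B :=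
  irreducible_le_or_isOrtho hD fun H hH hHD => h.2.2 H hH (hHD.trans hDU)

/-- If `U` had lines orthogonal to `A`, a component of their sum would be another component of `U`.
This identifies a sum of lines of which only the components can be controlled. -/
lemma eq_of_forall_isComponent {U A : Submodule ℂ V} (hU : U ∈ sumClosure W) (h0 : U ≠ ⊥)
    (h : ∀ B, IsComponent W U B → B = A) : U = A := by
  have hA : IsComponent W U A := by
    obtain ⟨B, hB⟩ := exists_isComponent hU h0
    exact h B hB ▸ hB
  refine le_antisymm ?_ hA.2.1
  obtain ⟨hsup, -, -⟩ := sumClosure_split hU hA.2.2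
  set U₁ := sumLines W (fun L => L ≤ U ∧ L ⟂ A)
  have h1 : U₁ ⟂ A := sumLines_isOrtho fun H _ h => h.2
  have h1U : U₁ ≤ U := sumLines_le fun H _ h => h.1
  by_cases hU1 : U₁ = ⊥
  · rw [hU1, sup_bot_eq] at hsup
    rw [← hsup]
    exact sumLines_le fun H _ h => h.2
  · obtain ⟨B, hB⟩ := exists_isComponent (sumLines_mem_sumClosure _) hU1
    have hBA : B = A := by
      refine h B ⟨hB.1, hB.2.1.trans h1U, fun H hH hHU => ?_⟩
      rcases hA.2.2 H hH hHU with h2 | h2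
      · exact Or.inr ((h1.symm.mono_left h2).mono_right hB.2.1)
      · exact hB.2.2 H hH (le_sumLines (p := fun L => L ≤ U ∧ L ⟂ A) hH ⟨hHU, h2⟩)
    exact absurd (Submodule.isOrtho_self.1 (h1.mono_left (hBA ▸ hB.2.1))) hA.1.2.1

lemma line_mem_irreducibles {H : Submodule ℂ V} (hH : H ∈ arrangement W) :
    Hᗮ ∈ irreducibles W := by
  have h0 : Hᗮ ≠ ⊥ := by
    intro h
    have := finrank_orthogonal_of_mem_arrangement hH
    rw [h, finrank_bot] at this
    omega
  obtain ⟨B, hB⟩ := exists_isComponent (line_mem_sumClosure hH) h0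
  have : B = Hᗮ := by
    refine Submodule.eq_of_le_of_finrank_le hB.2.1 ?_
    rw [finrank_orthogonal_of_mem_arrangement hH]
    exact Submodule.one_le_finrank_iff.2 hB.1.2.1
  exact this ▸ hB.1

/-- An isometry that maps the lines of an irreducible subspace to themselves acts on it as a
scalar. -/
lemma scalar_of_forall_lines {A : Submodule ℂ V} (hA : A ∈ irreducibles W) (z : V ≃ₗᵢ[ℂ] V)
    (hz : ∀ H ∈ arrangement W, Hᗮ ≤ A → ∀ v ∈ Hᗮ, z v ∈ Hᗮ) :
    ∃ c : ℂ, ∀ a ∈ A, z a = c • a := by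
  have hz' : ∀ H ∈ arrangement W, Hᗮ ≤ A → ∃ v : V, v ≠ 0 ∧ Hᗮ = Submodule.span ℂ {v} ∧
      ∃ c : ℂ, z v = c • v := by
    intro H hH hHA
    obtain ⟨v, hv, hs⟩ := exists_span_orthogonal hH
    have h1 := hz H hH hHA v (hs ▸ Submodule.mem_span_singleton_self v)
    rw [hs] at h1
    obtain ⟨c, hc⟩ := Submodule.mem_span_singleton.1 h1
    exact ⟨v, hv, hs, c, hc.symm⟩
  obtain ⟨H₀, hH₀, hH₀A⟩ := exists_line_le hA.1 hA.2.1
  obtain ⟨v₀, hv₀, hs₀, c, hc⟩ := hz' H₀ hH₀ hH₀A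
  refine ⟨c, ?_⟩
  have hcn : (starRingEnd ℂ) c * c = 1 := by
    have h1 : ‖c‖ * ‖v₀‖ = ‖v₀‖ := by rw [← norm_smul, ← hc, z.norm_map]
    have h2 : ‖c‖ = 1 := by
      have := norm_ne_zero_iff.2 hv₀
      field_simp at h1
      exact h1
    rw [mul_comm, Complex.mul_conj, Complex.normSq_eq_norm_sq, h2]
    norm_num
  -- An eigenspace that contains one line of `A`. The other lines are eigenlines of an isometry, so
  -- they lie in it or are orthogonal to it, and irreducibility forces `A ≤ B`.
  set B : Submodule ℂ V := LinearMap.ker ((z.toLinearEquiv : V →ₗ[ℂ] V) - c • LinearMap.id)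
    with hB
  have hmem : ∀ w, w ∈ B ↔ z w = c • w := fun w => by
    rw [hB, LinearMap.mem_ker, LinearMap.sub_apply, sub_eq_zero]
    rfl
  have hlines : ∀ H ∈ arrangement W, Hᗮ ≤ A → Hᗮ ≤ B ∨ Hᗮ ⟂ B := by
    intro H hH hHA
    obtain ⟨v, hv, hs, c', hc'⟩ := hz' H hH hHA
    by_cases hcc : c' = c
    · left
      rw [hs, Submodule.span_singleton_le_iff_mem, hmem, hc', hcc]
    · right
      rw [hs, Submodule.isOrtho_comm, Submodule.isOrtho_iff_inner_eq]
      intro w hw x hx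
      obtain ⟨a, rfl⟩ := Submodule.mem_span_singleton.1 hx
      rw [inner_smul_right]
      have h1 := z.inner_map_map w v
      rw [(hmem w).1 hw, hc', inner_smul_left, inner_smul_right] at h1
      by_cases h0 : inner ℂ w v = 0
      · rw [h0, mul_zero]
      · exfalso
        apply hcc
        have h2 : (starRingEnd ℂ) c * c' = 1 := by
          rw [← mul_assoc] at h1
          exact mul_right_cancel₀ h0 (h1.trans (one_mul _).symm)
        have h3 : (starRingEnd ℂ) c ≠ 0 := by
          intro h
          rw [h, zero_mul] at hcn
          exact zero_ne_one hcn
        exact mul_left_cancel₀ h3 (h2.trans hcn.symm)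
  rcases irreducible_le_or_isOrtho hA hlines with h | h
  · exact fun a ha => (hmem a).1 (h ha)
  · have h1 : v₀ ∈ A := hH₀A (hs₀ ▸ Submodule.mem_span_singleton_self v₀)
    exact absurd (inner_self_eq_zero.1
      (Submodule.isOrtho_iff_inner_eq.1 h v₀ h1 v₀ ((hmem v₀).2 hc))) hv₀

end Components

/-! ### The topology of the ambient product -/

section Topology

variable {E : Type*} [NormedAddCommGroup E] [InnerProductSpace ℂ E]

/-- The saturation of an open set is the union of its multiples by units. -/
lemma isOpenMap_mk' : IsOpenMap (Projectivization.mk' ℂ (V := E)) := by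
  intro U hU
  change IsOpen (Projectivization.mk' ℂ (V := E) ⁻¹' (Projectivization.mk' ℂ '' U))
  have : Projectivization.mk' ℂ (V := E) ⁻¹' (Projectivization.mk' ℂ '' U) =
      ⋃ c : ℂˣ, {v : {v : E // v ≠ 0} | (⟨(c : ℂ) • (v : E),
        smul_ne_zero c.ne_zero v.2⟩ : {v : E // v ≠ 0}) ∈ U} := by
    ext v
    simp only [Set.mem_preimage, Set.mem_image, Set.mem_iUnion, Set.mem_ofPred_eq]
    constructor
    · rintro ⟨w, hw, e⟩
      rw [Projectivization.mk'_eq_mk, Projectivization.mk'_eq_mk,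
        Projectivization.mk_eq_mk_iff] at e
      obtain ⟨c, hc⟩ := e
      refine ⟨c, ?_⟩
      convert hw
      exact hc
    · rintro ⟨c, hc⟩
      refine ⟨_, hc, ?_⟩
      rw [Projectivization.mk'_eq_mk, Projectivization.mk'_eq_mk,
        Projectivization.mk_eq_mk_iff]
      exact ⟨c, rfl⟩
  rw [this]
  refine isOpen_iUnion fun c => hU.preimage ?_
  exact Continuous.subtype_mk (continuous_const.smul continuous_subtype_val) _

lemma continuous_mk' : Continuous (Projectivization.mk' ℂ (V := E)) :=
  continuous_coinduced_rng

/-- The cosine of the angle with `a` is continuous on the projective space and, by the equality case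
of the Cauchy–Schwarz inequality, separates the line of `a` from every other line. -/
instance t2Space_projectivization : T2Space (ℙ ℂ E) := by
  refine ⟨fun x y hxy => ?_⟩
  induction x using Projectivization.ind with | _ a ha => ?_
  induction y using Projectivization.ind with | _ b hb => ?_
  let f : ℙ ℂ E → ℝ := Projectivization.lift (fun v => ‖inner ℂ a (v : E)‖ / ‖(v : E)‖) (by
    rintro ⟨v, hv⟩ ⟨w, hw⟩ t h
    simp only at h
    simp only [h, inner_smul_right, norm_mul, norm_smul]
    have ht : ‖t‖ ≠ 0 := by
      rw [norm_ne_zero_iff]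
      rintro rfl
      exact hv (by rw [h, zero_smul])
    exact mul_div_mul_left _ _ ht)
  have hf : Continuous f := by
    rw [continuous_coinduced_dom]
    exact (continuous_const.inner continuous_subtype_val).norm.div continuous_subtype_val.norm
      fun v => norm_ne_zero_iff.2 v.2
  refine separated_by_continuous hf fun h => hxy ?_
  have h1 : ‖inner ℂ a a‖ / ‖a‖ = ‖inner ℂ a b‖ / ‖b‖ := h
  have ha' := norm_ne_zero_iff.2 ha
  have hb' := norm_ne_zero_iff.2 hb
  have h2 : ‖inner ℂ a b‖ = ‖a‖ * ‖b‖ := by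
    rw [inner_self_eq_norm_sq_to_K, norm_pow, RCLike.norm_ofReal, abs_norm] at h1
    field_simp at h1
    exact h1.symm
  obtain ⟨r, hr, e⟩ := (norm_inner_eq_norm_iff ha hb).1 h2
  rw [Projectivization.mk_eq_mk_iff']
  exact ⟨r⁻¹, by rw [e, smul_smul, inv_mul_cancel₀ hr, one_smul]⟩

/-- Homogeneous coordinates can be normalized along a convergent family of points. -/
lemma tendsto_normalize {ι : Type*} {F : Filter ι} {y : ι → E} (hy : ∀ i, y i ≠ 0) {a : E}
    (ha : a ≠ 0) (h : Filter.Tendsto (fun i => Projectivization.mk ℂ (y i) (hy i)) F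
      (𝓝 (Projectivization.mk ℂ a ha))) :
    Filter.Tendsto (fun i => (inner ℂ a a / inner ℂ a (y i)) • y i) F (𝓝 a) := by
  -- On lines orthogonal to `a` the division by zero gives `0`; near the line of `a` this does not
  -- occur.
  let f : ℙ ℂ E → E := Projectivization.lift
    (fun v => (inner ℂ a a / inner ℂ a (v : E)) • (v : E)) (by
      rintro ⟨v, hv⟩ ⟨w, hw⟩ t h
      simp only at h
      simp only [h, inner_smul_right, smul_smul]
      have ht : t ≠ 0 := by
        rintro rfl
        exact hv (by rw [h, zero_smul])
      congr 1
      field_simp)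
  have h0 : inner ℂ a a ≠ 0 := inner_self_ne_zero.2 ha
  have hf : Filter.Tendsto f (𝓝 (Projectivization.mk ℂ a ha)) (𝓝 a) := by
    have h1 := isOpenMap_mk'.nhds_le (⟨a, ha⟩ : {v : E // v ≠ 0})
    refine Filter.Tendsto.mono_left ?_ h1
    rw [Filter.tendsto_map'_iff]
    have h2 : ContinuousAt (fun v : {v : E // v ≠ 0} =>
        (inner ℂ a a / inner ℂ a (v : E)) • (v : E)) ⟨a, ha⟩ := by
      refine ContinuousAt.smul (ContinuousAt.div continuousAt_const
        (continuous_const.inner continuous_subtype_val).continuousAt h0)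
        continuous_subtype_val.continuousAt
    have h3 := h2.tendsto
    simp only [div_self h0, one_smul] at h3
    exact h3
  exact hf.comp h

variable {W : Subgroup (V ≃ₗᵢ[ℂ] V)}

variable (W) in
/-- The systems of homogeneous coordinates of points of the ambient product. -/
abbrev NonzeroCoord : Type _ := {m : Coord W // ∀ D, m.2 D ≠ 0}

/-- The point with given homogeneous coordinates. -/
def toAmbient (m : NonzeroCoord W) : Ambient W :=
  (m.1.1, fun D => Projectivization.mk ℂ (m.1.2 D) (m.2 D))

lemma isLift_toAmbient (m : NonzeroCoord W) : IsLift m.1 (toAmbient m) :=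
  ⟨rfl, fun D => ⟨m.2 D, rfl⟩⟩

lemma IsLift.nonzero {m : Coord W} {ω : Ambient W} (h : IsLift m ω) (D : irreducibles W) :
    m.2 D ≠ 0 := (h.2 D).1

lemma IsLift.toAmbient_eq {m : Coord W} {ω : Ambient W} (h : IsLift m ω) :
    toAmbient ⟨m, h.nonzero⟩ = ω := (isLift_toAmbient _).unique h

lemma IsLift.exists_smul {m m' : Coord W} {ω : Ambient W} (h : IsLift m ω) (h' : IsLift m' ω)
    (D : irreducibles W) : ∃ c : ℂ, c ≠ 0 ∧ m'.2 D = c • m.2 D := by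
  obtain ⟨h0, e⟩ := h.2 D
  obtain ⟨h0', e'⟩ := h'.2 D
  obtain ⟨c, hc⟩ := (Projectivization.mk_eq_mk_iff' _ _ _ _ _).1 (e'.trans e.symm)
  refine ⟨c, ?_, hc.symm⟩
  rintro rfl
  exact h0' (by rw [← hc, zero_smul])

lemma IsLift.of_smul {m m' : Coord W} {ω : Ambient W} (h : IsLift m ω) (h1 : m'.1 = m.1)
    (h2 : ∀ D, ∃ c : ℂ, c ≠ 0 ∧ m'.2 D = c • m.2 D) : IsLift m' ω := by
  refine ⟨h1.trans h.1, fun D => ?_⟩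
  obtain ⟨h0, e⟩ := h.2 D
  obtain ⟨c, hc, e'⟩ := h2 D
  refine ⟨by rw [e']; exact smul_ne_zero hc h0, ?_⟩
  rw [← e, Projectivization.mk_eq_mk_iff']
  exact ⟨c, e'.symm⟩

variable [Finite W]

lemma isOpenMap_toAmbient : IsOpenMap (toAmbient (W := W)) := by
  let e : (V × ((D : irreducibles W) → {v : (D : Submodule ℂ V) // v ≠ 0})) → NonzeroCoord W :=
    fun p => ⟨(p.1, fun D => (p.2 D : (D : Submodule ℂ V))), fun D => (p.2 D).2⟩
  have he : Continuous e := by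
    refine Continuous.subtype_mk (continuous_fst.prodMk (continuous_pi fun D => ?_)) _
    exact continuous_subtype_val.comp ((continuous_apply D).comp continuous_snd)
  have h1 : IsOpenMap (Prod.map (id : V → V) (Pi.map fun D : irreducibles W =>
      Projectivization.mk' ℂ (V := (D : Submodule ℂ V)))) := by
    refine IsOpenMap.id.prodMap (IsOpenMap.piMap (fun D => isOpenMap_mk') ?_)
    rw [Filter.cofinite_eq_bot]
    exact Filter.eventually_bot
  intro U hU
  convert h1 _ (hU.preimage he) using 1
  ext ω
  constructor
  · rintro ⟨m, hm, rfl⟩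
    exact ⟨(m.1.1, fun D => ⟨m.1.2 D, m.2 D⟩), hm, rfl⟩
  · rintro ⟨p, hp, rfl⟩
    exact ⟨e p, hp, rfl⟩

lemma continuous_toAmbient : Continuous (toAmbient (W := W)) := by
  refine Continuous.prodMk (continuous_fst.comp continuous_subtype_val)
    (continuous_pi fun D => ?_)
  have h1 : Continuous fun m : NonzeroCoord W =>
      (⟨m.1.2 D, m.2 D⟩ : {v : (D : Submodule ℂ V) // v ≠ 0}) :=
    Continuous.subtype_mk ((continuous_apply D).comp (continuous_snd.comp continuous_subtype_val))
      _
  exact continuous_mk'.comp h1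

lemma isOpen_nonzeroCoord : IsOpen {m : Coord W | ∀ D, m.2 D ≠ 0} := by
  rw [Set.ofPred_forall]
  exact isOpen_iInter_of_finite fun D =>
    isOpen_ne_fun ((continuous_apply D).comp continuous_snd) continuous_const

/-- The points that have homogeneous coordinates in a given open set form an open set. -/
lemma isOpen_exists_lift {s : Set (Coord W)} (hs : IsOpen s) :
    IsOpen {ω : Ambient W | ∃ m ∈ s, IsLift m ω} := by
  convert isOpenMap_toAmbient _ (hs.preimage continuous_subtype_val) using 1
  ext ω
  constructor
  · rintro ⟨m, hm, h⟩
    exact ⟨⟨m, h.nonzero⟩, hm, h.toAmbient_eq⟩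
  · rintro ⟨m, hm, rfl⟩
    exact ⟨m.1, hm, isLift_toAmbient m⟩

/-- The points all whose homogeneous coordinates satisfy a closed condition form a closed set. -/
lemma isClosed_forall_lift {s : Set (Coord W)} (hs : IsClosed s) :
    IsClosed {ω : Ambient W | ∀ m, IsLift m ω → m ∈ s} := by
  rw [← isOpen_compl_iff]
  convert isOpen_exists_lift hs.isOpen_compl using 1
  ext ω
  simp only [Set.mem_compl_iff, Set.mem_ofPred_eq, not_forall]
  exact exists_congr fun m => ⟨fun ⟨h1, h2⟩ => ⟨h2, h1⟩, fun ⟨h1, h2⟩ => ⟨h2, h1⟩⟩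

/-- The homogeneous coordinates of points of an open set form an open set. -/
lemma isOpen_lifts {U : Set (Ambient W)} (hU : IsOpen U) :
    IsOpen {m : Coord W | ∃ ω ∈ U, IsLift m ω} := by
  have h1 := (isOpen_nonzeroCoord (W := W)).isOpenMap_subtype_val _
    (hU.preimage continuous_toAmbient)
  convert h1 using 1
  ext m
  constructor
  · rintro ⟨ω, hω, h⟩
    exact ⟨⟨m, h.nonzero⟩, by rwa [Set.mem_preimage, h.toAmbient_eq], rfl⟩
  · rintro ⟨m, hm, rfl⟩
    exact ⟨_, hm, isLift_toAmbient m⟩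

/-- A closed condition on homogeneous coordinates that holds on `X_W` holds on the model. -/
lemma forall_lift_of_mem_model {s : Set (Coord W)} (hs : IsClosed s)
    (h : ∀ v : complement W, ∀ m, IsLift m (embed v) → m ∈ s) (ω : Model W) {m : Coord W}
    (hm : IsLift m (ω : Ambient W)) : m ∈ s := by
  refine closure_minimal (t := {ω : Ambient W | ∀ m, IsLift m ω → m ∈ s}) ?_
    (isClosed_forall_lift hs) ω.2 m hm
  rintro _ ⟨v, rfl⟩
  exact h v

lemma isLift_embed (v : complement W) : IsLift ((v : V), fun D : irreducibles W =>
    (D : Submodule ℂ V).orthogonalProjectionOnto (v : V)) (embed v) :=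
  ⟨rfl, fun D => ⟨proj_ne_zero v.2 D, rfl⟩⟩

/-- The hypothesis expresses proportionality to `y` as an equation between continuous functions, so
that it passes from `X` to the closure. -/
lemma mem_span_of_smul_eq {F : Type*} [NormedAddCommGroup F] [InnerProductSpace ℂ F] {x y : F}
    (hy : y ≠ 0) (h : inner ℂ y y • x = inner ℂ y x • y) : ∃ c : ℂ, x = c • y := by
  have h0 : inner ℂ y y ≠ 0 := inner_self_ne_zero.2 hy
  exact ⟨(inner ℂ y y)⁻¹ * inner ℂ y x, by
    rw [mul_smul, ← h, smul_smul, inv_mul_cancel₀ h0, one_smul]⟩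

/-- The line of a point of the model at `D` contains the projection of its vector. -/
lemma exists_smul_eq_projection (ω : Model W) {m : Coord W} (hm : IsLift m (ω : Ambient W))
    (D : irreducibles W) :
    ∃ c : ℂ, (D : Submodule ℂ V).orthogonalProjectionOnto m.1 = c • m.2 D := by
  refine mem_span_of_smul_eq (hm.nonzero D) (forall_lift_of_mem_model
    (s := {m : Coord W | inner ℂ (m.2 D) (m.2 D) •
      (D : Submodule ℂ V).orthogonalProjectionOnto m.1 =
      inner ℂ (m.2 D) ((D : Submodule ℂ V).orthogonalProjectionOnto m.1) • m.2 D}) ?_ ?_ ω hm)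
  · exact isClosed_eq (by fun_prop) (by fun_prop)
  · intro v m hm
    obtain ⟨c, -, hc⟩ := (isLift_embed v).exists_smul hm D
    have h1 : m.1 = v := hm.1
    rw [Set.mem_ofPred_eq, hc, h1]
    simp only [inner_smul_left, inner_smul_right, smul_smul]
    congr 1
    ring

lemma projection_projection {D D' : Submodule ℂ V} (h : D' ≤ D) (v : V) :
    D'.orthogonalProjectionOnto (D.orthogonalProjectionOnto v : V)
      = D'.orthogonalProjectionOnto v :=
  Submodule.orthogonalProjectionOnto_starProjection_of_le h v

/-- The lines of a point of the model are compatible with projections. -/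
lemma exists_smul_eq_projection_of_le (ω : Model W) {m : Coord W}
    (hm : IsLift m (ω : Ambient W)) {D D' : irreducibles W}
    (h : (D' : Submodule ℂ V) ≤ (D : Submodule ℂ V)) :
    ∃ c : ℂ, (D' : Submodule ℂ V).orthogonalProjectionOnto (m.2 D : V) = c • m.2 D' := by
  refine mem_span_of_smul_eq (hm.nonzero D') (forall_lift_of_mem_model
    (s := {m : Coord W | inner ℂ (m.2 D') (m.2 D') •
      (D' : Submodule ℂ V).orthogonalProjectionOnto (m.2 D : V) =
      inner ℂ (m.2 D') ((D' : Submodule ℂ V).orthogonalProjectionOnto (m.2 D : V)) • m.2 D'})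
    ?_ ?_ ω hm)
  · exact isClosed_eq (by fun_prop) (by fun_prop)
  · intro v m hm
    obtain ⟨c, -, hc⟩ := (isLift_embed v).exists_smul hm D
    obtain ⟨c', -, hc'⟩ := (isLift_embed v).exists_smul hm D'
    rw [Set.mem_ofPred_eq, hc, hc']
    simp only [Submodule.coe_smul, map_smul, projection_projection h, inner_smul_left,
      inner_smul_right, smul_smul]
    congr 1
    ring

lemma mem_boundary_of_notMem {ω : Model W} (h : (ω : Ambient W).1 ∉ complement W) :
    ω ∈ boundary W := by
  rintro ⟨v, hv⟩
  exact h (hv ▸ v.2)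

/-- Over a vector of `X` all projections are nonzero, and they determine the lines. So the model has
only the embedded point there. -/
lemma notMem_complement_of_mem_boundary {ω : Model W} (h : ω ∈ boundary W) :
    (ω : Ambient W).1 ∉ complement W := by
  intro hx
  refine h ⟨⟨_, hx⟩, ?_⟩
  obtain ⟨m, hm⟩ := exists_lift (ω : Ambient W)
  refine ((isLift_embed ⟨_, hx⟩).of_smul (m' := m) hm.1 fun D => ?_).unique hm
  obtain ⟨c, hc⟩ := exists_smul_eq_projection ω hm D
  rw [hm.1] at hc
  have h0 := proj_ne_zero hx D
  have hc0 : c ≠ 0 := by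
    rintro rfl
    rw [zero_smul] at hc
    exact h0 hc
  exact ⟨c⁻¹, inv_ne_zero hc0, by
    change _ = c⁻¹ • (D : Submodule ℂ V).orthogonalProjectionOnto (ω : Ambient W).1
    rw [hc, smul_smul, inv_mul_cancel₀ hc0, one_smul]⟩

end Topology

/-! ### Strata of the boundary -/

section Strata

variable {W : Subgroup (V ≃ₗᵢ[ℂ] V)}

/-- The vector obtained from `v` by multiplication of its component in `A` by `t`. -/
def scaleIn (A : Submodule ℂ V) (t : ℂ) (v : V) : V :=
  Aᗮ.starProjection v + t • A.starProjection v

open scoped Classical in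
/-- Homogeneous coordinates of the point over `scaleIn A t v` whose line in `A` is spanned by the
component of `v`. -/
def famCoord (A : Submodule ℂ V) (t : ℂ) (v : V) : Coord W :=
  (scaleIn A t v, fun D => (D : Submodule ℂ V).orthogonalProjectionOnto
    (if (D : Submodule ℂ V) ≤ A then v else scaleIn A t v))

lemma famCoord_of_le {A : Submodule ℂ V} {t : ℂ} {v : V} {D : irreducibles W}
    (h : (D : Submodule ℂ V) ≤ A) :
    (famCoord A t v).2 D = (D : Submodule ℂ V).orthogonalProjectionOnto v := by
  simp only [famCoord, if_pos h]

lemma famCoord_of_not_le {A : Submodule ℂ V} {t : ℂ} {v : V} {D : irreducibles W}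
    (h : ¬ (D : Submodule ℂ V) ≤ A) :
    (famCoord A t v).2 D = (D : Submodule ℂ V).orthogonalProjectionOnto (scaleIn A t v) := by
  simp only [famCoord, if_neg h]

lemma scaleIn_add (A : Submodule ℂ V) (t : ℂ) (v w : V) :
    scaleIn A t (v + w) = scaleIn A t v + scaleIn A t w := by
  simp only [scaleIn, map_add, smul_add]
  abel

lemma scaleIn_smul (A : Submodule ℂ V) (t c : ℂ) (v : V) :
    scaleIn A t (c • v) = c • scaleIn A t v := by
  simp only [scaleIn, map_smul, smul_add, smul_comm t c]

lemma continuous_scaleIn (A : Submodule ℂ V) :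
    Continuous fun p : ℂ × V => scaleIn A p.1 p.2 := by
  unfold scaleIn
  fun_prop

lemma continuous_famCoord (A : Submodule ℂ V) :
    Continuous fun p : ℂ × V => (famCoord A p.1 p.2 : Coord W) := by
  refine (continuous_scaleIn A).prodMk (continuous_pi fun D => ?_)
  by_cases h : (D : Submodule ℂ V) ≤ A
  · simp only [if_pos h]
    fun_prop
  · simp only [if_neg h]
    exact (ContinuousLinearMap.continuous _).comp (continuous_scaleIn A)

lemma projection_scaleIn_of_le {A D : Submodule ℂ V} (h : D ≤ A) (t : ℂ) (v : V) :
    D.orthogonalProjectionOnto (scaleIn A t v) = t • D.orthogonalProjectionOnto v := by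
  have h1 : D.orthogonalProjectionOnto (Aᗮ.starProjection v) = 0 := by
    rw [Submodule.orthogonalProjectionOnto_eq_zero_iff]
    exact Submodule.orthogonal_le h (Aᗮ.starProjection_apply_mem v)
  rw [scaleIn, map_add, map_smul, h1, zero_add,
    Submodule.orthogonalProjectionOnto_starProjection_of_le h]

lemma scaleIn_zero_mem (A : Submodule ℂ V) (v : V) : scaleIn A 0 v ∈ Aᗮ := by
  rw [scaleIn, zero_smul, add_zero]
  exact Aᗮ.starProjection_apply_mem v

lemma notMem_of_projection_ne_zero {H : Submodule ℂ V} {v : V}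
    (h : Hᗮ.orthogonalProjectionOnto v ≠ 0) : v ∉ H := fun hv => h (by
  rw [Submodule.orthogonalProjectionOnto_eq_zero_iff]
  exact H.le_orthogonal_orthogonal hv)

lemma projection_ne_zero_of_notMem {H D : Submodule ℂ V} {v : V} (h : v ∉ H) (hD : Hᗮ ≤ D) :
    D.orthogonalProjectionOnto v ≠ 0 := fun h0 => h (by
  rw [Submodule.orthogonalProjectionOnto_eq_zero_iff] at h0
  rw [← H.orthogonal_orthogonal]
  exact Submodule.orthogonal_le hD h0)

variable [Finite W]

/-- For `t ≠ 0` the coordinates at `D ≤ A` differ from the projections of `scaleIn A t v` only by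
the factor `t`. -/
lemma isLift_famCoord_embed {A : Submodule ℂ V} {t : ℂ} (ht : t ≠ 0) {v : V}
    (h : ∀ D : irreducibles W, (famCoord A t v).2 D ≠ 0) :
    ∃ x : complement W, IsLift (famCoord A t v) (embed x) := by
  have hx : scaleIn A t v ∈ complement W := by
    intro H hH
    have h1 := h ⟨Hᗮ, line_mem_irreducibles hH⟩
    refine notMem_of_projection_ne_zero ?_
    by_cases hle : Hᗮ ≤ A
    · rw [famCoord_of_le hle] at h1
      rw [projection_scaleIn_of_le hle]
      exact smul_ne_zero ht h1
    · rwa [famCoord_of_not_le hle] at h1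
  refine ⟨⟨_, hx⟩, (isLift_embed ⟨_, hx⟩).of_smul rfl fun D => ?_⟩
  by_cases hle : (D : Submodule ℂ V) ≤ A
  · refine ⟨t⁻¹, inv_ne_zero ht, ?_⟩
    rw [famCoord_of_le hle]
    change _ = t⁻¹ • (D : Submodule ℂ V).orthogonalProjectionOnto (scaleIn A t v)
    rw [projection_scaleIn_of_le hle, smul_smul, inv_mul_cancel₀ ht, one_smul]
  · exact ⟨1, one_ne_zero, by rw [famCoord_of_not_le hle, one_smul]⟩

/-- Nearby nonzero parameters keep the coordinates nonzero and give points of `X`, so `t = 0` is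
reached as a limit. -/
lemma exists_model_famCoord {A : Submodule ℂ V} {t : ℂ} {v : V}
    (h : ∀ D : irreducibles W, (famCoord A t v).2 D ≠ 0) :
    ∃ ω : Model W, IsLift (famCoord A t v) (ω : Ambient W) := by
  refine ⟨⟨toAmbient ⟨_, h⟩, ?_⟩, isLift_toAmbient ⟨_, h⟩⟩
  rw [mem_closure_iff]
  intro U hU hω
  have h1 : Filter.Tendsto (fun s : ℂ => (famCoord A s v : Coord W)) (𝓝[{0}ᶜ] t)
      (𝓝 (famCoord A t v)) := by
    have : Continuous fun s : ℂ => (famCoord A s v : Coord W) :=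
      (continuous_famCoord A).comp (continuous_id.prodMk continuous_const)
    exact (this.tendsto t).mono_left nhdsWithin_le_nhds
  have h2 := h1.eventually ((isOpen_lifts hU).mem_nhds ⟨_, hω, isLift_toAmbient ⟨_, h⟩⟩)
  have h3 : (𝓝[{0}ᶜ] t).NeBot :=
    mem_closure_iff_nhdsWithin_neBot.1 (dense_compl_singleton (0 : ℂ) t)
  obtain ⟨s, ⟨ω', hω', hs⟩, hs0⟩ := (h2.and self_mem_nhdsWithin).exists
  obtain ⟨x, hx⟩ := isLift_famCoord_embed hs0 hs.nonzero
  exact ⟨ω', hω', x, hx.unique hs⟩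

variable (W) in
/-- The stratum of `A`: the points over a vector of `Aᗮ` in no unnecessary hyperplane whose line
in `A` lies in no hyperplane. -/
def stratum (A : Submodule ℂ V) : Set (Model W) :=
  {ω | ∃ v, IsLift (famCoord A 0 v) (ω : Ambient W)}

lemma stratum_fst {A : Submodule ℂ V} {ω : Model W} (h : ω ∈ stratum W A) :
    (ω : Ambient W).1 ∈ Aᗮ := by
  obtain ⟨v, hv⟩ := h
  rw [← hv.1]
  exact scaleIn_zero_mem A v

lemma mem_boundary_of_fst_mem (A : irreducibles W) {ω : Model W}
    (h : (ω : Ambient W).1 ∈ (A : Submodule ℂ V)ᗮ) : ω ∈ boundary W := by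
  obtain ⟨H, hH, hHA⟩ := exists_line_le A.2.1 A.2.2.1
  refine mem_boundary_of_notMem fun hx => hx H hH ?_
  rw [← H.orthogonal_orthogonal]
  exact Submodule.orthogonal_le hHA h

lemma closure_stratum_subset_boundary (A : irreducibles W) :
    closure (stratum W (A : Submodule ℂ V)) ⊆ boundary W := by
  have h1 : IsClosed {ω : Model W | (ω : Ambient W).1 ∈ (A : Submodule ℂ V)ᗮ} :=
    (Submodule.isClosed_orthogonal _).preimage (continuous_fst.comp continuous_subtype_val)
  intro ω hω
  exact mem_boundary_of_fst_mem A (closure_minimal (fun ω h => stratum_fst h) h1 hω)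

/-! ### The equations of the model -/

lemma orthogonal_sumLines {p : Submodule ℂ V → Prop} {b : V}
    (h : ∀ H ∈ arrangement W, p Hᗮ → b ∈ Hᗮᗮ) : b ∈ (sumLines W p)ᗮ := by
  have h1 : sumLines W p ⟂ Submodule.span ℂ {b} := sumLines_isOrtho fun H hH hp => by
    rw [Submodule.isOrtho_iff_le, Submodule.le_orthogonal_iff_le_orthogonal,
      Submodule.span_singleton_le_iff_mem]
    exact h H hH hp
  exact (Submodule.isOrtho_iff_le.1 h1.symm) (Submodule.mem_span_singleton_self b)

/-- The vector `b` has the correct lines at every `D` with `P D` that is not inside `U'`, and it is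
orthogonal to `U'`. Adding a small multiple `δ w` hardly changes the former, and inside `U'` only `δ
w` is seen, up to the scalar `δ`. -/
lemma approximation_step (m : Coord W) (b : V) {U' : Submodule ℂ V} (hb : b ∈ U'ᗮ)
    (P : irreducibles W → Prop)
    (hP : ∀ D, P D → (D : Submodule ℂ V) ≤ U' ∨
      ∃ c : ℂ, c ≠ 0 ∧ (D : Submodule ℂ V).orthogonalProjectionOnto b = c • m.2 D)
    {ε : ℝ} (hε : 0 < ε) (h : ∃ w : V, ∀ D : irreducibles W, (D : Submodule ℂ V) ≤ U' →
      ∃ c : ℂ, c ≠ 0 ∧ ‖c • (D : Submodule ℂ V).orthogonalProjectionOnto w - m.2 D‖ < ε) :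
    ∃ w : V, ‖w - b‖ < ε ∧ ∀ D, P D →
      ∃ c : ℂ, c ≠ 0 ∧ ‖c • (D : Submodule ℂ V).orthogonalProjectionOnto w - m.2 D‖ < ε := by
  obtain ⟨w, hw⟩ := h
  have hsmall : ∀ {F : Type _} [NormedAddCommGroup F] [NormedSpace ℂ F] (y : F),
      ∀ᶠ δ : ℂ in 𝓝[≠] 0, ‖δ • y‖ < ε := by
    intro F _ _ y
    have h1 : Filter.Tendsto (fun δ : ℂ => ‖δ • y‖) (𝓝 0) (𝓝 ‖(0 : ℂ) • y‖) :=
      Continuous.tendsto (by fun_prop) 0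
    rw [zero_smul, norm_zero] at h1
    exact (h1.eventually (gt_mem_nhds hε)).filter_mono nhdsWithin_le_nhds
  have key : ∀ D, ∀ᶠ δ : ℂ in 𝓝[≠] 0, P D → ∃ c : ℂ, c ≠ 0 ∧
      ‖c • (D : Submodule ℂ V).orthogonalProjectionOnto (b + δ • w) - m.2 D‖ < ε := by
    intro D
    by_cases hU : (D : Submodule ℂ V) ≤ U'
    · obtain ⟨c, hc, hlt⟩ := hw D hU
      filter_upwards [self_mem_nhdsWithin] with δ hδ _
      have h0 : (D : Submodule ℂ V).orthogonalProjectionOnto b = 0 := by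
        rw [Submodule.orthogonalProjectionOnto_eq_zero_iff]
        exact Submodule.orthogonal_le hU hb
      refine ⟨c * δ⁻¹, mul_ne_zero hc (inv_ne_zero hδ), ?_⟩
      rwa [map_add, map_smul, h0, zero_add, smul_smul, mul_assoc, inv_mul_cancel₀ hδ, mul_one]
    · by_cases hPD : P D
      · obtain ⟨c, hc, e⟩ := (hP D hPD).resolve_left hU
        filter_upwards [hsmall (c⁻¹ • (D : Submodule ℂ V).orthogonalProjectionOnto w)] with δ hδ _
        refine ⟨c⁻¹, inv_ne_zero hc, ?_⟩
        rwa [map_add, map_smul, e, smul_add, smul_smul, inv_mul_cancel₀ hc, one_smul,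
          add_sub_cancel_left, smul_comm]
      · exact Filter.Eventually.of_forall fun δ h => absurd h hPD
  obtain ⟨δ, h1, h2⟩ := ((hsmall w).and (Filter.eventually_all.2 key)).exists
  exact ⟨b + δ • w, by rwa [add_sub_cancel_left], h2⟩

lemma exists_approximation {m : Coord W} (hm : ∀ D, m.2 D ≠ 0)
    (h : ∀ D D' : irreducibles W, (D' : Submodule ℂ V) ≤ D → ∃ c : ℂ,
      (D' : Submodule ℂ V).orthogonalProjectionOnto (m.2 D : V) = c • m.2 D')
    {U : Submodule ℂ V} (hU : U ∈ sumClosure W) {ε : ℝ} (hε : 0 < ε) :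
    ∃ w : V, ∀ D : irreducibles W, (D : Submodule ℂ V) ≤ U →
      ∃ c : ℂ, c ≠ 0 ∧ ‖c • (D : Submodule ℂ V).orthogonalProjectionOnto w - m.2 D‖ < ε := by
  induction U using WellFoundedLT.induction with | _ U ih => ?_
  by_cases h0 : U = ⊥
  · exact ⟨0, fun D hD => absurd (le_bot_iff.1 (h0 ▸ hD)) D.2.2.1⟩
  obtain ⟨B, hB⟩ := exists_isComponent hU h0
  -- The vector of the line at one component settles every `D ≤ U` to which it is not orthogonal.
  -- The lines of `U` orthogonal to it span a strictly smaller space, left to the induction.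
  let b : V := m.2 ⟨B, hB.1⟩
  let p : Submodule ℂ V → Prop := fun L => L ≤ U ∧ b ∈ Lᗮ
  have hle : sumLines W p ≤ U := sumLines_le fun H _ hp => hp.1
  have hbU : b ∈ (sumLines W p)ᗮ := orthogonal_sumLines fun H _ hp => hp.2
  have hlt : sumLines W p < U := by
    refine lt_of_le_of_ne hle fun e => hm ⟨B, hB.1⟩ (Subtype.ext ?_)
    rw [e] at hbU
    have := Submodule.inner_right_of_mem_orthogonal (hB.2.1 (m.2 ⟨B, hB.1⟩).2) hbU
    exact inner_self_eq_zero.1 this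
  have hsub : ∀ D : irreducibles W, (D : Submodule ℂ V) ≤ U → b ∈ (D : Submodule ℂ V)ᗮ →
      (D : Submodule ℂ V) ≤ sumLines W p := fun D hDU hbD =>
    le_of_forall_lines D.2.1 fun H hH hHD =>
      le_sumLines hH ⟨hHD.trans hDU, Submodule.orthogonal_le hHD hbD⟩
  obtain ⟨w, -, hw⟩ := approximation_step m b hbU (fun D => (D : Submodule ℂ V) ≤ U) (by
    intro D hDU
    by_contra hc
    push Not at hc
    have hbD : b ∉ (D : Submodule ℂ V)ᗮ := fun hbD => hc.1 (hsub D hDU hbD)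
    rcases hB.le_or_isOrtho D.2 hDU with hDB | hDB
    · obtain ⟨c, e⟩ := h ⟨B, hB.1⟩ D hDB
      refine hc.2 c ?_ e
      rintro rfl
      rw [zero_smul, Submodule.orthogonalProjectionOnto_eq_zero_iff] at e
      exact hbD e
    · exact hbD (Submodule.isOrtho_iff_le.1 hDB.symm (m.2 ⟨B, hB.1⟩).2)) hε
    (ih _ hlt (sumLines_mem_sumClosure p))
  exact ⟨w, hw⟩

/-- The equations of the model. -/
lemma mem_model_of_relations {ω : Ambient W} {m : Coord W} (hm : IsLift m ω)
    (h1 : ∀ D : irreducibles W, ∃ c : ℂ,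
      (D : Submodule ℂ V).orthogonalProjectionOnto m.1 = c • m.2 D)
    (h2 : ∀ D D' : irreducibles W, (D' : Submodule ℂ V) ≤ D → ∃ c : ℂ,
      (D' : Submodule ℂ V).orthogonalProjectionOnto (m.2 D : V) = c • m.2 D') :
    ω ∈ closure (range (embed (W := W))) := by
  rw [mem_closure_iff]
  intro O hO hω
  obtain ⟨ε, hε, hball⟩ := Metric.isOpen_iff.1 (isOpen_lifts hO) m ⟨ω, hω, hm⟩
  -- The vector `m.1` settles every `D` to which it is not orthogonal; `exists_approximation`
  -- handles the sum of the lines orthogonal to it.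
  let p : Submodule ℂ V → Prop := fun L => m.1 ∈ Lᗮ
  obtain ⟨w, hwm, hw⟩ := approximation_step m m.1
    (orthogonal_sumLines (p := p) fun H _ hp => hp) (fun _ => True) (by
      intro D _
      by_contra hc
      push Not at hc
      obtain ⟨c, e⟩ := h1 D
      refine hc.2 c ?_ e
      rintro rfl
      rw [zero_smul, Submodule.orthogonalProjectionOnto_eq_zero_iff] at e
      exact hc.1 (le_of_forall_lines D.2.1 fun H hH hHD =>
        le_sumLines hH (Submodule.orthogonal_le hHD e))) hε
    (exists_approximation hm.nonzero h2 (sumLines_mem_sumClosure p) hε)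
  choose c hc0 hc using fun D => hw D trivial
  let m' : Coord W := (w, fun D => c D • (D : Submodule ℂ V).orthogonalProjectionOnto w)
  have hm' : m' ∈ Metric.ball m ε := by
    rw [mem_ball_iff_norm, Prod.norm_def, max_lt_iff]
    exact ⟨hwm, (pi_norm_lt_iff hε).2 hc⟩
  obtain ⟨ω', hω', hl⟩ := hball hm'
  have hx : w ∈ complement W := fun H hH => notMem_of_projection_ne_zero
    (right_ne_zero_of_smul (hl.nonzero ⟨Hᗮ, line_mem_irreducibles hH⟩))
  exact ⟨ω', hω', ⟨w, hx⟩, 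
    ((isLift_embed ⟨w, hx⟩).of_smul (m' := m') rfl fun D => ⟨c D, hc0 D, rfl⟩).unique hl⟩

/-! ### The Zariski topology of the model -/

lemma continuous_of_mem_polyFun {p : Coord W → ℂ} (hp : p ∈ polyFun W) : Continuous p := by
  induction hp using Algebra.adjoin_induction with
  | mem f hf =>
    obtain ⟨φ, rfl⟩ := hf
    exact LinearMap.continuous_of_finiteDimensional φ
  | algebraMap c => exact continuous_const
  | add f g _ _ hf hg => exact hf.add hg
  | mul f g _ _ hf hg => exact hf.mul hg

/-- The equality in `IsZariskiClosed` is one between subsets of the ambient product, with `Z`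
replaced by its image there. -/
lemma IsZariskiClosed.exists_mem_iff {Z : Set (Model W)} (h : IsZariskiClosed Z) :
    ∃ S ⊆ (polyFun W : Set (Coord W → ℂ)), ∀ ω : Model W,
      ω ∈ Z ↔ ∀ p ∈ S, ∀ m : Coord W, IsLift m (ω : Ambient W) → p m = 0 := by
  obtain ⟨S, hS, hZ⟩ := h
  refine ⟨S, hS, fun ω => ?_⟩
  have h1 : ω ∈ Z ↔ (ω : Ambient W) ∈ (Subtype.val '' Z : Set (Ambient W)) :=
    (Subtype.val_injective.mem_set_image).symm
  rw [h1]
  exact (Set.ext_iff.1 hZ (ω : Ambient W))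

lemma IsZariskiClosed.isClosed {Z : Set (Model W)} (h : IsZariskiClosed Z) : IsClosed Z := by
  obtain ⟨S, hS, hZ⟩ := h.exists_mem_iff
  have : Z = ⋂ p ∈ S, Subtype.val ⁻¹' {ω : Ambient W | ∀ m, IsLift m ω → m ∈ {m | p m = 0}} := by
    ext ω
    rw [hZ]
    simp
  rw [this]
  exact isClosed_biInter fun p hp => (isClosed_forall_lift (isClosed_eq
    (continuous_of_mem_polyFun (hS hp)) continuous_const)).preimage continuous_subtype_val

lemma linear_mem_polyFun (φ : Coord W →ₗ[ℂ] ℂ) : (φ : Coord W → ℂ) ∈ polyFun W :=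
  Algebra.subset_adjoin ⟨φ, rfl⟩

/-- Proportionality of two linear functions is a polynomial condition. -/
lemma exists_minors {F : Type*} [AddCommGroup F] [Module ℂ F] (x y : Coord W →ₗ[ℂ] F) :
    ∃ S ⊆ (polyFun W : Set (Coord W → ℂ)), ∀ m : Coord W, y m ≠ 0 →
      ((∀ p ∈ S, p m = 0) ↔ ∃ c : ℂ, x m = c • y m) := by
  refine ⟨{f | ∃ φ ψ : Module.Dual ℂ F, f = (φ ∘ₗ x : Coord W →ₗ[ℂ] ℂ) * (ψ ∘ₗ y : Coord W →ₗ[ℂ] ℂ)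
    - (ψ ∘ₗ x : Coord W →ₗ[ℂ] ℂ) * (φ ∘ₗ y : Coord W →ₗ[ℂ] ℂ)}, ?_, fun m hm => ⟨fun h => ?_, ?_⟩⟩
  · rintro f ⟨φ, ψ, rfl⟩
    exact sub_mem (mul_mem (linear_mem_polyFun _) (linear_mem_polyFun _))
      (mul_mem (linear_mem_polyFun _) (linear_mem_polyFun _))
  · obtain ⟨ψ, hψ⟩ : ∃ ψ : Module.Dual ℂ F, ψ (y m) ≠ 0 := by
      by_contra h
      push Not at h
      exact hm ((Module.forall_dual_apply_eq_zero_iff ℂ _).1 h)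
    refine ⟨ψ (x m) / ψ (y m), sub_eq_zero.1 ((Module.forall_dual_apply_eq_zero_iff ℂ _).1
      fun φ => ?_)⟩
    have h1 : φ (x m) * ψ (y m) - ψ (x m) * φ (y m) = 0 := h _ ⟨φ, ψ, rfl⟩
    rw [map_sub, map_smul, smul_eq_mul]
    field_simp
    linear_combination h1
  · rintro ⟨c, hc⟩ f ⟨φ, ψ, rfl⟩
    change φ (x m) * ψ (y m) - ψ (x m) * φ (y m) = 0
    rw [hc, map_smul, map_smul, smul_eq_mul, smul_eq_mul]
    ring

variable (W) in
/-- The linear function `m ↦ m.2 D`. -/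
def lineCoord (D : irreducibles W) : Coord W →ₗ[ℂ] (D : Submodule ℂ V) :=
  LinearMap.proj D ∘ₗ LinearMap.snd ℂ V _

/-- The set must be the whole zero locus of polynomials in the ambient product. So the equations of
the model are added to those of `L`; by `mem_model_of_relations` they suffice. -/
lemma isZariskiClosed_linear {F : Type*} [AddCommGroup F] [Module ℂ F] (L : Coord W →ₗ[ℂ] F) :
    IsZariskiClosed {ω : Model W | ∀ m, IsLift m (ω : Ambient W) → L m = 0} := by
  choose S₁ hS₁ h₁ using fun D : irreducibles W => exists_minors
    (((D : Submodule ℂ V).orthogonalProjectionOnto : V →ₗ[ℂ] (D : Submodule ℂ V)) ∘ₗ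
      LinearMap.fst ℂ V _) (lineCoord W D)
  choose S₂ hS₂ h₂ using fun D D' : irreducibles W => exists_minors
    (((D' : Submodule ℂ V).orthogonalProjectionOnto : V →ₗ[ℂ] (D' : Submodule ℂ V)) ∘ₗ
      (D : Submodule ℂ V).subtype ∘ₗ lineCoord W D) (lineCoord W D')
  refine ⟨{f | ∃ ψ : Module.Dual ℂ F, f = (ψ ∘ₗ L : Coord W →ₗ[ℂ] ℂ)} ∪ (⋃ D, S₁ D) ∪
    {f | ∃ D D' : irreducibles W, (D' : Submodule ℂ V) ≤ D ∧ f ∈ S₂ D D'}, ?_, ?_⟩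
  · refine Set.union_subset (Set.union_subset ?_ (Set.iUnion_subset hS₁)) ?_
    · rintro f ⟨ψ, rfl⟩
      exact linear_mem_polyFun _
    · rintro f ⟨D, D', -, hf⟩
      exact hS₂ D D' hf
  · ext ω
    constructor
    · rintro ⟨ω, h, rfl⟩ f ((⟨ψ, rfl⟩ | hf) | ⟨D, D', hle, hf⟩) m hm
      · rw [LinearMap.comp_apply, h m hm, map_zero]
      · obtain ⟨D, hf⟩ := Set.mem_iUnion.1 hf
        exact (h₁ D m (hm.nonzero D)).2 (exists_smul_eq_projection ω hm D) f hf
      · exact (h₂ D D' m (hm.nonzero D')).2 (exists_smul_eq_projection_of_le ω hm hle) f hf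
    · intro h
      obtain ⟨m, hm⟩ := exists_lift ω
      refine ⟨⟨ω, mem_model_of_relations hm (fun D => (h₁ D m (hm.nonzero D)).1 fun f hf =>
        h f (Or.inl (Or.inr (Set.mem_iUnion.2 ⟨D, hf⟩))) m hm) fun D D' hle =>
        (h₂ D D' m (hm.nonzero D')).1 fun f hf => h f (Or.inr ⟨D, D', hle, hf⟩) m hm⟩, ?_, rfl⟩
      intro m hm
      rw [← Module.forall_dual_apply_eq_zero_iff ℂ]
      exact fun ψ => h _ (Or.inl (Or.inl ⟨ψ, rfl⟩)) m hm

lemma IsZariskiIrreducible.closure {T : Set (Model W)} (h : IsZariskiIrreducible T) :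
    IsZariskiIrreducible (closure T) := by
  refine ⟨h.1.closure, fun Z₁ Z₂ h₁ h₂ hsub => ?_⟩
  exact (h.2 Z₁ Z₂ h₁ h₂ (subset_closure.trans hsub)).imp
    (fun hT => closure_minimal hT h₁.isClosed) (fun hT => closure_minimal hT h₂.isClosed)

lemma exists_polynomial_path {p : Coord W → ℂ} (hp : p ∈ polyFun W) (M₀ M₁ M₂ : Coord W) :
    ∃ q : Polynomial ℂ, ∀ s : ℂ, q.eval s = p (M₀ + s • M₁ + s ^ 2 • M₂) := by
  induction hp using Algebra.adjoin_induction with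
  | mem f hf =>
    obtain ⟨φ, rfl⟩ := hf
    refine ⟨Polynomial.C (φ M₀) + Polynomial.X * Polynomial.C (φ M₁) +
      Polynomial.X ^ 2 * Polynomial.C (φ M₂), fun s => ?_⟩
    simp
    ring
  | algebraMap c => exact ⟨Polynomial.C c, fun s => by simp⟩
  | add f g _ _ hf hg =>
    obtain ⟨a, ha⟩ := hf
    obtain ⟨b, hb⟩ := hg
    exact ⟨a + b, fun s => by rw [Polynomial.eval_add, ha, hb]; rfl⟩
  | mul f g _ _ hf hg =>
    obtain ⟨a, ha⟩ := hf
    obtain ⟨b, hb⟩ := hg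
    exact ⟨a * b, fun s => by rw [Polynomial.eval_mul, ha, hb]; rfl⟩

/-- A set is irreducible if the homogeneous coordinates of any two of its points are connected by
quadratic curves. -/
lemma isZariskiIrreducible_of_paths {T : Set (Model W)} (hT : T.Nonempty)
    (h : ∀ ω₁ ∈ T, ∀ ω₂ ∈ T, ∀ m₁ m₂ : Coord W, IsLift m₁ (ω₁ : Ambient W) →
      IsLift m₂ (ω₂ : Ambient W) → ∃ M₁ M₂ : Coord W, m₁ + M₁ + M₂ = m₂ ∧
      ∀ s : ℂ, (∀ D, (m₁ + s • M₁ + s ^ 2 • M₂).2 D ≠ 0) →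
        ∃ ω ∈ T, IsLift (m₁ + s • M₁ + s ^ 2 • M₂) (ω : Ambient W)) :
    IsZariskiIrreducible T := by
  refine ⟨hT, ?_⟩
  intro Z₁ Z₂ hZ₁ hZ₂ hsub
  obtain ⟨S₁, hS₁, hZ₁⟩ := hZ₁.exists_mem_iff
  obtain ⟨S₂, hS₂, hZ₂⟩ := hZ₂.exists_mem_iff
  by_contra hc
  push Not at hc
  obtain ⟨⟨ω₁, hω₁, h₁⟩, ω₂, hω₂, h₂⟩ := And.imp Set.not_subset.1 Set.not_subset.1 hc
  simp only [hZ₁, hZ₂, not_forall] at h₁ h₂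
  obtain ⟨p₁, hp₁, m₁, hm₁, hne₁⟩ := h₁
  obtain ⟨p₂, hp₂, m₂, hm₂, hne₂⟩ := h₂
  obtain ⟨M₁, M₂, hend, hpath⟩ := h ω₁ hω₁ ω₂ hω₂ m₁ m₂ hm₁ hm₂
  obtain ⟨q₁, hq₁⟩ := exists_polynomial_path (hS₁ hp₁) m₁ M₁ M₂
  obtain ⟨q₂, hq₂⟩ := exists_polynomial_path (hS₂ hp₂) m₁ M₁ M₂
  have hψ : ∀ D : irreducibles W, ∃ q : Polynomial ℂ, q ≠ 0 ∧
      ∀ s : ℂ, (m₁ + s • M₁ + s ^ 2 • M₂).2 D = 0 → q.eval s = 0 := by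
    intro D
    obtain ⟨ψ, hψ⟩ : ∃ ψ : Module.Dual ℂ (D : Submodule ℂ V), ψ (m₁.2 D) ≠ 0 := by
      by_contra h
      push Not at h
      exact hm₁.nonzero D ((Module.forall_dual_apply_eq_zero_iff ℂ _).1 h)
    obtain ⟨q, hq⟩ := exists_polynomial_path (W := W) (p := fun m => ψ (m.2 D))
      (Algebra.subset_adjoin
        ⟨ψ ∘ₗ LinearMap.proj D ∘ₗ LinearMap.snd ℂ V _, rfl⟩) m₁ M₁ M₂
    refine ⟨q, ?_, fun s hs => by rw [hq, hs, map_zero]⟩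
    rintro rfl
    apply hψ
    have := hq 0
    simpa using this.symm
  choose q hq0 hq using hψ
  have hne1 : q₁ ≠ 0 := by
    rintro rfl
    apply hne₁
    have := hq₁ 0
    simpa using this.symm
  have hne2 : q₂ ≠ 0 := by
    rintro rfl
    apply hne₂
    have := hq₂ 1
    rw [one_smul, one_pow, one_smul, hend] at this
    simpa using this.symm
  -- Apart from finitely many parameters the coordinates on the curve are nonzero, so its points lie
  -- in `T`, yet neither `p₁` nor `p₂` vanishes there.
  obtain ⟨s, hs⟩ := (q₁ * q₂ * ∏ D, q D).exists_eval_ne_zero_of_natDegree_lt_card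
    (mul_ne_zero (mul_ne_zero hne1 hne2) (Finset.prod_ne_zero_iff.2 fun D _ => hq0 D))
    ((Cardinal.natCast_lt_aleph0).trans_le (Cardinal.aleph0_le_mk ℂ))
  rw [Polynomial.eval_mul, Polynomial.eval_mul, Polynomial.eval_prod] at hs
  have hs1 := left_ne_zero_of_mul (left_ne_zero_of_mul hs)
  have hs2 := right_ne_zero_of_mul (left_ne_zero_of_mul hs)
  have hs3 := Finset.prod_ne_zero_iff.1 (right_ne_zero_of_mul hs)
  obtain ⟨ω, hω, hlift⟩ := hpath s fun D hD => hs3 D (Finset.mem_univ D) (hq D s hD)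
  rcases hsub hω with hz | hz
  · exact hs1 (by rw [hq₁]; exact (hZ₁ ω).1 hz p₁ hp₁ _ hlift)
  · exact hs2 (by rw [hq₂]; exact (hZ₂ ω).1 hz p₂ hp₂ _ hlift)

/-- Both the vectors and the scaling factors of the homogeneous coordinates are interpolated
linearly. The coordinates are products of the two, hence quadratic in the parameter. -/
lemma isZariskiIrreducible_stratum {A : Submodule ℂ V} (h : (stratum W A).Nonempty) :
    IsZariskiIrreducible (stratum W A) := by
  refine isZariskiIrreducible_of_paths h ?_
  rintro ω₁ ⟨v₁, hv₁⟩ ω₂ ⟨v₂, hv₂⟩ m₁ m₂ hm₁ hm₂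
  choose c₁ hc₁ e₁ using fun D => hv₁.exists_smul hm₁ D
  choose c₂ hc₂ e₂ using fun D => hv₂.exists_smul hm₂ D
  let B : (irreducibles W → ℂ) → V → Coord W := fun c v =>
    ((famCoord A 0 v : Coord W).1, fun D => c D • (famCoord A 0 v : Coord W).2 D)
  have hadd1 : ∀ v w, (famCoord A 0 (v + w) : Coord W) = famCoord A 0 v + famCoord A 0 w := by
    intro v w
    refine Prod.ext (scaleIn_add A 0 v w) (funext fun D => ?_)
    by_cases hle : (D : Submodule ℂ V) ≤ A
    · rw [Prod.snd_add, Pi.add_apply, famCoord_of_le hle, famCoord_of_le hle, famCoord_of_le hle,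
        map_add]
    · rw [Prod.snd_add, Pi.add_apply, famCoord_of_not_le hle, famCoord_of_not_le hle,
        famCoord_of_not_le hle, scaleIn_add, map_add]
  have hsmul1 : ∀ (a : ℂ) v, (famCoord A 0 (a • v) : Coord W) = a • famCoord A 0 v := by
    intro a v
    refine Prod.ext (scaleIn_smul A 0 a v) (funext fun D => ?_)
    by_cases hle : (D : Submodule ℂ V) ≤ A
    · rw [Prod.smul_snd, Pi.smul_apply, famCoord_of_le hle, famCoord_of_le hle, map_smul]
    · rw [Prod.smul_snd, Pi.smul_apply, famCoord_of_not_le hle, famCoord_of_not_le hle,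
        scaleIn_smul, map_smul]
  have hb1 : m₁ = B c₁ v₁ := Prod.ext (hm₁.1.trans hv₁.1.symm) (funext e₁)
  have hb2 : m₂ = B c₂ v₂ := Prod.ext (hm₂.1.trans hv₂.1.symm) (funext e₂)
  have hpath : ∀ s : ℂ, m₁ + s • (B c₁ v₂ + B c₂ v₁ - (2 : ℂ) • B c₁ v₁) +
      s ^ 2 • (B c₁ v₁ + B c₂ v₂ - B c₁ v₂ - B c₂ v₁) =
      B (fun D => (1 - s) * c₁ D + s * c₂ D) ((1 - s) • v₁ + s • v₂) := by
    intro s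
    rw [hb1]
    refine Prod.ext ?_ (funext fun D => ?_)
    · simp only [B, hadd1, hsmul1, Prod.fst_add, Prod.fst_sub, Prod.smul_fst]
      module
    · simp only [B, hadd1, hsmul1, Prod.snd_add, Prod.snd_sub, Prod.smul_snd, Pi.add_apply,
        Pi.sub_apply, Pi.smul_apply]
      module
  refine ⟨B c₁ v₂ + B c₂ v₁ - (2 : ℂ) • B c₁ v₁, B c₁ v₁ + B c₂ v₂ - B c₁ v₂ - B c₂ v₁, ?_,
    fun s hs => ?_⟩
  · rw [hb1, hb2]
    module
  · rw [hpath] at hs ⊢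
    obtain ⟨ω, hω⟩ := exists_model_famCoord (W := W) (A := A) (t := 0)
      (v := (1 - s) • v₁ + s • v₂) fun D => right_ne_zero_of_smul (hs D)
    exact ⟨ω, ⟨_, hω⟩, hω.of_smul rfl fun D => ⟨_, left_ne_zero_of_smul (hs D), rfl⟩⟩

/-! ### Boundary components through generic points -/

lemma exists_isBoundaryComponent {T : Set (Model W)} (hT : T ⊆ boundary W)
    (hirr : IsZariskiIrreducible T) : ∃ Z, IsBoundaryComponent W Z ∧ T ⊆ Z := by
  obtain ⟨Z, hTZ, hZ⟩ := zorn_subset_nonempty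
    {T : Set (Model W) | T ⊆ boundary W ∧ IsZariskiIrreducible T} (fun c hc hchain hne => by
      refine ⟨⋃₀ c, ⟨Set.sUnion_subset fun t ht => (hc ht).1, ?_, ?_⟩,
        fun t ht => Set.subset_sUnion_of_mem ht⟩
      · obtain ⟨t, ht⟩ := hne
        exact (hc ht).2.1.mono (Set.subset_sUnion_of_mem ht)
      · intro Z₁ Z₂ h₁ h₂ hsub
        by_contra hcon
        push Not at hcon
        simp only [Set.sUnion_subset_iff, not_forall] at hcon
        obtain ⟨⟨t₁, ht₁, hn₁⟩, t₂, ht₂, hn₂⟩ := hcon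
        have hU : ∀ t ∈ c, t ⊆ Z₁ ∪ Z₂ := fun t ht => (Set.subset_sUnion_of_mem ht).trans hsub
        rcases hchain.total ht₁ ht₂ with h12 | h21
        · rcases (hc ht₂).2.2 Z₁ Z₂ h₁ h₂ (hU _ ht₂) with h | h
          · exact hn₁ (h12.trans h)
          · exact hn₂ h
        · rcases (hc ht₁).2.2 Z₁ Z₂ h₁ h₂ (hU _ ht₁) with h | h
          · exact hn₁ h
          · exact hn₂ (h21.trans h)) T ⟨hT, hirr⟩
  exact ⟨Z, hZ, hTZ⟩

/-- `divisor` is a union of components; genericity identifies the one through `ω` with the whole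
union. -/
lemma IsGeneric.divisor_component {A : Submodule ℂ V} {ω : Model W} (h : IsGeneric W A ω) :
    IsBoundaryComponent W (divisor W A) ∧
      (fun ω : Model W => (ω : Ambient W).1) '' divisor W A = (Aᗮ : Set V) := by
  obtain ⟨Z, ⟨hZ, himg⟩, hω⟩ := h.1
  rw [← h.2 Z hZ hω]
  exact ⟨hZ, himg⟩

/-- The closure of a stratum is irreducible, so a boundary component contains it; this component
passes through `ω`. -/
lemma IsGeneric.closure_stratum_subset {A : Submodule ℂ V} {ω : Model W} (h : IsGeneric W A ω)
    (B : irreducibles W) (hB : ω ∈ closure (stratum W (B : Submodule ℂ V))) :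
    closure (stratum W (B : Submodule ℂ V)) ⊆ divisor W A := by
  obtain ⟨Z, hZ, hsub⟩ := exists_isBoundaryComponent (closure_stratum_subset_boundary B)
    (isZariskiIrreducible_stratum (closure_nonempty_iff.1 ⟨ω, hB⟩)).closure
  rw [← h.2 Z hZ (hsub hB)]
  exact hsub

/-- A generic point of the divisor of `A` lies in the closure of no other stratum. -/
lemma IsGeneric.eq_of_mem_closure_stratum {A : irreducibles W} {ω : Model W}
    (h : IsGeneric W (A : Submodule ℂ V) ω) (B : irreducibles W)
    (hB : ω ∈ closure (stratum W (B : Submodule ℂ V))) :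
    (B : Submodule ℂ V) = A := by
  obtain ⟨hcomp, himg⟩ := h.divisor_component
  have hsub := h.closure_stratum_subset B hB
  have hfst : ∀ z ∈ divisor W (A : Submodule ℂ V),
      (z : Ambient W).1 ∈ (A : Submodule ℂ V)ᗮ := fun z hz => by
    have : (z : Ambient W).1 ∈ ((A : Submodule ℂ V)ᗮ : Set V) := himg ▸ ⟨z, hz, rfl⟩
    exact this
  obtain ⟨σ, v, hσ⟩ := closure_nonempty_iff.1 ⟨ω, hB⟩
  have hσZ : σ ∈ divisor W (A : Submodule ℂ V) := hsub (subset_closure ⟨v, hσ⟩)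
  -- Otherwise the coordinate at `A` of the stratum point `σ` would be the projection of its vector,
  -- which is orthogonal to `A`.
  have hAB : (A : Submodule ℂ V) ≤ B := by
    by_contra hAB
    have h1 := hσ.nonzero A
    rw [famCoord_of_not_le hAB] at h1
    apply h1
    rw [Submodule.orthogonalProjectionOnto_eq_zero_iff]
    have h2 : scaleIn (B : Submodule ℂ V) 0 v = (σ : Ambient W).1 := hσ.1
    rw [h2]
    exact hfst σ hσZ
  refine le_antisymm ?_ hAB
  let L₁ : Coord W →ₗ[ℂ] (A : Submodule ℂ V) :=
    ((A : Submodule ℂ V).orthogonalProjectionOnto : V →ₗ[ℂ] (A : Submodule ℂ V)) ∘ₗ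
      (B : Submodule ℂ V).subtype ∘ₗ lineCoord W B
  let L₂ : Coord W →ₗ[ℂ] (B : Submodule ℂ V) :=
    ((B : Submodule ℂ V).orthogonalProjectionOnto : V →ₗ[ℂ] (B : Submodule ℂ V)) ∘ₗ
      LinearMap.fst ℂ V _
  -- If the vector of a point of the divisor projects nontrivially to `B`, the projection spans the
  -- line in `B` and is orthogonal to `A`. Irreducibility selects one of the closed sets; `σ`
  -- excludes the first, and the second gives `Aᗮ ≤ Bᗮ`.
  have hcov : divisor W (A : Submodule ℂ V) ⊆
      {ω : Model W | ∀ m, IsLift m (ω : Ambient W) → L₁ m = 0} ∪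
        {ω : Model W | ∀ m, IsLift m (ω : Ambient W) → L₂ m = 0} := by
    intro z hz
    by_cases h0 : (B : Submodule ℂ V).orthogonalProjectionOnto (z : Ambient W).1 = 0
    · right
      intro m hm
      change (B : Submodule ℂ V).orthogonalProjectionOnto m.1 = 0
      rw [hm.1, h0]
    · left
      intro m hm
      obtain ⟨c, hc⟩ := exists_smul_eq_projection z hm B
      rw [hm.1] at hc
      have hc0 : c ≠ 0 := by
        rintro rfl
        rw [zero_smul] at hc
        exact h0 hc
      have h2 : (A : Submodule ℂ V).orthogonalProjectionOnto (z : Ambient W).1 = 0 :=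
        (Submodule.orthogonalProjectionOnto_eq_zero_iff).2 (hfst z hz)
      rw [← projection_projection hAB, hc, Submodule.coe_smul, map_smul] at h2
      exact (smul_eq_zero.1 h2).resolve_left hc0
  rcases hcomp.prop.2.2 _ _ (isZariskiClosed_linear L₁) (isZariskiClosed_linear L₂) hcov with h1 | h1
  · exfalso
    have h2 := h1 hσZ _ hσ
    have h3 : L₁ (famCoord (B : Submodule ℂ V) 0 v) =
        (A : Submodule ℂ V).orthogonalProjectionOnto v := by
      change (A : Submodule ℂ V).orthogonalProjectionOnto
        (((famCoord (B : Submodule ℂ V) 0 v : Coord W).2 B : (B : Submodule ℂ V)) : V) = _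
      rw [famCoord_of_le le_rfl, projection_projection hAB]
    have h4 := hσ.nonzero A
    rw [famCoord_of_le hAB] at h4
    exact h4 (h3 ▸ h2)
  · rw [← Submodule.orthogonal_le_orthogonal_iff]
    intro x hx
    have hx' : x ∈ (fun ω : Model W => (ω : Ambient W).1) '' divisor W (A : Submodule ℂ V) :=
      himg ▸ hx
    obtain ⟨z, hz, rfl⟩ := hx'
    obtain ⟨m, hm⟩ := exists_lift (z : Ambient W)
    have h2 : (B : Submodule ℂ V).orthogonalProjectionOnto m.1 = 0 := h1 hz m hm
    rw [hm.1] at h2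
    exact (Submodule.orthogonalProjectionOnto_eq_zero_iff).1 h2

end Strata

/-! ### Generic points of the components of the boundary -/

section Generic

variable {W : Subgroup (V ≃ₗᵢ[ℂ] V)} [Finite W]

open Filter Asymptotics

/-- The factor that normalizes the component at `D` of the homogeneous coordinates of `embed v`. -/
def normFactor (m : Coord W) (D : irreducibles W) (v : V) : ℂ :=
  inner ℂ (m.2 D) (m.2 D) / inner ℂ (m.2 D) ((D : Submodule ℂ V).orthogonalProjectionOnto v)

lemma tendsto_normFactor {F : Filter (complement W)} {ω : Ambient W} (h : Tendsto embed F (𝓝 ω))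
    {m : Coord W} (hm : IsLift m ω) (D : irreducibles W) :
    Tendsto (fun v : complement W =>
      normFactor m D v • (D : Submodule ℂ V).orthogonalProjectionOnto (v : V)) F
      (𝓝 (m.2 D)) := by
  obtain ⟨h0, e⟩ := hm.2 D
  have h1 : Tendsto (fun v => (embed v : Ambient W).2 D) F (𝓝 (ω.2 D)) :=
    (((continuous_apply D).comp continuous_snd).tendsto ω).comp h
  rw [← e] at h1
  exact tendsto_normalize _ h0 h1

lemma tendsto_val_of_tendsto_embed {F : Filter (complement W)} {ω : Ambient W}
    (h : Tendsto embed F (𝓝 ω)) : Tendsto (fun v : complement W => (v : V)) F (𝓝 ω.1) :=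
  (continuous_fst.tendsto ω).comp h

lemma norm_projection_le_of_le {D D' : Submodule ℂ V} (h : D ≤ D') (v : V) :
    ‖D.starProjection v‖ ≤ ‖D'.starProjection v‖ := by
  have h1 : D.starProjection v = D.starProjection (D'.starProjection v) := by
    rw [Submodule.starProjection_apply, Submodule.starProjection_apply,
      Submodule.orthogonalProjectionOnto_starProjection_of_le h]
  rw [h1]
  exact D.norm_starProjection_apply_le _

lemma scaleIn_zero_eq (B : Submodule ℂ V) (v : V) : scaleIn B 0 v = v - B.starProjection v := by
  rw [scaleIn, zero_smul, add_zero, Submodule.starProjection_orthogonal_val]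

/-- Delete the part of `v` in `B`, but keep the lines at `D ≤ B`. Nothing changes at those `D`, nor
at `D ≤ U` orthogonal to `B`. Any other `D` contains a line outside `U`, whose projection dominates
the deleted part, so the change of the normalized coordinate tends to zero. -/
lemma mem_closure_stratum {F : Filter (complement W)} [F.NeBot] {ω : Model W}
    (h : Tendsto embed F (𝓝 (ω : Ambient W))) {U : Submodule ℂ V}
    (h0 : Tendsto (fun v : complement W => U.starProjection (v : V)) F (𝓝 0))
    (hU : ∀ H ∈ arrangement W, ¬ Hᗮ ≤ U →
      (fun v : complement W => U.starProjection (v : V)) =o[F] fun v : complement W =>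
        Hᗮ.starProjection (v : V))
    {B : Submodule ℂ V} (hB : IsComponent W U B) : ω ∈ closure (stratum W B) := by
  obtain ⟨m₀, hm₀⟩ := exists_lift (ω : Ambient W)
  let m : complement W → Coord W := fun v => (scaleIn B 0 v, fun D =>
    normFactor m₀ D v • (famCoord B 0 (v : V) : Coord W).2 D)
  have hBU : (fun v : complement W => B.starProjection (v : V)) =O[F] fun v : complement W =>
      U.starProjection (v : V) :=
    IsBigO.of_bound 1 (Eventually.of_forall fun v => by
      rw [one_mul]; exact norm_projection_le_of_le hB.2.1 _)
  have hm : Tendsto m F (𝓝 m₀) := by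
    rw [nhds_prod_eq]
    refine Tendsto.prodMk ?_ ?_
    · simp only [scaleIn_zero_eq]
      have := (tendsto_val_of_tendsto_embed h).sub (hBU.trans_tendsto h0)
      rwa [sub_zero, ← hm₀.1] at this
    · rw [nhds_pi, tendsto_pi]
      intro D
      have hD := tendsto_normFactor h hm₀ D
      by_cases hDB : (D : Submodule ℂ V) ≤ B
      · simp only [famCoord_of_le hDB]
        exact hD
      · simp only [famCoord_of_not_le hDB, scaleIn_zero_eq, map_sub, smul_sub]
        rw [← sub_zero (m₀.2 D)]
        refine hD.sub ?_
        by_cases hDU : (D : Submodule ℂ V) ≤ U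
        · have hperp := (hB.le_or_isOrtho D.2 hDU).resolve_left hDB
          have : ∀ v : V, (D : Submodule ℂ V).orthogonalProjectionOnto (B.starProjection v) = 0 :=
            fun v => by
              rw [Submodule.orthogonalProjectionOnto_eq_zero_iff]
              exact Submodule.isOrtho_iff_le.1 hperp.symm (B.starProjection_apply_mem v)
          simp only [this, smul_zero]
          exact tendsto_const_nhds
        · obtain ⟨H, hH, hHD, hHU⟩ : ∃ H ∈ arrangement W, Hᗮ ≤ (D : Submodule ℂ V) ∧ ¬ Hᗮ ≤ U := by
            by_contra hc
            push Not at hc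
            exact hDU (le_of_forall_lines D.2.1 hc)
          have h1 : (fun v : complement W =>
              (D : Submodule ℂ V).orthogonalProjectionOnto (B.starProjection (v : V))) =o[F]
              fun v : complement W => (D : Submodule ℂ V).orthogonalProjectionOnto (v : V) := by
            refine (IsBigO.of_bound 1 (Eventually.of_forall fun v => ?_)).trans_isLittleO
              ((hBU.trans_isLittleO (hU H hH hHU)).trans_isBigO
                (IsBigO.of_bound 1 (Eventually.of_forall fun v => ?_)))
            · rw [one_mul]
              exact (D : Submodule ℂ V).norm_orthogonalProjectionOnto_apply_le _
            · rw [one_mul]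
              exact norm_projection_le_of_le hHD _
          have h2 := (isBigO_refl (fun v : complement W => normFactor m₀ D (v : V)) F).smul_isLittleO
            h1
          exact (isLittleO_one_iff ℝ).1 (h2.trans_isBigO (hD.isBigO_one ℝ))
  rw [mem_closure_iff_nhds]
  intro O hO
  obtain ⟨O', hO', hsub⟩ := (mem_nhds_induced _ _ _).1 hO
  obtain ⟨O'', hO''sub, hopen, hmem⟩ := mem_nhds_iff.1 hO'
  obtain ⟨v, ω', hω', hv⟩ := (hm.eventually ((isOpen_lifts hopen).mem_nhds ⟨_, hmem, hm₀⟩)).exists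
  obtain ⟨σ, hσ⟩ := exists_model_famCoord (W := W) (A := B) (t := 0) (v := (v : V))
    fun D => right_ne_zero_of_smul (hv.nonzero D)
  have hσ' : IsLift (m v) (σ : Ambient W) :=
    hσ.of_smul rfl fun D => ⟨_, left_ne_zero_of_smul (hv.nonzero D), rfl⟩
  exact ⟨σ, hsub (hO''sub (hσ'.unique hv ▸ hω')), v, hσ⟩

lemma comap_embed_neBot (ω : Model W) : (comap embed (𝓝 (ω : Ambient W))).NeBot :=
  comap_neBot_iff.2 fun t ht => by
    obtain ⟨_, hy, v, rfl⟩ := mem_closure_iff_nhds.1 ω.2 t ht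
    exact ⟨v, hy⟩

lemma finite_arrangement : (arrangement W).Finite := by
  refine (Set.finite_range (fun w : W => fixedSpace (w : V ≃ₗᵢ[ℂ] V))).subset ?_
  rintro _ ⟨g, hg, -, rfl⟩
  exact ⟨⟨g, hg⟩, rfl⟩

lemma starProjection_orthogonal_ne_zero {H : Submodule ℂ V} {x : V} (h : x ∉ H) :
    Hᗮ.starProjection x ≠ 0 := fun h0 => h (by
  rw [← H.orthogonal_orthogonal]
  exact (Submodule.starProjection_apply_eq_zero_iff _).1 h0)

lemma exists_mem_hyperplane {ω : Model W} (h : ω ∈ boundary W) :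
    ∃ H ∈ arrangement W, (ω : Ambient W).1 ∈ H := by
  by_contra hc
  push Not at hc
  exact notMem_complement_of_mem_boundary h hc

lemma sumLines_ne_bot {p : Submodule ℂ V → Prop} {H : Submodule ℂ V} (hH : H ∈ arrangement W)
    (hp : p Hᗮ) : sumLines W p ≠ ⊥ := fun h =>
  (line_mem_irreducibles hH).2.1 (le_bot_iff.1 (h ▸ le_sumLines hH hp))

lemma IsGeneric.mem_boundary {A : Submodule ℂ V} {ω : Model W} (h : IsGeneric W A ω) :
    ω ∈ boundary W := h.divisor_component.1.prop.1 h.1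

/-- The hyperplanes through the vector of a generic point of the divisor of `A` contain `Aᗮ`. -/
lemma IsGeneric.sumLines_eq {A : irreducibles W} {ω : Model W}
    (h : IsGeneric W (A : Submodule ℂ V) ω) :
    sumLines W (fun L => (ω : Ambient W).1 ∈ Lᗮ) = A := by
  obtain ⟨H₀, hH₀, hx₀⟩ := exists_mem_hyperplane h.mem_boundary
  refine eq_of_forall_isComponent (sumLines_mem_sumClosure _)
    (sumLines_ne_bot hH₀ (by rwa [Submodule.orthogonal_orthogonal])) fun B hB => ?_
  refine h.eq_of_mem_closure_stratum ⟨B, hB.1⟩ ?_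
  have := comap_embed_neBot ω
  have ht : Tendsto (embed (W := W)) (comap embed (𝓝 (ω : Ambient W))) (𝓝 (ω : Ambient W)) :=
    tendsto_comap
  have hv := tendsto_val_of_tendsto_embed ht
  -- The vector of `ω` is orthogonal to these lines and to no others. So the projections to their
  -- sum tend to zero while those to each other line stay bounded below.
  have h0 : Tendsto (fun v : complement W =>
      (sumLines W (fun L => (ω : Ambient W).1 ∈ Lᗮ)).starProjection (v : V))
      (comap embed (𝓝 (ω : Ambient W))) (𝓝 0) := by
    have := ((sumLines W (fun L => (ω : Ambient W).1 ∈ Lᗮ)).starProjection.continuous.tendsto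
      _).comp hv
    rwa [(Submodule.starProjection_apply_eq_zero_iff _).2
      (orthogonal_sumLines (p := fun L => (ω : Ambient W).1 ∈ Lᗮ) fun H _ hp => hp)] at this
  refine mem_closure_stratum ht h0 (fun H hH hHU => ?_) hB
  have hxH : (ω : Ambient W).1 ∉ H := fun hx =>
    hHU (le_sumLines hH (by rwa [Submodule.orthogonal_orthogonal]))
  have h1 := (Hᗮ.starProjection.continuous.tendsto _).comp hv
  have hpos := norm_pos_iff.2 (starProjection_orthogonal_ne_zero hxH)
  exact ((isLittleO_one_iff ℝ).2 h0).trans_isBigO ((isBigO_const_left_iff_pos_le_norm one_ne_zero).2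
    ⟨_, half_pos hpos, (h1.norm.eventually (lt_mem_nhds (half_lt_self hpos))).mono
      fun _ h => h.le⟩)

/-- The vectors `u` that satisfy the bound form a subspace, which contains the lines. -/
lemma isBigO_inner_of_mem_sumLines {ι : Type*} {F : Filter ι} {y : ι → V} {g : ι → ℝ}
    {p : Submodule ℂ V → Prop}
    (hp : ∀ H ∈ arrangement W, p Hᗮ → (fun i => Hᗮ.starProjection (y i)) =O[F] g) {u : V}
    (hu : u ∈ sumLines W p) : (fun i => inner ℂ u (y i)) =O[F] g := by
  let N : Submodule ℂ V :=
    { carrier := {u | (fun i => inner ℂ u (y i)) =O[F] g}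
      add_mem' := fun {a b} ha hb => by
        simp only [Set.mem_ofPred_eq, inner_add_left] at *
        exact ha.add hb
      zero_mem' := by
        simp only [Set.mem_ofPred_eq, inner_zero_left]
        exact isBigO_zero _ _
      smul_mem' := fun c a ha => by
        simp only [Set.mem_ofPred_eq, inner_smul_left] at *
        exact ha.const_mul_left _ }
  refine (sumLines_le (U := N) fun H hH hpH u hu => ?_) hu
  refine (IsBigO.of_bound ‖u‖ (Eventually.of_forall fun i => ?_)).trans (hp H hH hpH)
  have h1 : inner ℂ u (y i) = inner ℂ u (Hᗮ.starProjection (y i)) := by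
    rw [← Submodule.inner_starProjection_left_eq_right,
      Submodule.starProjection_eq_self_iff.2 hu]
  rw [h1]
  exact norm_inner_le_norm _ _

lemma isBigO_projection_sumLines {ι : Type*} {F : Filter ι} {y : ι → V} {g : ι → ℝ}
    {p : Submodule ℂ V → Prop}
    (hp : ∀ H ∈ arrangement W, p Hᗮ → (fun i => Hᗮ.starProjection (y i)) =O[F] g) :
    (fun i => (sumLines W p).starProjection (y i)) =O[F] g := by
  let e := stdOrthonormalBasis ℂ (sumLines W p)
  have h1 : ∀ v : V, (sumLines W p).starProjection v =
      ∑ j, inner ℂ (e j : V) v • (e j : V) := fun v => by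
    rw [Submodule.starProjection_apply]
    conv_lhs => rw [← e.sum_repr' ((sumLines W p).orthogonalProjectionOnto v)]
    rw [Submodule.coe_sum]
    refine Finset.sum_congr rfl fun j _ => ?_
    rw [Submodule.coe_smul, Submodule.inner_orthogonalProjectionOnto_eq_of_mem_left]
  simp only [h1]
  refine IsBigO.fun_sum fun j _ => ?_
  have h2 : (fun i => inner ℂ (e j : V) (y i) • (e j : V)) =O[F] fun i => inner ℂ (e j : V) (y i) :=
    IsBigO.of_bound ‖(e j : V)‖ (Eventually.of_forall fun i => by rw [norm_smul, mul_comm])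
  exact h2.trans (isBigO_inner_of_mem_sumLines hp (e j).2)

/-- The line in `A` of a generic point of the divisor of `A` lies in no hyperplane. -/
lemma IsGeneric.notMem {A : irreducibles W} {ω : Model W} (h : IsGeneric W (A : Submodule ℂ V) ω)
    {m : Coord W} (hm : IsLift m (ω : Ambient W)) {H : Submodule ℂ V} (hH : H ∈ arrangement W)
    (hHA : Hᗮ ≤ A) : (m.2 A : V) ∉ H := by
  have := comap_embed_neBot ω
  -- Along an ultrafilter one of the finitely many lines has the smallest projection throughout, and
  -- each other projection is either comparable with it or infinitely larger.
  let 𝒰 := Ultrafilter.of (comap embed (𝓝 (ω : Ambient W)))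
  have ht : Tendsto (embed (W := W)) 𝒰 (𝓝 (ω : Ambient W)) :=
    tendsto_comap.mono_left (Ultrafilter.of_le _)
  have hv := tendsto_val_of_tendsto_embed ht
  obtain ⟨H₁, hH₁, hx₁⟩ := exists_mem_hyperplane h.mem_boundary
  obtain ⟨H₀, hH₀, hmin⟩ : ∃ H₀ ∈ arrangement W, ∀ᶠ v : complement W in 𝒰, ∀ H ∈ arrangement W,
      ‖H₀ᗮ.starProjection (v : V)‖ ≤ ‖Hᗮ.starProjection (v : V)‖ := by
    have h1 : (⋃ H₀ ∈ arrangement W, {v : complement W | ∀ H ∈ arrangement W,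
        ‖H₀ᗮ.starProjection (v : V)‖ ≤ ‖Hᗮ.starProjection (v : V)‖}) ∈ 𝒰 := by
      refine Filter.mem_of_superset univ_mem fun v _ => ?_
      obtain ⟨H₀, hH₀, hle⟩ := Set.exists_min_image (arrangement W)
        (fun H => ‖Hᗮ.starProjection (v : V)‖) finite_arrangement ⟨H₁, hH₁⟩
      exact Set.mem_biUnion hH₀ hle
    exact (Ultrafilter.finite_biUnion_mem_iff finite_arrangement).1 h1
  let g : complement W → ℝ := fun v => ‖H₀ᗮ.starProjection (v : V)‖
  let p : Submodule ℂ V → Prop := fun L =>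
    (fun v : complement W => L.starProjection (v : V)) =O[(𝒰 : Filter (complement W))] g
  have hg : ∀ H ∈ arrangement W, g =O[(𝒰 : Filter (complement W))] fun v : complement W =>
      Hᗮ.starProjection (v : V) := fun H hH => IsBigO.of_bound 1 (hmin.mono fun v hv => by
    rw [one_mul, norm_norm]; exact hv H hH)
  have hg0 : Tendsto g 𝒰 (𝓝 0) := by
    refine (hg H₁ hH₁).trans_tendsto ?_
    have h1 := (H₁ᗮ.starProjection.continuous.tendsto _).comp hv
    rwa [(Submodule.starProjection_apply_eq_zero_iff _).2
      (by rwa [Submodule.orthogonal_orthogonal])] at h1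
  have hpU : (fun v : complement W => (sumLines W p).starProjection (v : V))
      =O[(𝒰 : Filter (complement W))] g := isBigO_projection_sumLines fun H _ hp => hp
  -- The lines with projections comparable to the smallest one sum to a space all of whose
  -- components are `A`.
  have hU : sumLines W p = A := by
    refine eq_of_forall_isComponent (sumLines_mem_sumClosure _)
      (sumLines_ne_bot hH₀ (isBigO_norm_right.2 (isBigO_refl _ _))) fun B hB => ?_
    refine h.eq_of_mem_closure_stratum ⟨B, hB.1⟩ ?_
    refine mem_closure_stratum ht (hpU.trans_tendsto hg0) (fun H hH hHU => ?_) hB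
    refine hpU.trans_isLittleO ?_
    have hn : ¬ p Hᗮ := fun hp => hHU (le_sumLines hH hp)
    rw [isLittleO_iff]
    intro c hc
    have h1 : ¬ ∀ᶠ v : complement W in (𝒰 : Filter (complement W)),
        ‖Hᗮ.starProjection (v : V)‖ ≤ c⁻¹ * ‖g v‖ := fun h1 => hn (IsBigO.of_bound _ h1)
    filter_upwards [Ultrafilter.eventually_not.2 h1] with v hv
    rw [not_le, inv_mul_lt_iff₀ hc] at hv
    exact hv.le
  rw [hU] at hpU
  have hA := tendsto_normFactor ht hm A
  have hHm := (Hᗮ.starProjection.continuous.tendsto _).comp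
    ((continuous_subtype_val.tendsto _).comp hA)
  intro hmH
  rw [(Submodule.starProjection_apply_eq_zero_iff _).2
    (by rwa [Submodule.orthogonal_orthogonal])] at hHm
  -- The projection to `A` is bounded by the projection to `Hᗮ`. If `m.2 A` were in `H`, the
  -- normalized projections to `Hᗮ`, and with them those to `A`, would tend to zero; but the latter
  -- tend to `m.2 A`.
  have h1 : (fun v : complement W => normFactor m A (v : V) • (A : Submodule ℂ V).starProjection
      (v : V)) =O[(𝒰 : Filter (complement W))] fun v : complement W =>
      normFactor m A (v : V) • Hᗮ.starProjection (v : V) :=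
    (isBigO_refl _ _).smul (hpU.trans (hg H hH))
  have h2 : Tendsto (fun v : complement W => normFactor m A (v : V) • Hᗮ.starProjection (v : V))
      𝒰 (𝓝 0) := by
    refine hHm.congr fun v => ?_
    simp only [Function.comp_apply, Submodule.coe_smul, map_smul]
    congr 1
    exact congrArg Subtype.val
      (Submodule.orthogonalProjectionOnto_starProjection_of_le hHA (v : V))
  have h3 := tendsto_nhds_unique ((continuous_subtype_val.tendsto _).comp hA)
    (h1.trans_tendsto h2)
  exact hm.nonzero A (Subtype.ext h3)

end Generic

/-! ### A chart of the model -/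

section Chart

variable {W : Subgroup (V ≃ₗᵢ[ℂ] V)}

/-- The orthogonal complement of a vector. -/
abbrev transversal (a : V) : Submodule ℂ V := (Submodule.span ℂ {a})ᗮ

/-- Homogeneous coordinates of the points of the chart. -/
def param (A : irreducibles W) (a : V) (p : transversal a × ℂ) : Coord W :=
  famCoord (A : Submodule ℂ V) p.2 (a + p.1)

/-- The chart, in homogeneous coordinates. -/
def chartCoord (A : irreducibles W) (a : V) (m : Coord W) : transversal a × ℂ :=
  ((transversal a).orthogonalProjectionOnto ((A : Submodule ℂ V)ᗮ.starProjection m.1 +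
    (innerSL ℂ a (m.2 A : V))⁻¹ • (m.2 A : V)), innerSL ℂ a m.1)

/-- The chart as a function on the ambient product. -/
def chart (A : irreducibles W) (a : V) (ω : Ambient W) : transversal a × ℂ :=
  chartCoord A a (exists_lift ω).choose

/-- The domain of the chart. -/
def chartDomain (A : irreducibles W) (a : V) : Set (Model W) :=
  {z | ∃ p, IsLift (param A a p) (z : Ambient W)}

variable {A : irreducibles W} {a : V}

lemma chartCoord_eq {m m' : Coord W} {ω : Ambient W} (h : IsLift m ω) (h' : IsLift m' ω) :
    chartCoord A a m = chartCoord A a m' := by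
  obtain ⟨c, hc, e⟩ := h.exists_smul h' A
  have e1 : m.1 = m'.1 := h.1.trans h'.1.symm
  unfold chartCoord
  rw [e, e1, Submodule.coe_smul, map_smul, smul_smul, smul_eq_mul, mul_inv_rev, mul_assoc,
    inv_mul_cancel₀ hc, mul_one]

lemma chart_eq {m : Coord W} {ω : Ambient W} (h : IsLift m ω) :
    chart A a ω = chartCoord A a m :=
  chartCoord_eq (exists_lift ω).choose_spec h

lemma inner_transversal (u : transversal a) : inner ℂ a (u : V) = 0 :=
  Submodule.mem_orthogonal_singleton_iff_inner_right.1 u.2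

lemma inner_starProjection_of_mem {A : Submodule ℂ V} (ha : a ∈ A) (v : V) :
    inner ℂ a (A.starProjection v) = inner ℂ a v := by
  rw [← Submodule.inner_starProjection_left_eq_right, Submodule.starProjection_eq_self_iff.2 ha]

lemma starProjection_orthogonal_scaleIn (A : Submodule ℂ V) (t : ℂ) (v : V) :
    Aᗮ.starProjection (scaleIn A t v) = Aᗮ.starProjection v := by
  have h1 : Aᗮ.starProjection (A.starProjection v) = 0 := by
    rw [Submodule.starProjection_apply_eq_zero_iff]
    exact A.le_orthogonal_orthogonal (A.starProjection_apply_mem v)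
  rw [scaleIn, map_add, map_smul, h1, smul_zero, add_zero]
  exact Submodule.starProjection_eq_self_iff.2 (Aᗮ.starProjection_apply_mem v)

lemma inner_scaleIn (ha : a ∈ (A : Submodule ℂ V)) (t : ℂ) (v : V) :
    inner ℂ a (scaleIn (A : Submodule ℂ V) t v) = t * inner ℂ a v := by
  rw [scaleIn, inner_add_right, inner_smul_right, inner_starProjection_of_mem ha,
    Submodule.inner_right_of_mem_orthogonal ha (Submodule.starProjection_apply_mem _ v), zero_add]

lemma inner_self_of_norm (h1 : ‖a‖ = 1) : inner ℂ a a = 1 := by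
  rw [inner_self_eq_norm_sq_to_K, h1]
  norm_num

/-- The affine hyperplane `⟨a, v⟩ = 1` passes through `a` and is parametrized by `v - a` in
`transversal a`. -/
lemma orthogonalProjectionOnto_transversal {v : V} (h1 : ‖a‖ = 1) (h : inner ℂ a v = 1) :
    a + ((transversal a).orthogonalProjectionOnto v : V) = v := by
  have hm : v - a ∈ transversal a := by
    rw [Submodule.mem_orthogonal_singleton_iff_inner_right, inner_sub_right, h,
      inner_self_of_norm h1, sub_self]
  have h0 : (transversal a).orthogonalProjectionOnto a = 0 := by
    rw [Submodule.orthogonalProjectionOnto_eq_zero_iff]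
    exact Submodule.le_orthogonal_orthogonal _ (Submodule.mem_span_singleton_self a)
  have h2 : (transversal a).orthogonalProjectionOnto v = ⟨v - a, hm⟩ := by
    have h3 : v = (v - a) + a := by abel
    conv_lhs => rw [h3]
    rw [map_add, h0, add_zero]
    exact Submodule.orthogonalProjectionOnto_mem_subspace_eq_self ⟨v - a, hm⟩
  rw [h2]
  exact add_sub_cancel a v

lemma param_fst (p : transversal a × ℂ) :
    (param A a p).1 = scaleIn (A : Submodule ℂ V) p.2 (a + p.1) := rfl

lemma param_snd_self (p : transversal a × ℂ) :
    ((param A a p).2 A : V) = (A : Submodule ℂ V).starProjection (a + p.1) := by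
  rw [param, famCoord_of_le le_rfl]
  rfl

/-- `⟨a, v⟩ = 1` makes `t` the inner product of `a` with the vector of the point, and it normalizes
the line in `A`, which together with the part in `Aᗮ` gives back `v`. -/
lemma chartCoord_param (ha : a ∈ (A : Submodule ℂ V)) (h1 : ‖a‖ = 1) (p : transversal a × ℂ) :
    chartCoord A a (param A a p) = p := by
  have h2 : inner ℂ a (a + p.1 : V) = 1 := by
    rw [inner_add_right, inner_transversal, add_zero, inner_self_of_norm h1]
  refine Prod.ext ?_ ?_
  · refine Subtype.ext (add_left_cancel (a := a) ?_)
    simp only [chartCoord, param_snd_self, innerSL_apply_apply, inner_starProjection_of_mem ha, h2,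
      inv_one, one_smul, param_fst, starProjection_orthogonal_scaleIn]
    rw [add_comm ((A : Submodule ℂ V)ᗮ.starProjection _),
      Submodule.starProjection_add_starProjection_orthogonal,
      orthogonalProjectionOnto_transversal h1 h2]
  · simp only [chartCoord, param_fst, innerSL_apply_apply, inner_scaleIn ha, h2, mul_one]

lemma chart_of_isLift_param (ha : a ∈ (A : Submodule ℂ V)) (h1 : ‖a‖ = 1) {p : transversal a × ℂ}
    {ω : Ambient W} (h : IsLift (param A a p) ω) : chart A a ω = p :=
  (chart_eq h).trans (chartCoord_param ha h1 p)

lemma isLift_param_chart (ha : a ∈ (A : Submodule ℂ V)) (h1 : ‖a‖ = 1) {z : Model W}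
    (hz : z ∈ chartDomain A a) : IsLift (param A a (chart A a (z : Ambient W))) (z : Ambient W) := by
  obtain ⟨p, hp⟩ := hz
  rwa [chart_of_isLift_param ha h1 hp]

lemma chart_snd (ω : Ambient W) : (chart A a ω).2 = inner ℂ a ω.1 := by
  obtain ⟨m, hm⟩ := exists_lift ω
  rw [chart_eq hm, ← hm.1]
  rfl

lemma projection_ne_zero_of_mem_chartDomain {z : Model W} (hz : z ∈ chartDomain A a)
    {D : irreducibles W} (hD : ¬ (D : Submodule ℂ V) ≤ A) :
    (D : Submodule ℂ V).orthogonalProjectionOnto (z : Ambient W).1 ≠ 0 := by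
  obtain ⟨p, hp⟩ := hz
  have := hp.nonzero D
  rw [param, famCoord_of_not_le hD] at this
  rwa [← hp.1]

lemma projection_line_ne_zero_of_mem_chartDomain {z : Model W} (hz : z ∈ chartDomain A a)
    {m : Coord W} (hm : IsLift m (z : Ambient W))
    {D : irreducibles W} (hD : (D : Submodule ℂ V) ≤ A) :
    (D : Submodule ℂ V).orthogonalProjectionOnto (m.2 A : V) ≠ 0 := by
  obtain ⟨p, hp⟩ := hz
  obtain ⟨c, hc, e⟩ := hp.exists_smul hm A
  have := hp.nonzero D
  rw [param, famCoord_of_le hD] at this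
  rw [e, Submodule.coe_smul, map_smul, param_snd_self,
    Submodule.orthogonalProjectionOnto_starProjection_of_le hD]
  exact smul_ne_zero hc this

lemma inner_line_ne_zero_of_mem_chartDomain (ha : a ∈ (A : Submodule ℂ V)) (h1 : ‖a‖ = 1)
    {z : Model W} (hz : z ∈ chartDomain A a) {m : Coord W} (hm : IsLift m (z : Ambient W)) :
    inner ℂ a (m.2 A : V) ≠ 0 := by
  obtain ⟨p, hp⟩ := hz
  obtain ⟨c, hc, e⟩ := hp.exists_smul hm A
  rw [e, Submodule.coe_smul, param_snd_self, inner_smul_right, inner_starProjection_of_mem ha,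
    inner_add_right, inner_transversal, add_zero, inner_self_of_norm h1, mul_one]
  exact hc

lemma starProjection_eq_of_mem_chartDomain (ha : a ∈ (A : Submodule ℂ V)) (h1 : ‖a‖ = 1)
    {z : Model W} (hz : z ∈ chartDomain A a) :
    (z : Ambient W).1 ∈ (A : Submodule ℂ V)ᗮ ↔ (chart A a (z : Ambient W)).2 = 0 := by
  constructor
  · intro h
    rw [chart_snd]
    exact Submodule.inner_right_of_mem_orthogonal ha h
  · intro h
    have hp := isLift_param_chart ha h1 hz
    rw [← hp.1, param_fst, h]
    exact scaleIn_zero_mem _ _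

variable [Finite W]

/-- The relations of the model determine every line from the vector and the line in `A`, as long as
the relevant projections are nonzero. These are open conditions, whence `isOpen_chartDomain`. -/
lemma mem_chartDomain (h1 : ‖a‖ = 1) (ha : a ∈ (A : Submodule ℂ V)) {z : Model W} {m : Coord W}
    (hm : IsLift m (z : Ambient W))
    (hx : ∀ D : irreducibles W, ¬ (D : Submodule ℂ V) ≤ A →
      (D : Submodule ℂ V).orthogonalProjectionOnto m.1 ≠ 0)
    (hl : ∀ D : irreducibles W, (D : Submodule ℂ V) ≤ A →
      (D : Submodule ℂ V).orthogonalProjectionOnto (m.2 A : V) ≠ 0)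
    (h0 : inner ℂ a (m.2 A : V) ≠ 0) : z ∈ chartDomain A a := by
  obtain ⟨c, hc⟩ := exists_smul_eq_projection z hm A
  set y : V := (inner ℂ a (m.2 A : V))⁻¹ • (m.2 A : V) with hy
  have hyA : y ∈ (A : Submodule ℂ V) := Submodule.smul_mem _ _ (m.2 A).2
  have hay : inner ℂ a y = 1 := by rw [hy, inner_smul_right, inv_mul_cancel₀ h0]
  -- The projection of the vector to `A` is a multiple of `y`; pairing with `a` finds the factor.
  have hAx : (A : Submodule ℂ V).starProjection m.1 = inner ℂ a m.1 • y := by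
    have e1 : (A : Submodule ℂ V).starProjection m.1 = c • (m.2 A : V) := congrArg Subtype.val hc
    rw [← inner_starProjection_of_mem ha m.1, e1, inner_smul_right, hy, smul_smul, mul_assoc,
      mul_inv_cancel₀ h0, mul_one]
  have hv : inner ℂ a ((A : Submodule ℂ V)ᗮ.starProjection m.1 + y) = 1 := by
    rw [inner_add_right, hay,
      Submodule.inner_right_of_mem_orthogonal ha (Submodule.starProjection_apply_mem _ _), zero_add]
  have hscale : scaleIn (A : Submodule ℂ V) (inner ℂ a m.1)
      ((A : Submodule ℂ V)ᗮ.starProjection m.1 + y) = m.1 := by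
    have e2 : (A : Submodule ℂ V).starProjection ((A : Submodule ℂ V)ᗮ.starProjection m.1) = 0 := by
      rw [Submodule.starProjection_apply_eq_zero_iff]
      exact Submodule.starProjection_apply_mem _ _
    have e3 : (A : Submodule ℂ V)ᗮ.starProjection y = 0 := by
      rw [Submodule.starProjection_apply_eq_zero_iff]
      exact Submodule.le_orthogonal_orthogonal _ hyA
    have e4 : (A : Submodule ℂ V)ᗮ.starProjection ((A : Submodule ℂ V)ᗮ.starProjection m.1) =
        (A : Submodule ℂ V)ᗮ.starProjection m.1 :=
      Submodule.starProjection_eq_self_iff.2 (Submodule.starProjection_apply_mem _ _)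
    rw [scaleIn, map_add, map_add, e2, e3, e4, add_zero, zero_add,
      Submodule.starProjection_eq_self_iff.2 hyA, ← hAx, add_comm,
      Submodule.starProjection_add_starProjection_orthogonal]
  refine ⟨((transversal a).orthogonalProjectionOnto ((A : Submodule ℂ V)ᗮ.starProjection m.1 + y),
    inner ℂ a m.1), hm.of_smul ?_ fun D => ?_⟩
  · rw [param_fst, orthogonalProjectionOnto_transversal h1 hv, hscale]
  · rw [param, orthogonalProjectionOnto_transversal h1 hv]
    by_cases hD : (D : Submodule ℂ V) ≤ A
    · obtain ⟨d, hd⟩ := exists_smul_eq_projection_of_le z hm hD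
      have hd0 : d ≠ 0 := by
        rintro rfl
        exact hl D hD (by rw [hd, zero_smul])
      refine ⟨(inner ℂ a (m.2 A : V))⁻¹ * d, mul_ne_zero (inv_ne_zero h0) hd0, ?_⟩
      have e0 : (D : Submodule ℂ V).orthogonalProjectionOnto
          ((A : Submodule ℂ V)ᗮ.starProjection m.1) = 0 := by
        rw [Submodule.orthogonalProjectionOnto_eq_zero_iff]
        exact Submodule.orthogonal_le hD (Submodule.starProjection_apply_mem _ _)
      rw [famCoord_of_le hD, map_add, e0, zero_add, hy, map_smul, hd, smul_smul]
    · obtain ⟨d, hd⟩ := exists_smul_eq_projection z hm D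
      have hd0 : d ≠ 0 := by
        rintro rfl
        exact hx D hD (by rw [hd, zero_smul])
      exact ⟨d, hd0, by rw [famCoord_of_not_le hD]; simp only [hscale, hd]⟩

lemma isOpen_chartDomain (h1 : ‖a‖ = 1) (ha : a ∈ (A : Submodule ℂ V)) :
    IsOpen (chartDomain A a) := by
  have hs : IsOpen ((⋂ D : irreducibles W, ⋂ _ : ¬ (D : Submodule ℂ V) ≤ A,
      {m : Coord W | (D : Submodule ℂ V).orthogonalProjectionOnto m.1 ≠ 0}) ∩
    ((⋂ D : irreducibles W, ⋂ _ : (D : Submodule ℂ V) ≤ A,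
      {m : Coord W | (D : Submodule ℂ V).orthogonalProjectionOnto (m.2 A : V) ≠ 0}) ∩
    {m : Coord W | inner ℂ a (m.2 A : V) ≠ 0})) := by
    refine IsOpen.inter ?_ (IsOpen.inter ?_ ?_)
    · exact isOpen_iInter_of_finite fun D => isOpen_iInter_of_finite fun _ =>
        isOpen_ne_fun (by fun_prop) (by fun_prop)
    · exact isOpen_iInter_of_finite fun D => isOpen_iInter_of_finite fun _ =>
        isOpen_ne_fun (by fun_prop) (by fun_prop)
    · exact isOpen_ne_fun (by fun_prop) (by fun_prop)
  convert (isOpen_exists_lift hs).preimage continuous_subtype_val using 1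
  ext z
  constructor
  · rintro ⟨p, hp⟩
    refine ⟨param A a p, ⟨Set.mem_iInter₂.2 fun D hD => ?_, Set.mem_iInter₂.2 fun D hD =>
      projection_line_ne_zero_of_mem_chartDomain ⟨p, hp⟩ hp hD,
      inner_line_ne_zero_of_mem_chartDomain ha h1 ⟨p, hp⟩ hp⟩, hp⟩
    rw [Set.mem_ofPred_eq, hp.1]
    exact projection_ne_zero_of_mem_chartDomain ⟨p, hp⟩ hD
  · rintro ⟨m, ⟨h2, h3, h4⟩, hm⟩
    exact mem_chartDomain h1 ha hm (Set.mem_iInter₂.1 h2) (Set.mem_iInter₂.1 h3) h4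

lemma differentiable_param : Differentiable ℂ (param A a) := by
  have h1 : Differentiable ℂ fun p : transversal a × ℂ =>
      scaleIn (A : Submodule ℂ V) p.2 (a + p.1) := by
    unfold scaleIn
    have : Differentiable ℂ fun p : transversal a × ℂ => ((p.1 : V)) :=
      ((transversal a).subtypeL.differentiable).comp differentiable_fst
    fun_prop
  refine h1.prodMk (differentiable_pi.2 fun D => ?_)
  by_cases h : (D : Submodule ℂ V) ≤ A
  · simp only [if_pos h]
    have : Differentiable ℂ fun p : transversal a × ℂ => ((p.1 : V)) :=
      ((transversal a).subtypeL.differentiable).comp differentiable_fst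
    fun_prop
  · simp only [if_neg h]
    exact (ContinuousLinearMap.differentiable _).comp h1

lemma differentiableAt_chartCoord {m : Coord W} (h : inner ℂ a (m.2 A : V) ≠ 0) :
    DifferentiableAt ℂ (chartCoord A a) m := by
  have h1 : Differentiable ℂ fun m : Coord W => (m.2 A : V) :=
    ((A : Submodule ℂ V).subtype ∘ₗ lineCoord W A).toContinuousLinearMap.differentiable
  have h2 : DifferentiableAt ℂ (fun m : Coord W => (innerSL ℂ a (m.2 A : V))⁻¹) m :=
    ((innerSL ℂ a).differentiable.comp h1).differentiableAt.inv (by simpa using h)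
  refine DifferentiableAt.prodMk ?_ ?_
  · refine (ContinuousLinearMap.differentiableAt _).comp m (DifferentiableAt.add ?_ ?_)
    · exact ((ContinuousLinearMap.differentiable _).comp differentiable_fst).differentiableAt
    · exact h2.smul h1.differentiableAt
  · exact ((ContinuousLinearMap.differentiable _).comp differentiable_fst).differentiableAt

lemma isOpen_nonzero_param : IsOpen {p : transversal a × ℂ | ∀ D, (param A a p).2 D ≠ 0} :=
  isOpen_nonzeroCoord.preimage differentiable_param.continuous

open scoped Classical in
/-- The point of the model with given chart coordinates. -/
def chartPoint (A : irreducibles W) (a : V) (ω₀ : Model W) (p : transversal a × ℂ) : Model W :=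
  -- `ω₀` is a default value for parameters at which a coordinate vanishes.
  if h : ∃ z : Model W, IsLift (param A a p) (z : Ambient W) then h.choose else ω₀

lemma isLift_chartPoint {ω₀ : Model W} {p : transversal a × ℂ}
    (h : ∀ D, (param A a p).2 D ≠ 0) :
    IsLift (param A a p) (chartPoint A a ω₀ p : Ambient W) := by
  have h' : ∃ z : Model W, IsLift (param A a p) (z : Ambient W) := exists_model_famCoord h
  rw [chartPoint, dif_pos h']
  exact h'.choose_spec

lemma chartPoint_of_isLift {ω₀ z : Model W} {p : transversal a × ℂ}
    (h : IsLift (param A a p) (z : Ambient W)) : chartPoint A a ω₀ p = z :=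
  Subtype.ext ((isLift_chartPoint h.nonzero).unique h)

lemma continuousOn_chartPoint (ω₀ : Model W) :
    ContinuousOn (chartPoint A a ω₀) {p | ∀ D, (param A a p).2 D ≠ 0} := by
  rw [continuousOn_iff_continuous_domRestrict, Topology.IsInducing.subtypeVal.continuous_iff]
  have h1 : Continuous fun p : {p : transversal a × ℂ | ∀ D, (param A a p).2 D ≠ 0} =>
      toAmbient (⟨param A a p, p.2⟩ : NonzeroCoord W) :=
    continuous_toAmbient.comp (Continuous.subtype_mk
      (differentiable_param.continuous.comp continuous_subtype_val) _)
  convert h1 using 1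
  funext p
  exact ((isLift_chartPoint p.2).unique (isLift_toAmbient ⟨param A a p, p.2⟩))

lemma isOpen_chart_preimage {s : Set (transversal a × ℂ)} (hs : IsOpen s) :
    IsOpen {ω : Ambient W | ∃ m, IsLift m ω ∧ inner ℂ a (m.2 A : V) ≠ 0 ∧
      chartCoord A a m ∈ s} := by
  have h1 : IsOpen {m : Coord W | inner ℂ a (m.2 A : V) ≠ 0} :=
    isOpen_ne_fun (by fun_prop) (by fun_prop)
  have h2 : IsOpen ({m : Coord W | inner ℂ a (m.2 A : V) ≠ 0} ∩ chartCoord A a ⁻¹' s) :=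
    ContinuousOn.isOpen_inter_preimage (fun m hm =>
      (differentiableAt_chartCoord hm).continuousAt.continuousWithinAt) h1 hs
  convert isOpen_exists_lift h2 using 1
  ext ω
  exact exists_congr fun m => ⟨fun ⟨h1, h2, h3⟩ => ⟨⟨h2, h3⟩, h1⟩, fun ⟨⟨h2, h3⟩, h1⟩ => ⟨h1, h2, h3⟩⟩

/-- Holomorphic functions of the chart coordinates are holomorphic. -/
lemma holomorphicOn_comp_chart {s : Set (transversal a × ℂ)} (hs : IsOpen s)
    {g : transversal a × ℂ → ℂ} (hg : DifferentiableOn ℂ g s) :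
    HolomorphicOn {ω : Ambient W | ∃ m, IsLift m ω ∧ inner ℂ a (m.2 A : V) ≠ 0 ∧
      chartCoord A a m ∈ s} (fun ω => g (chart A a ω)) := by
  refine ⟨fun m => g (chartCoord A a m), ?_, fun ω _ m hm => by simp only [chart_eq hm]⟩
  rintro m ⟨ω, ⟨m', hm', h0, hs'⟩, hm⟩
  obtain ⟨c, hc, e⟩ := hm'.exists_smul hm A
  have h0' : inner ℂ a (m.2 A : V) ≠ 0 := by
    rw [e, Submodule.coe_smul, inner_smul_right]
    exact mul_ne_zero hc h0
  rw [chartCoord_eq hm' hm] at hs'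
  exact ((hg.differentiableAt (hs.mem_nhds hs')).comp m
    (differentiableAt_chartCoord h0')).differentiableWithinAt

/-- Holomorphic functions are holomorphic functions of the chart coordinates. -/
lemma HolomorphicAt.eventually_differentiableAt {Z : Set (Model W)} {f : Model W → ℂ} {ω : Model W}
    (hf : HolomorphicAt Z f ω) {p : transversal a × ℂ} (hp : IsLift (param A a p) (ω : Ambient W))
    (ω₀ : Model W) : ∃ g : transversal a × ℂ → ℂ, (∀ᶠ q in 𝓝 p, DifferentiableAt ℂ g q) ∧
      ∀ᶠ q in 𝓝 p, chartPoint A a ω₀ q ∈ Z → f (chartPoint A a ω₀ q) = g q := by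
  obtain ⟨U, hU, hωU, F, ⟨F', h1, h2⟩, e⟩ := hf
  have hev : ∀ᶠ q in 𝓝 p, param A a q ∈ {m : Coord W | ∃ ω ∈ U, IsLift m ω} :=
    differentiable_param.continuous.continuousAt.eventually
      ((isOpen_lifts hU).mem_nhds ⟨_, hωU, hp⟩)
  refine ⟨fun q => F' (param A a q), ?_, ?_⟩
  · filter_upwards [hev] with q hq
    exact (h1.differentiableAt ((isOpen_lifts hU).mem_nhds hq)).comp q
      differentiable_param.differentiableAt
  · filter_upwards [hev] with q ⟨ω', hω', hq⟩ hZ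
    have h3 := isLift_chartPoint (ω₀ := ω₀) hq.nonzero
    have h4 : (chartPoint A a ω₀ q : Ambient W) ∈ U := h3.unique hq ▸ hω'
    rw [e _ hZ h4, h2 _ h4 _ h3]

lemma continuousAt_chart (h1 : ‖a‖ = 1) (ha : a ∈ (A : Submodule ℂ V)) {z : Model W}
    (hz : z ∈ chartDomain A a) : ContinuousAt (fun z : Model W => chart A a (z : Ambient W)) z := by
  intro s hs
  obtain ⟨s', hs', hopen, hmem⟩ := mem_nhds_iff.1 hs
  have hl := isLift_param_chart ha h1 hz
  have h2 : {z : Model W | ∃ m, IsLift m (z : Ambient W) ∧ inner ℂ a (m.2 A : V) ≠ 0 ∧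
      chartCoord A a m ∈ s'} ∈ 𝓝 z :=
    ((isOpen_chart_preimage hopen).preimage continuous_subtype_val).mem_nhds
      ⟨_, hl, inner_line_ne_zero_of_mem_chartDomain ha h1 hz hl, by rwa [← chart_eq hl]⟩
  rw [Filter.mem_map]
  filter_upwards [h2] with z' ⟨m, hm, _, hm'⟩
  rw [Set.mem_preimage, chart_eq hm]
  exact hs' hm'

end Chart

/-! ### Stabilizers of Springer generic points -/

section Stabilizer

variable {W : Subgroup (V ≃ₗᵢ[ℂ] V)}

lemma moveLin_projection (w : W) (D : irreducibles W) (v : V) :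
    moveLin w D ((move (w : V ≃ₗᵢ[ℂ] V)⁻¹ (D : Submodule ℂ V)).orthogonalProjectionOnto v) =
      (D : Submodule ℂ V).orthogonalProjectionOnto ((w : V ≃ₗᵢ[ℂ] V) v) := by
  symm
  refine Subtype.ext (Submodule.eq_starProjection_of_mem_orthogonal (Subtype.property _) ?_)
  have e : (w : V ≃ₗᵢ[ℂ] V) v - (w : V ≃ₗᵢ[ℂ] V)
      ((move (w : V ≃ₗᵢ[ℂ] V)⁻¹ (D : Submodule ℂ V)).starProjection v)
      = (w : V ≃ₗᵢ[ℂ] V) (v -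
        (move (w : V ≃ₗᵢ[ℂ] V)⁻¹ (D : Submodule ℂ V)).starProjection v) :=
    (map_sub _ _ _).symm
  have h2 := Submodule.sub_starProjection_mem_orthogonal
    (K := move (w : V ≃ₗᵢ[ℂ] V)⁻¹ (D : Submodule ℂ V)) v
  rw [← move_orthogonal, mem_move, inv_inv] at h2
  exact e ▸ h2

lemma apply_eq_scaleIn {A : Submodule ℂ V} {w : V ≃ₗᵢ[ℂ] V} {c : ℂ} (h1 : ∀ v ∈ A, w v = c • v)
    (h2 : ∀ v ∈ Aᗮ, w v = v) (v : V) : w v = scaleIn A c v := by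
  conv_lhs => rw [← A.starProjection_add_starProjection_orthogonal v]
  rw [map_add, h1 _ (A.starProjection_apply_mem v), h2 _ (Aᗮ.starProjection_apply_mem v), scaleIn,
    add_comm]

lemma scaleIn_scaleIn (A : Submodule ℂ V) (s t : ℂ) (v : V) :
    scaleIn A s (scaleIn A t v) = scaleIn A (s * t) v := by
  have h1 : A.starProjection (scaleIn A t v) = t • A.starProjection v := by
    have h0 : A.starProjection (Aᗮ.starProjection v) = 0 := by
      rw [Submodule.starProjection_apply_eq_zero_iff]
      exact Aᗮ.starProjection_apply_mem v
    rw [scaleIn, map_add, map_smul, h0, zero_add,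
      Submodule.starProjection_eq_self_iff.2 (A.starProjection_apply_mem v)]
  rw [scaleIn, starProjection_orthogonal_scaleIn, h1, smul_smul, scaleIn]

lemma scalar_ne_zero {A : Submodule ℂ V} (hA : A ≠ ⊥) {w : V ≃ₗᵢ[ℂ] V} {c : ℂ}
    (h : ∀ v ∈ A, w v = c • v) : c ≠ 0 := by
  rintro rfl
  obtain ⟨v, hv, hv0⟩ := Submodule.exists_mem_ne_zero_of_ne_bot hA
  have := h v hv
  rw [zero_smul] at this
  exact hv0 (w.map_eq_zero_iff.1 this)

/-- The action of an element that is scalar on `A` and trivial on `Aᗮ`. -/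
lemma isLift_famCoord_smul {A : irreducibles W} {w : W} {c : ℂ}
    (h1 : ∀ v ∈ (A : Submodule ℂ V), (w : V ≃ₗᵢ[ℂ] V) v = c • v)
    (h2 : ∀ v ∈ (A : Submodule ℂ V)ᗮ, (w : V ≃ₗᵢ[ℂ] V) v = v) {t : ℂ} {v : V} {z : Ambient W}
    (hz : IsLift (famCoord (A : Submodule ℂ V) t v) z) :
    IsLift (famCoord (A : Submodule ℂ V) (c * t) v) (w • z) := by
  have hc := scalar_ne_zero A.2.2.1 h1
  have hw := apply_eq_scaleIn h1 h2
  refine (hz.smul w).of_smul ?_ fun D => ?_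
  · change scaleIn _ _ _ = (w : V ≃ₗᵢ[ℂ] V) (scaleIn _ _ _)
    rw [hw, scaleIn_scaleIn]
  · have hiff : move (w : V ≃ₗᵢ[ℂ] V)⁻¹ (D : Submodule ℂ V) ≤ A ↔ (D : Submodule ℂ V) ≤ A := by
      have hA : move (w : V ≃ₗᵢ[ℂ] V) (A : Submodule ℂ V) = A := by
        refine Submodule.eq_of_le_of_finrank_eq ?_ (finrank_move _ _)
        rintro _ ⟨v, hv, rfl⟩
        change (w : V ≃ₗᵢ[ℂ] V) v ∈ _
        rw [h1 v hv]
        exact Submodule.smul_mem _ _ hv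
      constructor
      · intro h
        have := move_mono (w : V ≃ₗᵢ[ℂ] V) h
        rwa [move_move_inv, hA] at this
      · intro h
        have := move_mono (w : V ≃ₗᵢ[ℂ] V)⁻¹ h
        rwa [← hA, move_inv_move] at this
    -- For `D ≤ A` the coordinate is multiplied by `c`, which does not change its line. For other
    -- `D` it follows the vector, in which `t` becomes `c * t`.
    by_cases hD : (D : Submodule ℂ V) ≤ A
    · refine ⟨c⁻¹, inv_ne_zero hc, ?_⟩
      change _ = c⁻¹ • moveLin w D _
      rw [famCoord_of_le hD, famCoord_of_le (hiff.2 hD), moveLin_projection, hw,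
        projection_scaleIn_of_le hD, smul_smul, inv_mul_cancel₀ hc, one_smul]
    · refine ⟨1, one_ne_zero, ?_⟩
      change _ = (1 : ℂ) • moveLin w D _
      rw [famCoord_of_not_le hD, famCoord_of_not_le fun h => hD (hiff.1 h), moveLin_projection, hw,
        scaleIn_scaleIn, one_smul]

lemma smul_mem_of_fix_orthogonal {A : Submodule ℂ V} {g : V ≃ₗᵢ[ℂ] V} (h : ∀ v ∈ Aᗮ, g v = v)
    {v : V} (hv : v ∈ A) : g v ∈ A := by
  rw [← A.orthogonal_orthogonal, Submodule.mem_orthogonal]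
  intro u hu
  rw [← h u hu, g.inner_map_map]
  exact Submodule.inner_left_of_mem_orthogonal hv hu

lemma mem_parabolic_of_isReflection {A : Submodule ℂ V} {r : V ≃ₗᵢ[ℂ] V} (hr : r ∈ W)
    (hA : (fixedSpace r)ᗮ ≤ A) : r ∈ parabolic W A := by
  refine ⟨hr, fun v hv => ?_⟩
  have := Submodule.orthogonal_le hA hv
  rwa [Submodule.orthogonal_orthogonal] at this

/-- The center of a parabolic subgroup consists of the scalar elements. -/
lemma mem_center_parabolic_iff (A : irreducibles W) (w : parabolic W (A : Submodule ℂ V)) :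
    w ∈ Subgroup.center (parabolic W (A : Submodule ℂ V)) ↔
      ∃ c : ℂ, ∀ v ∈ (A : Submodule ℂ V), (w : V ≃ₗᵢ[ℂ] V) v = c • v := by
  rw [Subgroup.mem_center_iff]
  constructor
  · intro h
    refine scalar_of_forall_lines A.2 _ ?_
    rintro _ ⟨r, hr, href, rfl⟩ hA v hv
    have h1 := congrArg Subtype.val (h ⟨r, mem_parabolic_of_isReflection hr hA⟩)
    have h2 : ∀ u, r ((w : V ≃ₗᵢ[ℂ] V) u) = (w : V ≃ₗᵢ[ℂ] V) (r u) := fun u => DFunLike.congr_fun h1 u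
    -- Commuting with `r`, the element `w` preserves its fixed space and so the line orthogonal to
    -- it; `scalar_of_forall_lines` needs just this.
    have h3 : move (w : V ≃ₗᵢ[ℂ] V) (fixedSpace r) = fixedSpace r := by
      refine Submodule.eq_of_le_of_finrank_eq ?_ (finrank_move _ _)
      rintro _ ⟨u, hu, rfl⟩
      change r ((w : V ≃ₗᵢ[ℂ] V) u) = (w : V ≃ₗᵢ[ℂ] V) u
      rw [h2, show r u = u from hu]
    rw [← h3, ← move_orthogonal, mem_move]
    exact ((w : V ≃ₗᵢ[ℂ] V).symm_apply_apply v).symm ▸ hv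
  · rintro ⟨c, hc⟩ g
    refine Subtype.ext (LinearIsometryEquiv.ext fun v => ?_)
    change (g : V ≃ₗᵢ[ℂ] V) ((w : V ≃ₗᵢ[ℂ] V) v) = (w : V ≃ₗᵢ[ℂ] V) ((g : V ≃ₗᵢ[ℂ] V) v)
    have h1 := (A : Submodule ℂ V).starProjection_apply_mem v
    have h2 := (A : Submodule ℂ V)ᗮ.starProjection_apply_mem v
    rw [← (A : Submodule ℂ V).starProjection_add_starProjection_orthogonal v]
    simp only [map_add]
    rw [w.2.2 _ h2, g.2.2 _ h2, w.2.2 _ h2, hc _ h1, map_smul,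
      hc _ (smul_mem_of_fix_orthogonal g.2.2 h1)]

variable [Finite W]

lemma IsGeneric.hyperplane {A : irreducibles W} {ω : Model W}
    (h : IsGeneric W (A : Submodule ℂ V) ω) {H : Submodule ℂ V} (hH : H ∈ arrangement W)
    (hx : (ω : Ambient W).1 ∈ H) : Hᗮ ≤ A := by
  rw [← h.sumLines_eq]
  exact le_sumLines hH (by rwa [Submodule.orthogonal_orthogonal])

lemma IsGeneric.fst_mem {A : irreducibles W} {ω : Model W}
    (h : IsGeneric W (A : Submodule ℂ V) ω) : (ω : Ambient W).1 ∈ (A : Submodule ℂ V)ᗮ := by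
  rw [← h.sumLines_eq]
  exact orthogonal_sumLines (p := fun L => (ω : Ambient W).1 ∈ Lᗮ) fun H _ hp => hp

/-- The vector of `ω` is fixed, so by `steinberg` the element is a product of reflections that fix
it, and these have their lines in `A`. The line of `ω` in `A` is an eigenline outside all
hyperplanes of `W_A`; a nonscalar element would make it Springer regular. -/
lemma IsSpringerGeneric.exists_scalar (hW : IsReflectionGroup W) {A : irreducibles W} {ω : Model W}
    (h : IsSpringerGeneric W A ω) {w : W} (hw : w • ω = ω) :
    (w : V ≃ₗᵢ[ℂ] V) ∈ parabolic W (A : Submodule ℂ V) ∧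
      ∃ c : ℂ, ∀ v ∈ (A : Submodule ℂ V), (w : V ≃ₗᵢ[ℂ] V) v = c • v := by
  have hpar : (w : V ≃ₗᵢ[ℂ] V) ∈ parabolic W (A : Submodule ℂ V) := by
    have h1 : (w : V ≃ₗᵢ[ℂ] V) ∈ fixer W (ω : Ambient W).1 :=
      ⟨w.2, congrArg (fun z : Model W => (z : Ambient W).1) hw⟩
    refine (Subgroup.closure_le _).2 ?_ (steinberg hW _ h1)
    rintro r ⟨hr, href⟩
    exact mem_parabolic_of_isReflection hr.1
      (h.1.hyperplane ⟨r, hr.1, href, rfl⟩ hr.2)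
  refine ⟨hpar, ?_⟩
  by_contra hns
  obtain ⟨m, hm⟩ := exists_lift (ω : Ambient W)
  have hmove : move (w : V ≃ₗᵢ[ℂ] V)⁻¹ (A : Submodule ℂ V) = A := by
    refine Submodule.eq_of_le_of_finrank_eq (fun v hv => ?_) (finrank_move _ _)
    rw [mem_move, inv_inv] at hv
    have := smul_mem_of_fix_orthogonal ((parabolic W (A : Submodule ℂ V)).inv_mem hpar).2 hv
    rwa [show (w : V ≃ₗᵢ[ℂ] V)⁻¹ ((w : V ≃ₗᵢ[ℂ] V) v) = v from
      (w : V ≃ₗᵢ[ℂ] V).symm_apply_apply v] at this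
  have hlift : IsLift (coordMap w m) (ω : Ambient W) := by
    have := hm.smul w
    rwa [show w • (ω : Ambient W) = ω from congrArg Subtype.val hw] at this
  obtain ⟨c, hc, e⟩ := hm.exists_smul hlift A
  have e' : (w : V ≃ₗᵢ[ℂ] V) (m.2 A : V) = c • (m.2 A : V) := by
    have e1 : ((coordMap w m).2 A : V) = ((c • m.2 A : (A : Submodule ℂ V)) : V) := by rw [e]
    rw [Submodule.coe_smul] at e1
    rw [← e1]
    change _ = (w : V ≃ₗᵢ[ℂ] V) (m.2 ⟨move (w : V ≃ₗᵢ[ℂ] V)⁻¹ (A : Submodule ℂ V), _⟩ : V)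
    congr 1
    exact coord_congr m (Subtype.ext hmove.symm)
  refine h.2 (m.2 A) ⟨?_, w, hpar, ⟨c, e'⟩, hns⟩ ?_
  · rintro _ ⟨r, hr, href, rfl⟩
    refine h.1.notMem hm ⟨r, hr.1, href, rfl⟩ ?_
    rw [← (A : Submodule ℂ V).orthogonal_orthogonal]
    exact Submodule.orthogonal_le fun v hv => hr.2 v hv
  · obtain ⟨h0, e⟩ := hm.2 A
    rw [← e, Projectivization.submodule_mk]

/-! ### The divisor in the chart, and the stabilizer -/

variable {A : irreducibles W} {a : V}

lemma mem_divisor_fst {A : Submodule ℂ V} {z : Model W} (hz : z ∈ divisor W A) :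
    (z : Ambient W).1 ∈ Aᗮ := by
  obtain ⟨Z, ⟨-, himg⟩, hzZ⟩ := hz
  have : (z : Ambient W).1 ∈ (Aᗮ : Set V) := himg ▸ ⟨z, hzZ, rfl⟩
  exact this

/-- A unit vector on the line in `A` of a generic point gives a chart around the point. -/
lemma IsGeneric.exists_chart {ω : Model W} (h : IsGeneric W (A : Submodule ℂ V) ω) :
    ∃ a ∈ (A : Submodule ℂ V), ‖a‖ = 1 ∧ ω ∈ chartDomain A a := by
  obtain ⟨m, hm⟩ := exists_lift (ω : Ambient W)
  have h0 : (m.2 A : V) ≠ 0 := fun h0 => hm.nonzero A (Subtype.ext h0)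
  have hn : (‖(m.2 A : V)‖ : ℂ) ≠ 0 := by
    rw [Complex.ofReal_ne_zero]
    exact norm_ne_zero_iff.2 h0
  have ha1 : ‖((‖(m.2 A : V)‖ : ℂ)⁻¹ • (m.2 A : V))‖ = 1 := by
    rw [norm_smul, norm_inv, Complex.norm_real, norm_norm]
    exact inv_mul_cancel₀ (norm_ne_zero_iff.2 h0)
  have haA : (‖(m.2 A : V)‖ : ℂ)⁻¹ • (m.2 A : V) ∈ (A : Submodule ℂ V) :=
    Submodule.smul_mem _ _ (m.2 A).2
  refine ⟨_, haA, ha1, mem_chartDomain ha1 haA hm (fun D hD h0 => hD ?_) (fun D hD h0 => ?_) ?_⟩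
  · rw [Submodule.orthogonalProjectionOnto_eq_zero_iff, hm.1] at h0
    exact le_of_forall_lines D.2.1 fun H hH hHD => h.hyperplane hH (by
      rw [← H.orthogonal_orthogonal]
      exact Submodule.orthogonal_le hHD h0)
  · obtain ⟨H, hH, hHD⟩ := exists_line_le D.2.1 D.2.2.1
    exact projection_ne_zero_of_notMem (h.notMem hm hH (hHD.trans hD)) hHD h0
  · rw [inner_smul_left]
    exact mul_ne_zero ((map_ne_zero _).2 (inv_ne_zero hn)) (inner_self_ne_zero.2 h0)

/-- The locus `t = 0` of the chart lies in the stratum of `A`, which contains `ω`; hence it lies in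
the divisor. -/
lemma IsGeneric.mem_divisor_iff {ω : Model W} (h : IsGeneric W (A : Submodule ℂ V) ω)
    (ha : a ∈ (A : Submodule ℂ V)) (h1 : ‖a‖ = 1) (hω : ω ∈ chartDomain A a) {z : Model W}
    (hz : z ∈ chartDomain A a) :
    z ∈ divisor W (A : Submodule ℂ V) ↔ (chart A a (z : Ambient W)).2 = 0 := by
  rw [← starProjection_eq_of_mem_chartDomain ha h1 hz]
  refine ⟨mem_divisor_fst, fun hzA => ?_⟩
  have key : ∀ z ∈ chartDomain A a, (z : Ambient W).1 ∈ (A : Submodule ℂ V)ᗮ →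
      z ∈ stratum W (A : Submodule ℂ V) := by
    intro z hz hzA
    have hl := isLift_param_chart ha h1 hz
    rw [param, (starProjection_eq_of_mem_chartDomain ha h1 hz).1 hzA] at hl
    exact ⟨_, hl⟩
  exact h.closure_stratum_subset A (subset_closure (key ω hω h.fst_mem))
    (subset_closure (key z hz hzA))

lemma toQuotient_eq_iff {z z' : Model W} : toQuotient W z = toQuotient W z' ↔ ∃ g : W, g • z' = z :=
  Quotient.eq.trans MulAction.orbitRel_apply

/-- A point of a translate of `D_A` has a vector orthogonal to some `g w A`. In the chart,
projections to irreducible subspaces outside `A` are nonzero, so `g w A ≤ A`, with equality by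
dimension. -/
lemma IsGeneric.mem_quotientDivisor_iff {ω : Model W} (h : IsGeneric W (A : Submodule ℂ V) ω)
    (ha : a ∈ (A : Submodule ℂ V)) (h1 : ‖a‖ = 1) (hω : ω ∈ chartDomain A a) {z : Model W}
    (hz : z ∈ chartDomain A a) :
    toQuotient W z ∈ quotientDivisor W (A : Submodule ℂ V) ↔
      (chart A a (z : Ambient W)).2 = 0 := by
  constructor
  · rintro ⟨z', hz', e⟩
    obtain ⟨w, hw⟩ := Set.mem_iUnion.1 hz'
    obtain ⟨g, rfl⟩ := toQuotient_eq_iff.1 e.symm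
    rw [← starProjection_eq_of_mem_chartDomain ha h1 hz]
    have h2 : ((g • z' : Model W) : Ambient W).1 ∈
        (move ((g * w : W) : V ≃ₗᵢ[ℂ] V) (A : Submodule ℂ V))ᗮ := by
      rw [Subgroup.coe_mul, move_mul, ← move_orthogonal, mem_move]
      exact ((g : V ≃ₗᵢ[ℂ] V).symm_apply_apply (z' : Ambient W).1).symm ▸ mem_divisor_fst hw
    have h3 : move ((g * w : W) : V ≃ₗᵢ[ℂ] V) (A : Submodule ℂ V) ≤ A := by
      by_contra hle
      refine projection_ne_zero_of_mem_chartDomain hz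
        (D := ⟨_, move_mem_irreducibles (g * w : W).2 A.2⟩) hle ?_
      rw [Submodule.orthogonalProjectionOnto_eq_zero_iff]
      exact h2
    rwa [Submodule.eq_of_le_of_finrank_eq h3 (finrank_move _ _)] at h2
  · intro h0
    refine ⟨z, Set.mem_iUnion.2 ⟨1, ?_⟩, rfl⟩
    rw [OneMemClass.coe_one, move_one]
    exact (h.mem_divisor_iff ha h1 hω hz).2 h0

/-- The element multiplies the chart coordinate `t` by `c`, without effect at `t = 0`. -/
lemma smul_eq_of_chart_snd (ha : a ∈ (A : Submodule ℂ V)) (h1 : ‖a‖ = 1) {z : Model W}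
    (hz : z ∈ chartDomain A a) (h0 : (chart A a (z : Ambient W)).2 = 0) {w : W}
    (hw : (w : V ≃ₗᵢ[ℂ] V) ∈ parabolic W (A : Submodule ℂ V)) {c : ℂ}
    (hc : ∀ v ∈ (A : Submodule ℂ V), (w : V ≃ₗᵢ[ℂ] V) v = c • v) : w • z = z := by
  have hl := isLift_param_chart ha h1 hz
  have h2 := isLift_famCoord_smul hc hw.2 hl
  rw [h0, mul_zero] at h2
  rw [param, h0] at hl
  exact Subtype.ext (h2.unique hl)

lemma IsSpringerGeneric.mem_stabilizer_iff (hW : IsReflectionGroup W) {ω : Model W}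
    (h : IsSpringerGeneric W A ω) (w : W) : w • ω = ω ↔
      (w : V ≃ₗᵢ[ℂ] V) ∈ parabolic W (A : Submodule ℂ V) ∧
        ∃ c : ℂ, ∀ v ∈ (A : Submodule ℂ V), (w : V ≃ₗᵢ[ℂ] V) v = c • v := by
  refine ⟨h.exists_scalar hW, fun ⟨hpar, c, hc⟩ => ?_⟩
  obtain ⟨a, ha, h1, hω⟩ := h.1.exists_chart
  exact smul_eq_of_chart_snd ha h1 hω
    ((starProjection_eq_of_mem_chartDomain ha h1 hω).1 h.1.fst_mem) hpar hc

lemma IsSpringerGeneric.map_stabilizer (hW : IsReflectionGroup W) {ω : Model W}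
    (h : IsSpringerGeneric W A ω) :
    (MulAction.stabilizer W ω).map W.subtype =
      (Subgroup.center (parabolic W (A : Submodule ℂ V))).map
        (parabolic W (A : Submodule ℂ V)).subtype := by
  ext g
  constructor
  · rintro ⟨w, hw, rfl⟩
    obtain ⟨hpar, hc⟩ := h.exists_scalar hW hw
    exact ⟨⟨w, hpar⟩, (mem_center_parabolic_iff A _).2 hc, rfl⟩
  · rintro ⟨w, hw, rfl⟩
    exact ⟨⟨w, w.2.1⟩, (h.mem_stabilizer_iff hW _).2
      ⟨w.2, (mem_center_parabolic_iff A w).1 hw⟩, rfl⟩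

/-- The stabilizer of a Springer generic point has a generator that acts on `A` as a primitive
root of unity. -/
lemma IsSpringerGeneric.exists_generator (hW : IsReflectionGroup W) {ω : Model W}
    (h : IsSpringerGeneric W A ω) : ∃ (ρ : W) (ε : ℂ), ρ • ω = ω ∧
      Subgroup.zpowers ρ = MulAction.stabilizer W ω ∧
      IsPrimitiveRoot ε (Nat.card (Subgroup.center (parabolic W (A : Submodule ℂ V)))) ∧
      (∀ v ∈ (A : Submodule ℂ V), (ρ : V ≃ₗᵢ[ℂ] V) v = ε • v) ∧
      (∀ v ∈ (A : Submodule ℂ V)ᗮ, (ρ : V ≃ₗᵢ[ℂ] V) v = v) := by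
  obtain ⟨a, ha, h1, -⟩ := h.1.exists_chart
  have hs : ∀ w : MulAction.stabilizer W ω, ∃ c : ℂ, ∀ v ∈ (A : Submodule ℂ V),
      ((w : W) : V ≃ₗᵢ[ℂ] V) v = c • v := fun w => (h.exists_scalar hW w.2).2
  choose c hc using hs
  have ha0 : a ≠ 0 := fun h0 => by simp [h0] at h1
  have huniq : ∀ {x y : ℂ}, x • a = y • a → x = y := fun h => smul_left_injective ℂ ha0 h
  -- The scalar on `A` determines the element, so the stabilizer embeds multiplicatively in a field.
  -- A finite group of this kind is cyclic, and the scalar of a generator is a primitive root of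
  -- unity.
  let f : MulAction.stabilizer W ω →* ℂ :=
    { toFun := c
      map_one' := huniq (by rw [← hc 1 a ha, one_smul]; rfl)
      map_mul' := fun x y => huniq (by
        have e1 : ((x * y : MulAction.stabilizer W ω) : V ≃ₗᵢ[ℂ] V) a =
            (x : V ≃ₗᵢ[ℂ] V) ((y : V ≃ₗᵢ[ℂ] V) a) := rfl
        rw [← hc (x * y) a ha, e1, hc y a ha, map_smul, hc x a ha, smul_smul, mul_comm]) }
  have hf : Function.Injective f := by
    intro x y hxy
    have hxy' : c x = c y := hxy
    refine Subtype.ext (Subtype.ext (LinearIsometryEquiv.ext fun v => ?_))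
    rw [apply_eq_scaleIn (hc x) (h.exists_scalar hW x.2).1.2,
      apply_eq_scaleIn (hc y) (h.exists_scalar hW y.2).1.2, hxy']
  have hcyc : IsCyclic (MulAction.stabilizer W ω) := isCyclic_of_injective_ringHom f hf
  obtain ⟨ρ, hρ⟩ := hcyc.exists_generator
  refine ⟨ρ, f ρ, ρ.2, ?_, ?_, hc ρ, (h.exists_scalar hW ρ.2).1.2⟩
  · ext w
    constructor
    · rintro ⟨k, rfl⟩
      exact (MulAction.stabilizer W ω).zpow_mem ρ.2 k
    · intro hw
      obtain ⟨k, hk⟩ := hρ ⟨w, hw⟩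
      exact ⟨k, congrArg Subtype.val hk⟩
  · have h2 : Nat.card (Subgroup.center (parabolic W (A : Submodule ℂ V))) = orderOf ρ := by
      rw [orderOf_eq_card_of_forall_mem_zpowers hρ]
      refine Nat.card_congr (((Subgroup.equivMapOfInjective _ _
        (Subgroup.subtype_injective _)).toEquiv.trans (Equiv.setCongr ?_)).trans
        (Subgroup.equivMapOfInjective (MulAction.stabilizer W ω) _
          (Subgroup.subtype_injective _)).toEquiv.symm)
      rw [h.map_stabilizer hW]
    rw [h2, ← orderOf_injective f hf]
    exact IsPrimitiveRoot.orderOf (f ρ)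

end Stabilizer

/-! ### Division of holomorphic functions by a coordinate -/

section Division

open MeasureTheory

variable {E : Type*} [NormedAddCommGroup E] [NormedSpace ℂ E] [FiniteDimensional ℂ E]

/-- Bounded integrals of holomorphic functions that depend continuously on a parameter are
holomorphic. -/
lemma differentiableOn_integral_of_bounded {μ : Measure ℝ} [IsFiniteMeasure μ] {k : E → ℝ → ℂ}
    {p₀ : E} {r C : ℝ} (hd : ∀ θ, DifferentiableOn ℂ (fun p => k p θ) (Metric.ball p₀ r))
    (hc : ∀ p ∈ Metric.ball p₀ r, Continuous (k p))
    (hC : ∀ p ∈ Metric.ball p₀ r, ∀ θ, ‖k p θ‖ ≤ C) :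
    DifferentiableOn ℂ (fun p => ∫ θ, k p θ ∂μ) (Metric.ball p₀ r) := by
  intro p hp
  obtain ⟨s, hs, hsub⟩ := Metric.isOpen_iff.1 Metric.isOpen_ball p hp
  have hd' : ∀ θ, DifferentiableAt ℂ (fun p => k p θ) p := fun θ =>
    (hd θ).differentiableAt (Metric.isOpen_ball.mem_nhds hp)
  -- Directional derivatives are limits of difference quotients that are continuous in `θ`; in a
  -- basis the derivative is a finite sum of them.
  have hmeas : AEStronglyMeasurable (fun θ => fderiv ℂ (fun p => k p θ) p) μ := by
    let b := Module.finBasis ℂ E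
    have happ : ∀ v : E, AEStronglyMeasurable (fun θ => fderiv ℂ (fun p => k p θ) p v) μ := by
      intro v
      obtain ⟨η, hη, hηv⟩ : ∃ η : ℝ, 0 < η ∧ η * ‖v‖ < s := by
        refine ⟨s / (‖v‖ + 1), by positivity, ?_⟩
        rw [div_mul_eq_mul_div, div_lt_iff₀ (by positivity)]
        nlinarith [norm_nonneg v]
      let c : ℕ → ℂ := fun n => ((η * (1 / ((n : ℝ) + 1)) : ℝ) : ℂ)
      have hc0 : ∀ n, c n ≠ 0 := fun n => by
        simp only [c, ne_eq, Complex.ofReal_eq_zero]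
        positivity
      have hcn : ∀ n, ‖c n‖ ≤ η := fun n => by
        simp only [c, Complex.norm_real, Real.norm_eq_abs]
        rw [abs_of_nonneg (by positivity)]
        have : (1 : ℝ) / ((n : ℝ) + 1) ≤ 1 := by
          rw [div_le_one (by positivity)]
          have : (0 : ℝ) ≤ n := n.cast_nonneg
          linarith
        nlinarith
      have hlim : Filter.Tendsto c Filter.atTop (𝓝[≠] 0) := by
        refine tendsto_nhdsWithin_iff.2 ⟨?_, Filter.Eventually.of_forall hc0⟩
        have h1 := (tendsto_one_div_add_atTop_nhds_zero_nat (𝕜 := ℝ)).const_mul η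
        rw [mul_zero] at h1
        exact (Complex.continuous_ofReal.tendsto 0).comp h1
      have hin : ∀ n, p + c n • v ∈ Metric.ball p₀ r := fun n => hsub (by
        rw [mem_ball_iff_norm, add_sub_cancel_left, norm_smul]
        exact (mul_le_mul_of_nonneg_right (hcn n) (norm_nonneg v)).trans_lt hηv)
      refine aestronglyMeasurable_of_tendsto_ae Filter.atTop
        (f := fun n θ => (c n)⁻¹ • (k (p + c n • v) θ - k p θ)) (fun n => ?_)
        (Filter.Eventually.of_forall fun θ => ?_)
      · have h1 := hc _ (hin n)
        have h2 := hc p hp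
        have h3 : Continuous fun θ => (c n)⁻¹ • (k (p + c n • v) θ - k p θ) := by fun_prop
        exact h3.aestronglyMeasurable
      · have h1 := ((hd' θ).hasFDerivAt.hasLineDerivAt v)
        have h2 := hasDerivAt_iff_tendsto_slope_zero.1 h1
        simpa [Function.comp_def] using h2.comp hlim
    have hsum : (fun θ => fderiv ℂ (fun p => k p θ) p) = fun θ => ∑ i,
        (fderiv ℂ (fun p => k p θ) p (b i)) • (b.coord i).toContinuousLinearMap := by
      funext θ
      ext v
      have h := congrArg (fderiv ℂ (fun p => k p θ) p) (b.sum_repr v)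
      rw [map_sum] at h
      simp only [map_smul, smul_eq_mul] at h
      simp only [← h, sum_apply, smul_apply,
        LinearMap.coe_toContinuousLinearMap', Module.Basis.coord_apply, smul_eq_mul, mul_comm]
    rw [hsum]
    exact Finset.aestronglyMeasurable_fun_sum _ fun i _ => (happ (b i)).smul_const _
  -- On the ball of radius `s` the values stay within `C + C` of the value at its centre, so the
  -- Schwarz lemma gives the Lipschitz bound `(C + C) / s`.
  refine (hasFDerivAt_integral_of_dominated_loc_of_lip' (bound := fun _ => (C + C) / s)
    (Metric.ball_mem_nhds p hs) (fun x hx => (hc x (hsub hx)).aestronglyMeasurable)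
    ((integrable_const C).mono' (hc p hp).aestronglyMeasurable
      (Filter.Eventually.of_forall fun θ => hC p hp θ)) hmeas
    (Filter.Eventually.of_forall fun θ x hx => ?_) (integrable_const _)
    (Filter.Eventually.of_forall fun θ =>
      (hd' θ).hasFDerivAt)).2.differentiableAt.differentiableWithinAt
  rw [← dist_eq_norm, ← dist_eq_norm]
  refine Complex.dist_le_div_mul_dist_of_mapsTo_ball (f := fun p => k p θ) ((hd θ).mono hsub)
    (fun y hy => ?_) hx
  rw [mem_closedBall_iff_norm]
  exact (norm_sub_le _ _).trans (add_le_add (hC y (hsub hy) θ) (hC p hp θ))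

/-- A holomorphic function that vanishes on the hyperplane of the last coordinate is divisible by
that coordinate. -/
lemma exists_eq_mul_of_vanishing {F : E × ℂ → ℂ} {u₀ : E}
    (hF : ∀ᶠ p in 𝓝 (u₀, (0 : ℂ)), DifferentiableAt ℂ F p)
    (h0 : ∀ᶠ u in 𝓝 u₀, F (u, 0) = 0) :
    ∃ G : E × ℂ → ℂ, (∀ᶠ p in 𝓝 (u₀, (0 : ℂ)), DifferentiableAt ℂ G p) ∧
      ∀ᶠ p in 𝓝 (u₀, (0 : ℂ)), F p = p.2 * G p := by
  have := FiniteDimensional.proper ℂ E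
  obtain ⟨ρ₁, hρ₁, hb₁⟩ := Metric.eventually_nhds_iff_ball.1 hF
  obtain ⟨ρ₂, hρ₂, hb₂⟩ := Metric.eventually_nhds_iff_ball.1 h0
  -- The circle has radius `2 δ` and the points stay within `δ` of the centre, so `‖s - t‖ ≥ δ` on
  -- the circle, and everything remains inside the domain.
  set δ := min ρ₁ ρ₂ / 4 with hδ
  have hδ0 : 0 < δ := by positivity
  have h41 : 4 * δ ≤ ρ₁ := by rw [hδ]; linarith [min_le_left ρ₁ ρ₂]
  have h42 : 4 * δ ≤ ρ₂ := by rw [hδ]; linarith [min_le_right ρ₁ ρ₂]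
  have hFd : ∀ u t, dist u u₀ < 4 * δ → ‖t‖ < 4 * δ → DifferentiableAt ℂ F (u, t) := by
    intro u t hu ht
    refine hb₁ _ ?_
    rw [Metric.mem_ball, Prod.dist_eq, max_lt_iff, dist_zero_right]
    exact ⟨hu.trans_le h41, ht.trans_le h41⟩
  obtain ⟨M, hM⟩ : ∃ M : ℝ, ∀ u t, dist u u₀ ≤ 2 * δ → ‖t‖ ≤ 2 * δ → ‖F (u, t)‖ ≤ M := by
    obtain ⟨M, hM⟩ := (isCompact_closedBall (u₀, (0 : ℂ)) (2 * δ)).exists_bound_of_continuousOn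
      (f := F) (fun p hp => by
        rw [Metric.mem_closedBall, Prod.dist_eq, max_le_iff, dist_zero_right] at hp
        exact (hFd p.1 p.2 (by linarith) (by linarith)).continuousAt.continuousWithinAt)
    refine ⟨M, fun u t hu ht => hM (u, t) ?_⟩
    rw [Metric.mem_closedBall, Prod.dist_eq, max_le_iff, dist_zero_right]
    exact ⟨hu, ht⟩
  have hball : ∀ p ∈ Metric.ball (u₀, (0 : ℂ)) δ, dist p.1 u₀ < δ ∧ ‖p.2‖ < δ := by
    intro p hp
    rwa [Metric.mem_ball, Prod.dist_eq, max_lt_iff, dist_zero_right] at hp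
  have hsub : ∀ p ∈ Metric.ball (u₀, (0 : ℂ)) δ, ∀ s : ℂ, ‖s‖ = 2 * δ → δ ≤ ‖s - p.2‖ := by
    intro p hp s hs
    have h1 := norm_sub_norm_le s p.2
    have h2 := (hball p hp).2
    linarith
  have hs0 : ∀ s : ℂ, ‖s‖ = 2 * δ → s ≠ 0 := fun s hs h => by
    rw [h, norm_zero] at hs
    linarith
  have hps : ∀ p ∈ Metric.ball (u₀, (0 : ℂ)) δ, ∀ s : ℂ, ‖s‖ = 2 * δ → s - p.2 ≠ 0 :=
    fun p hp s hs h => by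
      have := hsub p hp s hs
      rw [h, norm_zero] at this
      linarith
  have hcirc : ∀ θ, ‖circleMap (0 : ℂ) (2 * δ) θ‖ = 2 * δ := fun θ => by
    rw [norm_circleMap_zero, abs_of_pos (by linarith)]
  -- The quotient is the circle integral of this kernel divided by `2πi`. As `t / (s (s - t)) = 1 /
  -- (s - t) - 1 / s`, Cauchy's formula turns `t` times it into `F (u, t) - F (u, 0)`.
  let f : E × ℂ → ℂ → ℂ := fun p s => (s - p.2)⁻¹ * (s⁻¹ * F (p.1, s))
  let k : E × ℂ → ℝ → ℂ := fun p θ => deriv (circleMap 0 (2 * δ)) θ •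
    f p (circleMap 0 (2 * δ) θ)
  have hfd : ∀ s : ℂ, ‖s‖ = 2 * δ →
      DifferentiableOn ℂ (fun p => f p s) (Metric.ball (u₀, (0 : ℂ)) δ) := by
    intro s hs p hp
    have h1 : DifferentiableAt ℂ (fun p : E × ℂ => (s - p.2)⁻¹) p :=
      ((differentiableAt_const s).sub differentiableAt_snd).inv (hps p hp s hs)
    have h2 : DifferentiableAt ℂ (fun p : E × ℂ => F (p.1, s)) p :=
      (hFd p.1 s (by linarith [(hball p hp).1]) (by linarith)).comp p
        (differentiableAt_fst.prodMk (differentiableAt_const s))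
    exact (h1.mul ((differentiableAt_const _).mul h2)).differentiableWithinAt
  have hfc : ∀ p ∈ Metric.ball (u₀, (0 : ℂ)) δ,
      ContinuousOn (f p) (Metric.sphere 0 (2 * δ)) := by
    intro p hp s hs
    have hs' : ‖s‖ = 2 * δ := by simpa using hs
    have h1 : ContinuousAt (fun s : ℂ => (s - p.2)⁻¹) s :=
      (continuousAt_id.sub continuousAt_const).inv₀ (hps p hp s hs')
    have h2 : ContinuousAt (fun s : ℂ => F (p.1, s)) s :=
      (hFd p.1 s (by linarith [(hball p hp).1]) (by linarith)).continuousAt.comp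
        (f := fun s : ℂ => (p.1, s)) (by fun_prop)
    exact (h1.mul ((continuousAt_inv₀ (hs0 s hs')).mul h2)).continuousWithinAt
  have hk : DifferentiableOn ℂ (fun p => ∫ θ in Set.Ioc 0 (2 * Real.pi), k p θ)
      (Metric.ball (u₀, (0 : ℂ)) δ) := by
    refine differentiableOn_integral_of_bounded (C := 2 * δ * (δ⁻¹ * ((2 * δ)⁻¹ * M)))
      (fun θ => ?_) (fun p hp => ?_) (fun p hp θ => ?_)
    · exact (hfd _ (hcirc θ)).const_smul (deriv (circleMap (0 : ℂ) (2 * δ)) θ)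
    · have h1 : Continuous (deriv (circleMap (0 : ℂ) (2 * δ))) := by
        have : deriv (circleMap (0 : ℂ) (2 * δ)) = fun θ => circleMap 0 (2 * δ) θ * Complex.I :=
          funext fun θ => deriv_circleMap 0 _ θ
        rw [this]
        exact (continuous_circleMap _ _).mul continuous_const
      exact h1.smul ((hfc p hp).comp_continuous (continuous_circleMap _ _)
        fun θ => by simpa using hcirc θ)
    · have h1 : ‖circleMap (0 : ℂ) (2 * δ) θ‖ = 2 * δ := hcirc θ
      simp only [k, f, deriv_circleMap, norm_smul, norm_mul, Complex.norm_I, mul_one, norm_inv, h1]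
      have h2 := hsub p hp _ h1
      have h3 := hM p.1 (circleMap 0 (2 * δ) θ) (by linarith [(hball p hp).1]) h1.le
      gcongr
  have hkc : ∀ p, ∫ θ in Set.Ioc 0 (2 * Real.pi), k p θ = circleIntegral (f p) 0 (2 * δ) :=
    fun p => (intervalIntegral.integral_of_le Real.two_pi_pos.le).symm
  refine ⟨fun p => (2 * Real.pi * Complex.I : ℂ)⁻¹ * circleIntegral (f p) 0 (2 * δ), ?_, ?_⟩
  · simp only [hkc] at hk
    filter_upwards [Metric.ball_mem_nhds (u₀, (0 : ℂ)) hδ0] with p hp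
    exact ((hk.differentiableAt (Metric.isOpen_ball.mem_nhds hp)).const_mul _)
  · filter_upwards [Metric.ball_mem_nhds (u₀, (0 : ℂ)) hδ0] with p hp
    have hFs : DifferentiableOn ℂ (fun s : ℂ => F (p.1, s)) (Metric.closedBall 0 (2 * δ)) := by
      intro s hs
      rw [mem_closedBall_zero_iff] at hs
      exact ((hFd p.1 s (by linarith [(hball p hp).1]) (by linarith)).comp (f := fun s : ℂ => (p.1, s))
        s (by fun_prop)).differentiableWithinAt
    have hci : ∀ w : ℂ, ‖w‖ < 2 * δ → CircleIntegrable (fun s : ℂ => (s - w)⁻¹ • F (p.1, s)) 0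
        (2 * δ) := by
      intro w hw
      have h1 : ContinuousOn (fun s : ℂ => (s - w)⁻¹) (Metric.sphere 0 (2 * δ)) := by
        refine ContinuousOn.inv₀ (by fun_prop) fun s hs h => ?_
        rw [mem_sphere_zero_iff_norm] at hs
        rw [sub_eq_zero] at h
        rw [h] at hs
        linarith
      exact ContinuousOn.circleIntegrable (by linarith)
        (h1.smul (hFs.continuousOn.mono Metric.sphere_subset_closedBall))
    have hp2 : ‖p.2‖ < 2 * δ := by linarith [(hball p hp).2]
    have h1 := hFs.circleIntegral_sub_inv_smul (w := p.2) (by simpa using hp2)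
    have h2 := hFs.circleIntegral_sub_inv_smul (w := 0) (by simpa using hδ0)
    have h3 : F (p.1, 0) = 0 := hb₂ p.1 (by
      rw [Metric.mem_ball]
      linarith [(hball p hp).1])
    have h4 : p.2 * circleIntegral (f p) 0 (2 * δ) =
        circleIntegral (fun s => (s - p.2)⁻¹ • F (p.1, s) - (s - 0)⁻¹ • F (p.1, s)) 0 (2 * δ) := by
      rw [← circleIntegral.integral_const_mul]
      refine circleIntegral.integral_congr (by linarith) fun s hs => ?_
      rw [mem_sphere_zero_iff_norm] at hs
      have e1 := hps p hp s hs
      have e2 := hs0 s hs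
      simp only [smul_eq_mul, sub_zero]
      field_simp
      ring
    rw [circleIntegral.integral_sub (hci _ hp2) (hci 0 (by rw [norm_zero]; linarith)), h1, h2, h3,
      smul_zero, sub_zero, smul_eq_mul] at h4
    rw [mul_left_comm, h4, inv_mul_cancel_left₀ Complex.two_pi_I_ne_zero]

end Division

/-! ### The normal space of the divisor -/

section NormalSpace

variable {W : Subgroup (V ≃ₗᵢ[ℂ] V)} [Finite W]

/-- Derivations depend only on the germs of functions. -/
lemma tangentSpace_apply_congr {ω : Model W} (δ : tangentSpace ω) {f g : localRing ω}
    (h : ∀ᶠ z in 𝓝 ω, f.1 z = g.1 z) : δ.1 f = δ.1 g := by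
  obtain ⟨s, hs, hsub⟩ := (mem_nhds_induced _ _ _).1 h
  obtain ⟨O, hO, hopen, hω⟩ := mem_nhds_iff.1 hs
  classical
  -- The indicator `e` of a neighbourhood is `1` at `ω` and `(f - g) * e = 0` everywhere, so the
  -- Leibniz rule leaves `δ (f - g) = 0`.
  have he : (fun z : Model W => if (z : Ambient W) ∈ O then (1 : ℂ) else 0) ∈ localRing ω :=
    ⟨O, hopen, hω, fun _ => 1, ⟨fun _ => 1, differentiableOn_const _, fun _ _ _ _ => rfl⟩,
      fun z _ hz => if_pos hz⟩
  let e : localRing ω := ⟨_, he⟩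
  have h0 : (f - g) * e = 0 := by
    refine Subtype.ext (funext fun z => ?_)
    change (f.1 z - g.1 z) * (if (z : Ambient W) ∈ O then (1 : ℂ) else 0) = 0
    split_ifs with hz
    · rw [show f.1 z = g.1 z from hsub (hO hz), sub_self, zero_mul]
    · rw [mul_zero]
  have h1 := δ.2 (f - g) e
  have h2 : (f - g).1 ω = 0 := sub_eq_zero.2 (hsub (hO hω))
  have h3 : e.1 ω = 1 := if_pos hω
  rw [h0, h2, h3, map_zero, zero_mul, zero_add, one_mul, map_sub] at h1
  exact (sub_eq_zero.1 h1.symm)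

variable {A : irreducibles W} {a : V}

lemma inner_fst_mem_localRing (a : V) (ω : Model W) :
    (fun z : Model W => inner ℂ a (z : Ambient W).1) ∈ localRing ω := by
  refine ⟨univ, isOpen_univ, mem_univ _, fun z => inner ℂ a z.1,
    ⟨fun m => innerSL ℂ a m.1, ?_, fun z _ m hm => ?_⟩, fun _ _ _ => rfl⟩
  · exact ((innerSL ℂ a).differentiable.comp differentiable_fst).differentiableOn
  · simp only [innerSL_apply_apply, hm.1]

/-- The equation of the divisor in the chart. -/
def equation (a : V) (ω : Model W) : localRing ω := ⟨_, inner_fst_mem_localRing a ω⟩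

/-- The value of a tangent vector at the equation of the divisor. -/
def normalCoord (a : V) (ω : Model W) : tangentSpace ω →ₗ[ℂ] ℂ :=
  LinearMap.applyₗ (equation a ω) ∘ₗ (tangentSpace ω).subtype

lemma normalCoord_apply {ω : Model W} (δ : tangentSpace ω) : normalCoord a ω δ = δ.1 (equation a ω) := rfl

lemma comp_chart_mem_localRing (ha : a ∈ (A : Submodule ℂ V)) (h1 : ‖a‖ = 1) {ω : Model W}
    (hω : ω ∈ chartDomain A a) {G : transversal a × ℂ → ℂ}
    (hG : ∀ᶠ p in 𝓝 (chart A a (ω : Ambient W)), DifferentiableAt ℂ G p) :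
    (fun z : Model W => G (chart A a (z : Ambient W))) ∈ localRing ω := by
  obtain ⟨s, hs, hopen, hmem⟩ := eventually_nhds_iff.1 hG
  have hl := isLift_param_chart ha h1 hω
  exact ⟨_, isOpen_chart_preimage hopen,
    ⟨_, hl, inner_line_ne_zero_of_mem_chartDomain ha h1 hω hl, by rwa [← chart_eq hl]⟩, _,
    holomorphicOn_comp_chart hopen fun p hp => (hs p hp).differentiableWithinAt, fun _ _ _ => rfl⟩

lemma continuousAt_chartPoint {ω₀ z : Model W} {p : transversal a × ℂ}
    (hp : IsLift (param A a p) (z : Ambient W)) :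
    Filter.Tendsto (chartPoint A a ω₀) (𝓝 p) (𝓝 z) := by
  have := (continuousOn_chartPoint ω₀).continuousAt (isOpen_nonzero_param.mem_nhds hp.nonzero)
  rw [ContinuousAt, chartPoint_of_isLift hp] at this
  exact this

lemma chartPoint_chart (ha : a ∈ (A : Submodule ℂ V)) (h1 : ‖a‖ = 1) {ω₀ z : Model W}
    (hz : z ∈ chartDomain A a) : chartPoint A a ω₀ (chart A a (z : Ambient W)) = z :=
  chartPoint_of_isLift (isLift_param_chart ha h1 hz)

lemma IsGeneric.chart_snd_eq {ω : Model W} (h : IsGeneric W (A : Submodule ℂ V) ω)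
    (ha : a ∈ (A : Submodule ℂ V)) (h1 : ‖a‖ = 1) (hω : ω ∈ chartDomain A a) :
    (chart A a (ω : Ambient W)).2 = 0 :=
  (h.mem_divisor_iff ha h1 hω hω).1 h.1

/-- Near `ω` a function that vanishes on the divisor is a multiple of the equation. The equation is
zero at `ω`, so a derivation that kills it kills all its multiples. -/
lemma IsGeneric.ker_normalCoord {ω : Model W} (h : IsGeneric W (A : Submodule ℂ V) ω)
    (ha : a ∈ (A : Submodule ℂ V)) (h1 : ‖a‖ = 1) (hω : ω ∈ chartDomain A a) :
    LinearMap.ker (normalCoord a ω) = tangentSubspace (divisor W (A : Submodule ℂ V)) ω := by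
  have hopen := isOpen_chartDomain h1 ha
  ext δ
  rw [LinearMap.mem_ker, normalCoord_apply]
  constructor
  · intro hδ f hf
    set u₀ := (chart A a (ω : Ambient W)).1
    have hp₀ : chart A a (ω : Ambient W) = (u₀, 0) :=
      Prod.ext rfl (h.chart_snd_eq ha h1 hω)
    have hl := isLift_param_chart ha h1 hω
    obtain ⟨g, hg, hfg⟩ := HolomorphicAt.eventually_differentiableAt f.2 hl ω
    have hlim := continuousAt_chartPoint (ω₀ := ω) hl
    rw [hp₀] at hg hfg hlim
    have hzero : ∀ᶠ u in 𝓝 u₀, g (u, 0) = 0 := by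
      have hi : Filter.Tendsto (fun u : transversal a => (u, (0 : ℂ))) (𝓝 u₀) (𝓝 (u₀, 0)) :=
        Continuous.tendsto (by fun_prop) u₀
      filter_upwards [hi.eventually hfg, hi.eventually (hlim.eventually hf),
        hi.eventually (hlim.eventually (hopen.mem_nhds hω)),
        hi.eventually (isOpen_nonzero_param.mem_nhds (hp₀ ▸ hl.nonzero))] with u h2 h3 h4 h5
      rw [← h2 trivial]
      refine h3 ((h.mem_divisor_iff ha h1 hω h4).2 ?_)
      rw [chart_of_isLift_param ha h1 (isLift_chartPoint h5)]
    obtain ⟨G, hG, hgG⟩ := exists_eq_mul_of_vanishing hg hzero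
    have hGm := comp_chart_mem_localRing ha h1 hω (hp₀ ▸ hG)
    have hc := continuousAt_chart h1 ha hω
    rw [ContinuousAt, hp₀] at hc
    have hf2 : ∀ᶠ z in 𝓝 ω, f.1 z = (equation a ω * ⟨_, hGm⟩ : localRing ω).1 z := by
      filter_upwards [hopen.mem_nhds hω, hc.eventually hfg, hc.eventually hgG] with z h2 h3 h4
      rw [chartPoint_chart ha h1 h2] at h3
      rw [h3 trivial, h4, chart_snd]
      rfl
    rw [tangentSpace_apply_congr δ hf2, δ.2, hδ, mul_zero, add_zero]
    have h5 : (equation a ω).1 ω = 0 := by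
      have := h.chart_snd_eq ha h1 hω
      rwa [chart_snd] at this
    rw [h5, zero_mul]
  · intro hδ
    refine hδ _ ?_
    filter_upwards [hopen.mem_nhds hω] with z hz hzD
    have := (h.mem_divisor_iff ha h1 hω hz).1 hzD
    rwa [chart_snd] at this

/-- The derivative along the curve on which only the last chart coordinate varies. -/
lemma exists_normalCoord_eq_one (ha : a ∈ (A : Submodule ℂ V)) (h1 : ‖a‖ = 1) {ω : Model W}
    (hω : ω ∈ chartDomain A a) : ∃ δ : tangentSpace ω, normalCoord a ω δ = 1 := by
  set p₀ := chart A a (ω : Ambient W) with hp₀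
  have hl : IsLift (param A a p₀) (ω : Ambient W) := isLift_param_chart ha h1 hω
  let γ : ℂ → Model W := fun t => chartPoint A a ω (p₀.1, t)
  have hγ : γ p₀.2 = ω := chartPoint_chart ha h1 hω
  have hi : Filter.Tendsto (fun t : ℂ => (p₀.1, t)) (𝓝 p₀.2) (𝓝 p₀) :=
    Continuous.tendsto (by fun_prop) p₀.2
  have hd : ∀ f : localRing ω, DifferentiableAt ℂ (fun t => f.1 (γ t)) p₀.2 := by
    intro f
    obtain ⟨g, hg, hfg⟩ := HolomorphicAt.eventually_differentiableAt f.2 hl ω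
    have h2 : DifferentiableAt ℂ (fun t => g (p₀.1, t)) p₀.2 :=
      hg.self_of_nhds.comp (f := fun t : ℂ => (p₀.1, t)) p₀.2 (by fun_prop)
    refine h2.congr_of_eventuallyEq ?_
    filter_upwards [hi.eventually hfg] with t ht
    exact ht trivial
  let δ : localRing ω →ₗ[ℂ] ℂ :=
    { toFun := fun f => deriv (fun t => f.1 (γ t)) p₀.2
      map_add' := fun f g => deriv_add (hd f) (hd g)
      map_smul' := fun c f => deriv_const_smul c (hd f) }
  refine ⟨⟨δ, fun f g => ?_⟩, ?_⟩
  · have h2 := deriv_mul (hd f) (hd g)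
    simp only [hγ] at h2
    change deriv ((fun t => f.1 (γ t)) * fun t => g.1 (γ t)) p₀.2 = _
    rw [h2]
    change _ = f.1 ω * deriv (fun t => g.1 (γ t)) p₀.2 + g.1 ω * deriv (fun t => f.1 (γ t)) p₀.2
    ring
  · change deriv (fun t => (equation a ω).1 (γ t)) p₀.2 = 1
    have h2 : (fun t => (equation a ω).1 (γ t)) =ᶠ[𝓝 p₀.2] id := by
      filter_upwards [hi.eventually (isOpen_nonzero_param.mem_nhds hl.nonzero)] with t ht
      have h3 := chart_of_isLift_param ha h1 (isLift_chartPoint (ω₀ := ω) ht)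
      have h4 := congrArg Prod.snd h3
      rw [chart_snd] at h4
      exact h4
    rw [h2.deriv_eq, deriv_id]

lemma IsGeneric.finrank_normalSpace {ω : Model W} (h : IsGeneric W (A : Submodule ℂ V) ω) :
    Module.finrank ℂ (NormalSpace (divisor W (A : Submodule ℂ V)) ω) = 1 := by
  obtain ⟨a, ha, h1, hω⟩ := h.exists_chart
  have hsurj : Function.Surjective (normalCoord a ω) := by
    obtain ⟨δ, hδ⟩ := exists_normalCoord_eq_one ha h1 hω
    exact fun c => ⟨c • δ, by rw [map_smul, hδ, smul_eq_mul, mul_one]⟩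
  change Module.finrank ℂ (tangentSpace ω ⧸ tangentSubspace (divisor W (A : Submodule ℂ V)) ω) = 1
  rw [← h.ker_normalCoord ha h1 hω,
    ((normalCoord a ω).quotKerEquivOfSurjective hsurj).finrank_eq, Module.finrank_self]

/-- An element that is scalar on `A` and trivial on `Aᗮ` acts on the normal space as this scalar. -/
lemma IsGeneric.differential_sub_smul_mem {ω : Model W} (h : IsGeneric W (A : Submodule ℂ V) ω)
    {w : W} {c : ℂ} (hc : ∀ v ∈ (A : Submodule ℂ V), (w : V ≃ₗᵢ[ℂ] V) v = c • v)
    (hw : ∀ v ∈ (A : Submodule ℂ V)ᗮ, (w : V ≃ₗᵢ[ℂ] V) v = v) (hω : w • ω = ω)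
    (δ : tangentSpace ω) :
    differential w ω hω δ - c • δ ∈ tangentSubspace (divisor W (A : Submodule ℂ V)) ω := by
  obtain ⟨a, ha, h1, hch⟩ := h.exists_chart
  rw [← h.ker_normalCoord ha h1 hch, LinearMap.mem_ker, map_sub, map_smul]
  -- The equation is `⟨a, ·⟩` with `a` in `A`, so the element multiplies it by `c`.
  have h2 : pullback w ω hω (equation a ω) = c • equation a ω := by
    refine Subtype.ext (funext fun z => ?_)
    change inner ℂ a ((w : V ≃ₗᵢ[ℂ] V) (z : Ambient W).1) = c • inner ℂ a (z : Ambient W).1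
    rw [apply_eq_scaleIn hc hw, inner_scaleIn ha, smul_eq_mul]
  have h3 : normalCoord a ω (differential w ω hω δ) = δ.1 (pullback w ω hω (equation a ω)) := rfl
  rw [h3, h2, map_smul, normalCoord_apply, sub_self]

end NormalSpace

/-! ### A chart of the quotient of the divisor -/

section QuotientChart

variable {W : Subgroup (V ≃ₗᵢ[ℂ] V)} [Finite W] {A : irreducibles W} {a : V}

instance continuousConstSMul_model : ContinuousConstSMul W (Model W) := ⟨continuous_smul_model⟩

lemma continuous_toQuotient : Continuous (toQuotient W) := continuous_quotient_mk'

lemma isOpenMap_toQuotient : IsOpenMap (toQuotient W) :=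
  isOpenMap_quotient_mk'_mul (Γ := W) (T := Model W)

/-- A Springer generic point has a neighbourhood on whose intersection with the divisor the quotient
map is injective. -/
lemma IsSpringerGeneric.exists_slice (hW : IsReflectionGroup W) {ω : Model W}
    (h : IsSpringerGeneric W A ω) (ha : a ∈ (A : Submodule ℂ V)) (h1 : ‖a‖ = 1)
    (hω : ω ∈ chartDomain A a) :
    ∃ O : Set (Model W), IsOpen O ∧ ω ∈ O ∧ O ⊆ chartDomain A a ∧ ∀ z ∈ O, ∀ z' ∈ O,
      toQuotient W z ∈ quotientDivisor W (A : Submodule ℂ V) →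
      toQuotient W z = toQuotient W z' → z = z' := by
  -- On a small neighbourhood only elements of the stabilizer of `ω` can identify points, and these
  -- fix the divisor pointwise in the chart.
  have hsep : ∀ w : W, ∃ U : Set (Model W), IsOpen U ∧ ω ∈ U ∧
      ∀ z ∈ U, w • z ∈ U → w • ω = ω := by
    intro w
    by_cases hw : w • ω = ω
    · exact ⟨univ, isOpen_univ, mem_univ _, fun _ _ _ => hw⟩
    · obtain ⟨P, Q, hP, hQ, hωP, hwQ, hdisj⟩ := t2_separation (Ne.symm hw)
      exact ⟨P ∩ (fun z => w • z) ⁻¹' Q, hP.inter (hQ.preimage (continuous_smul_model w)),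
        ⟨hωP, hwQ⟩, fun z hz hz' => (Set.disjoint_left.1 hdisj hz'.1 hz.2).elim⟩
  choose U hU hωU hsepU using hsep
  refine ⟨(⋂ w, U w) ∩ chartDomain A a, (isOpen_iInter_of_finite hU).inter
    (isOpen_chartDomain h1 ha), ⟨Set.mem_iInter.2 hωU, hω⟩, Set.inter_subset_right, ?_⟩
  rintro z ⟨hz, hzc⟩ z' ⟨hz', hzc'⟩ hzL e
  obtain ⟨g, rfl⟩ := toQuotient_eq_iff.1 e
  have hg := hsepU g z' (Set.mem_iInter.1 hz' g) (Set.mem_iInter.1 hz g)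
  obtain ⟨hpar, c, hc⟩ := h.exists_scalar hW hg
  exact smul_eq_of_chart_snd ha h1 hzc'
    ((h.1.mem_quotientDivisor_iff ha h1 hω hzc').1 (e ▸ hzL)) hpar hc

lemma HolomorphicAt.smul {Z : Set (Model W)} {f : Model W → ℂ} {ω : Model W}
    (hf : HolomorphicAt Z f ω) (w : W) (hZ : ∀ z ∈ Z, w⁻¹ • z ∈ Z)
    (hfw : ∀ z, f (w⁻¹ • z) = f z) : HolomorphicAt Z f (w • ω) := by
  obtain ⟨U, hU, hω, F, ⟨F', h1, h2⟩, e⟩ := hf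
  refine ⟨(fun z => w⁻¹ • z) ⁻¹' U, hU.preimage (continuous_smul_ambient w⁻¹), ?_,
    fun z => F (w⁻¹ • z), ⟨fun m => F' (coordMap w⁻¹ m), ?_, ?_⟩, ?_⟩
  · change w⁻¹ • (w • (ω : Ambient W)) ∈ U
    rwa [inv_smul_smul]
  · refine h1.comp ?_ ?_
    · exact (LinearMap.toContinuousLinearMap (coordMap w⁻¹)).differentiable.differentiableOn
    · rintro m ⟨z, hz, hm⟩
      exact ⟨w⁻¹ • z, hz, hm.smul w⁻¹⟩
  · exact fun z hz m hm => h2 _ hz _ (hm.smul w⁻¹)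
  · intro z hz hzU
    rw [← hfw z]
    exact e (w⁻¹ • z) (hZ z hz) hzU

lemma toQuotient_smul (w : W) (z : Model W) : toQuotient W (w • z) = toQuotient W z :=
  toQuotient_eq_iff.2 ⟨w, rfl⟩

/-- Holomorphy on the quotient can be tested at one preimage. -/
lemma holomorphicAtQuotient_iff {L : Set (QuotientModel W)} {f : QuotientModel W → ℂ}
    {ω : Model W} : HolomorphicAtQuotient L f (toQuotient W ω) ↔
      HolomorphicAt (toQuotient W ⁻¹' L) (f ∘ toQuotient W) ω := by
  refine ⟨fun h => h ω rfl, fun h ω' e => ?_⟩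
  obtain ⟨w, rfl⟩ := toQuotient_eq_iff.1 e
  refine h.smul w (fun z hz => ?_) fun z => ?_
  · rwa [Set.mem_preimage, toQuotient_smul]
  · rw [Function.comp_apply, toQuotient_smul, Function.comp_apply]

lemma finrank_transversal (h1 : ‖a‖ = 1) :
    Module.finrank ℂ (transversal a) = Module.finrank ℂ V - 1 := by
  have ha0 : a ≠ 0 := fun h0 => by simp [h0] at h1
  have h2 := Submodule.finrank_add_finrank_orthogonal (Submodule.span ℂ {a})
  rw [finrank_span_singleton ha0] at h2
  exact eq_tsub_of_add_eq ((add_comm _ _).trans h2)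

/-- The slice `t = 0` in `O` is mapped injectively, and by an open map, to a neighbourhood in `L`.
So the first chart coordinate, in `transversal a`, becomes a chart of `L`. -/
lemma isSmoothAt_of_slice (ha : a ∈ (A : Submodule ℂ V)) (h1 : ‖a‖ = 1) {ω : Model W}
    {L : Set (QuotientModel W)} {O : Set (Model W)} (hO : IsOpen O) (hωO : ω ∈ O)
    (hsub : O ⊆ chartDomain A a) (hωL : toQuotient W ω ∈ L)
    (hL : ∀ z ∈ chartDomain A a, toQuotient W z ∈ L ↔ (chart A a (z : Ambient W)).2 = 0)
    (hinj : ∀ z ∈ O, ∀ z' ∈ O, toQuotient W z ∈ L → toQuotient W z = toQuotient W z' → z = z') :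
    IsSmoothAt L (toQuotient W ω) (Module.finrank ℂ V - 1) := by
  classical
  let e : transversal a ≃L[ℂ] (Fin (Module.finrank ℂ V - 1) → ℂ) :=
    ContinuousLinearEquiv.ofFinrankEq (by rw [finrank_transversal h1, Module.finrank_fin_fun])
  let pt : (Fin (Module.finrank ℂ V - 1) → ℂ) → Model W := fun x =>
    chartPoint A a ω (e.symm x, 0)
  let good : Set (Fin (Module.finrank ℂ V - 1) → ℂ) :=
    {x | ∀ D, (param A a (e.symm x, 0)).2 D ≠ 0}
  have hincl : Continuous fun x : Fin (Module.finrank ℂ V - 1) → ℂ => (e.symm x, (0 : ℂ)) := by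
    fun_prop
  have hgood : IsOpen good := isOpen_nonzero_param.preimage hincl
  have hptc : ContinuousOn pt good :=
    (continuousOn_chartPoint ω).comp hincl.continuousOn fun x hx => hx
  let tgt : Set (Fin (Module.finrank ℂ V - 1) → ℂ) := good ∩ pt ⁻¹' O
  have htgt : IsOpen tgt := hptc.isOpen_inter_preimage hgood hO
  have hchart : ∀ x ∈ tgt, chart A a (pt x : Ambient W) = (e.symm x, 0) := fun x hx =>
    chart_of_isLift_param ha h1 (isLift_chartPoint hx.1)
  have hptL : ∀ x ∈ tgt, toQuotient W (pt x) ∈ L := fun x hx =>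
    (hL _ (hsub hx.2)).2 (by rw [hchart x hx])
  have hzero : ∀ z ∈ O, toQuotient W z ∈ L →
      (e.symm (e (chart A a (z : Ambient W)).1), (0 : ℂ)) = chart A a (z : Ambient W) :=
    fun z hz hzL => Prod.ext (e.symm_apply_apply _) ((hL z (hsub hz)).1 hzL).symm
  have hpt : ∀ z ∈ O, toQuotient W z ∈ L → pt (e (chart A a (z : Ambient W)).1) = z :=
    fun z hz hzL => by
      change chartPoint A a ω (e.symm (e (chart A a (z : Ambient W)).1), 0) = z
      rw [hzero z hz hzL, chartPoint_chart ha h1 (hsub hz)]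
  have hmemtgt : ∀ z ∈ O, toQuotient W z ∈ L → e (chart A a (z : Ambient W)).1 ∈ tgt := by
    intro z hz hzL
    refine ⟨?_, ?_⟩
    · change ∀ D, (param A a (e.symm (e (chart A a (z : Ambient W)).1), 0)).2 D ≠ 0
      rw [hzero z hz hzL]
      exact (isLift_param_chart ha h1 (hsub hz)).nonzero
    · rw [Set.mem_preimage, hpt z hz hzL]
      exact hz
  let src : Set L := {y | ∃ z ∈ O, toQuotient W z = y}
  have hsrc : IsOpen src := by
    have : src = Subtype.val ⁻¹' (toQuotient W '' O) := rfl
    rw [this]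
    exact (isOpenMap_toQuotient O hO).preimage continuous_subtype_val
  -- Outside `src` the value `ω` is a default; on `src` the representative in `O` is unique by
  -- `hinj`.
  let rep : L → Model W := fun y => if h : ∃ z ∈ O, toQuotient W z = y then h.choose else ω
  have hrep : ∀ y ∈ src, rep y ∈ O ∧ toQuotient W (rep y) = y := by
    intro y hy
    have hy' : ∃ z ∈ O, toQuotient W z = y := hy
    simp only [rep, dif_pos hy']
    exact hy'.choose_spec
  have huniq : ∀ (y : L), ∀ z ∈ O, toQuotient W z = y → rep y = z := by
    intro y z hz hzy
    have h2 := hrep y ⟨z, hz, hzy⟩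
    exact hinj _ h2.1 z hz (by rw [h2.2]; exact y.2) (h2.2.trans hzy.symm)
  let inv : (Fin (Module.finrank ℂ V - 1) → ℂ) → L := fun x =>
    if h : toQuotient W (pt x) ∈ L then ⟨_, h⟩ else ⟨_, hωL⟩
  have hinv : ∀ x ∈ tgt, (inv x : QuotientModel W) = toQuotient W (pt x) := by
    intro x hx
    simp only [inv, dif_pos (hptL x hx)]
  let φ : OpenPartialHomeomorph L (Fin (Module.finrank ℂ V - 1) → ℂ) :=
    { toFun := fun y => e (chart A a (rep y : Ambient W)).1
      invFun := inv
      source := src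
      target := tgt
      map_source' := fun y hy => hmemtgt _ (hrep y hy).1 (by rw [(hrep y hy).2]; exact y.2)
      map_target' := fun x hx => ⟨pt x, hx.2, (hinv x hx).symm⟩
      left_inv' := fun y hy => by
        have hy' : toQuotient W (rep y) ∈ L := by rw [(hrep y hy).2]; exact y.2
        refine Subtype.ext ?_
        rw [hinv _ (hmemtgt _ (hrep y hy).1 hy'), hpt _ (hrep y hy).1 hy', (hrep y hy).2]
      right_inv' := fun x hx => by
        rw [huniq (inv x) (pt x) hx.2 (hinv x hx).symm, hchart x hx, e.apply_symm_apply]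
      open_source := hsrc
      open_target := htgt
      continuousOn_toFun := by
        rw [continuousOn_open_iff hsrc]
        intro T hT
        have hopen : IsOpen (O ∩ (fun z : Model W => e (chart A a (z : Ambient W)).1) ⁻¹' T) := by
          refine ContinuousOn.isOpen_inter_preimage (fun z hz => ?_) hO hT
          exact ((e.continuous.comp continuous_fst).continuousAt.comp
            (continuousAt_chart h1 ha (hsub hz))).continuousWithinAt
        convert (isOpenMap_toQuotient _ hopen).preimage (continuous_subtype_val (p := (· ∈ L)))
          using 1
        ext y
        constructor
        · rintro ⟨hy, hyT⟩
          exact ⟨rep y, ⟨(hrep y hy).1, hyT⟩, (hrep y hy).2⟩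
        · rintro ⟨z, ⟨hz, hzT⟩, hzy⟩
          refine ⟨⟨z, hz, hzy⟩, ?_⟩
          rw [Set.mem_preimage, huniq y z hz hzy]
          exact hzT
      continuousOn_invFun := by
        rw [Topology.IsInducing.subtypeVal.continuousOn_iff]
        refine ContinuousOn.congr (f := fun x => toQuotient W (pt x)) ?_ hinv
        exact continuous_toQuotient.comp_continuousOn (hptc.mono Set.inter_subset_left) }
  refine ⟨hωL, φ, ⟨ω, hωO, rfl⟩, fun f y hy => ?_⟩
  obtain ⟨hz, hzy⟩ := hrep y hy
  set z := rep y
  have hzL : toQuotient W z ∈ L := by rw [hzy]; exact y.2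
  have hφ : φ y = e (chart A a (z : Ambient W)).1 := rfl
  have hxt : φ y ∈ tgt := hmemtgt z hz hzL
  have hsymm : ∀ x ∈ tgt, (φ.symm x : QuotientModel W) = toQuotient W (pt x) := hinv
  have hl := isLift_param_chart ha h1 (hsub hz)
  rw [← hzy, holomorphicAtQuotient_iff]
  constructor
  · intro hf
    obtain ⟨g, hg, hfg⟩ := hf.eventually_differentiableAt hl ω
    have hlim : Filter.Tendsto (fun x : Fin (Module.finrank ℂ V - 1) → ℂ => (e.symm x, (0 : ℂ)))
        (𝓝 (φ y)) (𝓝 (chart A a (z : Ambient W))) := by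
      have := hincl.tendsto (φ y)
      rwa [hφ, hzero z hz hzL] at this
    have hev : ∀ᶠ x in 𝓝 (φ y), f (φ.symm x) = g (e.symm x, 0) := by
      filter_upwards [htgt.mem_nhds hxt, hlim.eventually hfg] with x hx h2
      rw [hsymm x hx]
      exact h2 (hptL x hx)
    filter_upwards [eventually_eventually_nhds.2 hev, hlim.eventually hg] with x hx h2
    refine DifferentiableAt.congr_of_eventuallyEq ?_ hx
    exact h2.comp (f := fun x => (e.symm x, (0 : ℂ))) x
      (e.symm.differentiableAt.prodMk (differentiableAt_const _))
  · intro hd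
    obtain ⟨T, hT, hTopen, hyT⟩ := eventually_nhds_iff.1 hd
    obtain ⟨O', hO', hOO'⟩ := isOpen_induced_iff.1 hO
    let s : Set (transversal a × ℂ) := {p | e p.1 ∈ T}
    have hs : IsOpen s := hTopen.preimage (e.continuous.comp continuous_fst)
    -- A holomorphic function on the slice is extended as a function independent of `t`.
    have hol := holomorphicOn_comp_chart (A := A) hs (g := fun p => f (φ.symm (e p.1)))
      fun p hp => ((hT _ hp).comp (f := fun p : transversal a × ℂ => e p.1) p
        (e.differentiableAt.comp p differentiableAt_fst)).differentiableWithinAt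
    refine ⟨_, (isOpen_chart_preimage (A := A) hs).inter hO', ⟨⟨_, hl,
      inner_line_ne_zero_of_mem_chartDomain ha h1 (hsub hz) hl, ?_⟩, ?_⟩, _,
      hol.inter_left, ?_⟩
    · rw [← chart_eq hl]
      exact hyT
    · have : z ∈ Subtype.val ⁻¹' O' := hOO' ▸ hz
      exact this
    · rintro z' hz'L ⟨-, hz'O⟩
      have hz' : z' ∈ O := hOO' ▸ hz'O
      change f (toQuotient W z') = f (φ.symm (e (chart A a (z' : Ambient W)).1))
      rw [hsymm _ (hmemtgt z' hz' hz'L), hpt z' hz' hz'L]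

lemma IsSpringerGeneric.isSmoothAt (hW : IsReflectionGroup W) {ω : Model W}
    (h : IsSpringerGeneric W A ω) :
    IsSmoothAt (quotientDivisor W (A : Submodule ℂ V)) (toQuotient W ω)
      (Module.finrank ℂ V - 1) := by
  obtain ⟨a, ha, h1, hω⟩ := h.1.exists_chart
  obtain ⟨O, hO, hωO, hsub, hinj⟩ := h.exists_slice hW ha h1 hω
  exact isSmoothAt_of_slice ha h1 hO hωO hsub
    ((h.1.mem_quotientDivisor_iff ha h1 hω hω).2 (h.1.chart_snd_eq ha h1 hω))
    (fun z hz => h.1.mem_quotientDivisor_iff ha h1 hω hz) hinj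

end QuotientChart

end Wonderful

end

theorem mainTheorem10 {V : Type*} [NormedAddCommGroup V] [InnerProductSpace ℂ V]
    [FiniteDimensional ℂ V] (W : Subgroup (V ≃ₗᵢ[ℂ] V)) [Finite W]
    (hW : Wonderful.IsReflectionGroup W) (hirr : Wonderful.ActsIrreducibly W)
    (A : Wonderful.irreducibles W) :
    (∀ y : Wonderful.QuotientModel W, Wonderful.IsSpringerGenericQuotient W A y →
      Wonderful.IsSmoothAt (Wonderful.quotientDivisor W A) y (Module.finrank ℂ V - 1)) ∧
    ∀ ω : Wonderful.Model W, Wonderful.IsSpringerGeneric W A ω →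
      (MulAction.stabilizer W ω).map W.subtype =
        (Subgroup.center (Wonderful.parabolic W A)).map (Wonderful.parabolic W A).subtype ∧
      Module.finrank ℂ (Wonderful.NormalSpace (Wonderful.divisor W A) ω) = 1 ∧
      ∃ (ρ : W) (ε : ℂ) (hρ : ρ • ω = ω),
        Subgroup.zpowers ρ = MulAction.stabilizer W ω ∧
        IsPrimitiveRoot ε (Nat.card (Subgroup.center (Wonderful.parabolic W A))) ∧
        (∀ v ∈ (A : Submodule ℂ V), (ρ : V ≃ₗᵢ[ℂ] V) v = ε • v) ∧
        (∀ v ∈ (A : Submodule ℂ V)ᗮ, (ρ : V ≃ₗᵢ[ℂ] V) v = v) ∧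
        ∀ δ : Wonderful.tangentSpace ω, Wonderful.differential ρ ω hρ δ - ε • δ ∈
          Wonderful.tangentSubspace (Wonderful.divisor W A) ω := by
  refine ⟨?_, fun ω h => ⟨h.map_stabilizer hW, h.1.finrank_normalSpace, ?_⟩⟩
  · rintro _ ⟨ω, h, rfl⟩
    exact h.isSmoothAt hW
  · obtain ⟨ρ, ε, hρ, hgen, hprim, hA, hperp⟩ := h.exists_generator hW
    exact ⟨ρ, ε, hρ, hgen, hprim, hA, hperp, h.1.differential_sub_smul_mem hA hperp hρ⟩
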